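/- Let $L>0$. Let $B_1(0)\subset\mathbb R^2$ be the open unit disk and let $$M_L=\{\gamma:[0,L]\to B_1(0)\;:\;\gamma\text{ is a simple closed }C^2\text{-curve},\ |\gamma'|=1\},$$ where a $C^n$-closed curve on $[0,L]$ is a $C^n$ curve all of whose derivatives up to order $n$ agree at $0$ and $L$ (equivalently, its $L$-periodic extension is $C^n$). For $\gamma\in M_L$ set $\mathcal B(\gamma)=\int_0^L|\gamma''(s)|^2\,ds$, and let $m_L=\inf_{M_L}\mathcal B$. **Proposition 2.1.** Let $(\gamma_k)_{k\in\mathbb N}$ be a minimal sequence in $M_L$, i.e. $\gamma_k\in M_L$ for all $k$ and $\mathcal B(\gamma_k)\to m_L$. Then there are a subsequence $(\gamma_{k_j})_{j}$, a curve $\gamma\in W^{2,2}((0,L);\mathbb R^2)$ and a set $E\subset\mathbb R^2$ such that: 1. $\gamma_{k_j}\to\gamma$ weakly in $W^{2,2}((0,L);\mathbb R^2)$ as $j\to\infty$. 2. $\gamma$ is (represented by) a $C^1$-closed curve, $\gamma([0,L])\subset\overline{B_1(0)}$, and $|\gamma'(s)|=1$ for all $s\in[0,L]$. 3. $\gamma$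 can touch the unit circle only tangentially: if $|\gamma(s)|=1$ then $\gamma(s)\cdot\gamma'(s)=0$. 4. $\gamma$ has no transversal crossings, i.e. it can touch itself only tangentially: if $\gamma(s)=\gamma(t)$ then $\gamma'(s)$ and $\gamma'(t)$ span the same line. 5. Let $\mathcal X_k$ be the characteristic function of the open set enclosed by $\gamma_k$ (the bounded component of $\mathbb R^2\setminus\gamma_k([0,L])$). Then $\mathcal X_{k_j}\to\mathcal X_E$ strongly in $L^1(\mathbb R^2)$ as $j\to\infty$. 6. $E\subset\overline{B_1(0)}$, $E$ has finite perimeter, and its (De Giorgi) reduced boundary satisfies $\partial^*E\subset\gamma([0,L])$. 7. After changing the orientation of $\gamma$ if necessary (that is, for $\gamma$ itself or for $s\mapsto\gamma(L-s)$ in place of $\gamma$), for $\mathcal H^1$-almost every $x\in\partial^*E$ the set $\{s\in[0,L):\gamma(s)=x\}$ is finite and $$\nu_E(x)=\sum_{s\in[0,L),\ \gamma(s)=x}\gamma'(s)^\perp,$$ where $\nu_E$ is the inner unit normal of $E$ and $\perp$ is the clockwise rotation by $\pi/2$, $(a,b)^\perp=(b,-a)$. -/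

import Mathlib

open MeasureTheory Set Filter Topology
open scoped ContDiff

noncomputable section

namespace ConfinedElastica

/-! The plane `ℝ²` is represented by `ℂ` with its Euclidean norm, its real inner product
`inner ℝ`, its Lebesgue measure `volume` and its one-dimensional Hausdorff measure `μH[1]`. -/

/-! ### Closed curves, the elastica energy and minimal sequences -/

/-- A `C^n`-closed curve on `[0, L]`: a `C^n` curve whose derivatives up to order `n` agree at the
two end points. It is represented by its `L`-periodic extension to `ℝ`, that is, as a `C^n` map on
the circle of length `L`. -/
def IsClosedCurve (n : ℕ∞) (L : ℝ) (γ : ℝ → ℂ) : Prop :=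
  ContDiff ℝ n γ ∧ Function.Periodic γ L

/-- The class `M_L` of simple closed `C²` curves of length `L` in the open unit disk,
parametrized by arclength. -/
def admissible (L : ℝ) : Set (ℝ → ℂ) :=
  {γ | IsClosedCurve 2 L γ ∧ InjOn γ (Ico 0 L) ∧ (∀ s ∈ Icc 0 L, ‖deriv γ s‖ = 1) ∧
    ∀ s ∈ Icc 0 L, γ s ∈ Metric.ball (0 : ℂ) 1}

/-- Euler's elastica energy `∫_0^L |γ''|²`. -/
def bendingEnergy (L : ℝ) (γ : ℝ → ℂ) : ℝ :=
  ∫ s in (0 : ℝ)..L, ‖iteratedDeriv 2 γ s‖ ^ 2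

/-- The optimal value `m_L`. -/
def optimalValue (L : ℝ) : ℝ :=
  sInf (bendingEnergy L '' admissible L)

/-- A minimal (minimizing) sequence in `M_L`. -/
def IsMinimalSequence (L : ℝ) (γ : ℕ → ℝ → ℂ) : Prop :=
  (∀ k, γ k ∈ admissible L) ∧
    Tendsto (fun k => bendingEnergy L (γ k)) atTop (𝓝 (optimalValue L))

/-! ### The Sobolev space `W^{2,2}` and its weak topology -/

/-- `L²((0, L); ℝ²)`. -/
abbrev LTwo (L : ℝ) : Type := Lp ℂ 2 (volume.restrict (Ioo (0 : ℝ) L))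

/-- Smooth real test functions with compact support in `(0, L)`. -/
def IsTest (L : ℝ) (φ : ℝ → ℝ) : Prop :=
  ContDiff ℝ ∞ φ ∧ HasCompactSupport φ ∧ tsupport φ ⊆ Ioo (0 : ℝ) L

/-- `g` is the weak derivative of `f` on `(0, L)`. -/
def IsWeakDeriv (L : ℝ) (f g : LTwo L) : Prop :=
  ∀ φ : ℝ → ℝ, IsTest L φ →
    ∫ s in Ioo (0 : ℝ) L, deriv φ s • f s = -∫ s in Ioo (0 : ℝ) L, φ s • g s

theorem integrable_smul_of_test {L : ℝ} {ψ : ℝ → ℝ} (hc : Continuous ψ)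
    (hs : HasCompactSupport ψ) (f : LTwo L) :
    Integrable (fun s => ψ s • f s) (volume.restrict (Ioo (0 : ℝ) L)) := by
  have hf : Integrable f (volume.restrict (Ioo (0 : ℝ) L)) :=
    (Lp.memLp f).integrable (by norm_num)
  obtain ⟨C, hC⟩ := hs.exists_bound_of_continuous hc
  exact hf.bdd_smul C hc.aestronglyMeasurable (Eventually.of_forall hC)

theorem integral_smul_add {L : ℝ} {ψ : ℝ → ℝ} (hc : Continuous ψ) (hs : HasCompactSupport ψ)
    (f g : LTwo L) :
    ∫ s in Ioo (0 : ℝ) L, ψ s • (f + g : LTwo L) s =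
      (∫ s in Ioo (0 : ℝ) L, ψ s • f s) + ∫ s in Ioo (0 : ℝ) L, ψ s • g s := by
  rw [← integral_add (integrable_smul_of_test hc hs f) (integrable_smul_of_test hc hs g)]
  apply integral_congr_ae
  filter_upwards [Lp.coeFn_add f g] with s hs'
  rw [hs', Pi.add_apply, smul_add]

theorem integral_smul_smul {L : ℝ} (ψ : ℝ → ℝ) (c : ℝ) (f : LTwo L) :
    ∫ s in Ioo (0 : ℝ) L, ψ s • (c • f : LTwo L) s =
      c • ∫ s in Ioo (0 : ℝ) L, ψ s • f s := by
  rw [← integral_smul]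
  apply integral_congr_ae
  filter_upwards [Lp.coeFn_smul c f] with s hs'
  rw [hs', Pi.smul_apply, smul_comm]

theorem isWeakDeriv_zero (L : ℝ) : IsWeakDeriv L 0 0 := by
  intro φ _
  have h : ∀ ψ : ℝ → ℝ, ∫ s in Ioo (0 : ℝ) L, ψ s • (0 : LTwo L) s = 0 := by
    intro ψ
    have := integral_smul_smul ψ 0 (0 : LTwo L)
    simpa only [zero_smul] using this
  rw [h, h, neg_zero]

theorem IsWeakDeriv.add {L : ℝ} {f g f₁ g₁ : LTwo L} (h : IsWeakDeriv L f g)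
    (h₁ : IsWeakDeriv L f₁ g₁) : IsWeakDeriv L (f + f₁) (g + g₁) := by
  intro φ hφ
  have hd : Continuous (deriv φ) := hφ.1.continuous_deriv (by norm_num)
  rw [integral_smul_add hd hφ.2.1.deriv, integral_smul_add hφ.1.continuous hφ.2.1,
    h φ hφ, h₁ φ hφ, neg_add]

theorem IsWeakDeriv.smul {L : ℝ} {f g : LTwo L} (c : ℝ) (h : IsWeakDeriv L f g) :
    IsWeakDeriv L (c • f) (c • g) := by
  intro φ hφ
  rw [integral_smul_smul, integral_smul_smul, h φ hφ, smul_neg]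

/-- The Sobolev space `W^{2,2}((0, L); ℝ²)`. A function `u` is stored together with its weak
derivatives as the triple `(u, u', u'')` in `L² × L² × L²`; the norm inherited from the product is
equivalent to the usual `W^{2,2}` norm. -/
def W22 (L : ℝ) : Submodule ℝ (LTwo L × LTwo L × LTwo L) where
  carrier := {p | IsWeakDeriv L p.1 p.2.1 ∧ IsWeakDeriv L p.2.1 p.2.2}
  zero_mem' := ⟨isWeakDeriv_zero L, isWeakDeriv_zero L⟩
  add_mem' := fun h h₁ => ⟨h.1.add h₁.1, h.2.add h₁.2⟩
  smul_mem' := fun c _ h => ⟨h.1.smul c, h.2.smul c⟩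

/-- `u : W^{2,2}` is the class of the function `γ`, restricted to `(0, L)`. -/
def Represents {L : ℝ} (u : W22 L) (γ : ℝ → ℂ) : Prop :=
  (u.1.1 : ℝ → ℂ) =ᵐ[volume.restrict (Ioo (0 : ℝ) L)] γ

/-- The functions `γ k` and `γ` belong to `W^{2,2}((0, L); ℝ²)`, and `γ k → γ` in the weak
topology of that space. -/
def WeaklyConvergesW22 (L : ℝ) (γs : ℕ → ℝ → ℂ) (γ : ℝ → ℂ) : Prop :=
  ∃ (u : ℕ → W22 L) (v : W22 L), (∀ k, Represents (u k) (γs k)) ∧ Represents v γ ∧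
    Tendsto (fun k => toWeakSpace ℝ (W22 L) (u k)) atTop (𝓝 (toWeakSpace ℝ (W22 L) v))

/-! ### Contact and the enclosed set -/

/-- The curve touches the unit circle only tangentially: at a contact point its tangent is
orthogonal to the radius. -/
def TouchesCircleTangentially (L : ℝ) (γ : ℝ → ℂ) : Prop :=
  ∀ s ∈ Icc 0 L, ‖γ s‖ = 1 → inner ℝ (γ s) (deriv γ s) = 0

/-- The curve has no transversal crossings: at a self-contact the two tangent lines coincide. -/
def NoTransversalCrossings (L : ℝ) (γ : ℝ → ℂ) : Prop :=
  ∀ s ∈ Icc 0 L, ∀ t ∈ Icc 0 L, γ s = γ t →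
    Submodule.span ℝ {deriv γ s} = Submodule.span ℝ {deriv γ t}

/-- The set enclosed by a curve: the points off its trace which lie in a bounded connected
component of the complement of the trace (for a simple closed curve there is exactly one such
component). -/
def enclosed (L : ℝ) (γ : ℝ → ℂ) : Set ℂ :=
  {z | z ∉ γ '' Icc 0 L ∧ Bornology.IsBounded (connectedComponentIn (γ '' Icc 0 L)ᶜ z)}

/-- Characteristic function of a subset of the plane. -/
def charFn (A : Set ℂ) : ℂ → ℝ := A.indicator fun _ => 1

/-! ### Sets of finite perimeter and the reduced boundary -/

/-- Divergence of a vector field on the plane. -/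
def divergence (η : ℂ → ℂ) (z : ℂ) : ℝ :=
  (fderiv ℝ η z 1).re + (fderiv ℝ η z Complex.I).im

/-- The distributional gradient of the characteristic function of `E` is the finite vector-valued
Borel measure `ν μ`, in polar form: `|ν| = 1` holds `μ`-almost everywhere, so that `μ` is the
total variation (the perimeter measure of `E`). -/
def IsPolarGradient (E : Set ℂ) (μ : Measure ℂ) (ν : ℂ → ℂ) : Prop :=
  IsFiniteMeasure μ ∧ Measurable ν ∧ (∀ᵐ z ∂μ, ‖ν z‖ = 1) ∧
    ∀ η : ℂ → ℂ, ContDiff ℝ 1 η → HasCompactSupport η →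
      ∫ z in E, divergence η z = -∫ z, inner ℝ (η z) (ν z) ∂μ

/-- `E` is a set of finite perimeter: the distributional gradient of its characteristic function is
a finite vector-valued measure. -/
def HasFinitePerimeter (E : Set ℂ) : Prop :=
  MeasurableSet E ∧ ∃ μ ν, IsPolarGradient E μ ν

/-- `n` is the inner unit normal of `E` at `x` in the sense of De Giorgi: `x` lies in the support
of the perimeter measure `|Dχ_E|`, the quotients `Dχ_E(B_r(x)) / |Dχ_E|(B_r(x))` converge to `n`
as `r → 0`, and `|n| = 1`. -/
def IsInnerNormalAt (E : Set ℂ) (x n : ℂ) : Prop :=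
  ∃ μ ν, IsPolarGradient E μ ν ∧ (∀ r : ℝ, 0 < r → 0 < μ (Metric.ball x r)) ∧
    Tendsto (fun r : ℝ => ⨍ z in Metric.ball x r, ν z ∂μ) (𝓝[>] 0) (𝓝 n) ∧ ‖n‖ = 1

/-- The reduced boundary `∂*E`. -/
def reducedBoundary (E : Set ℂ) : Set ℂ := {x | ∃ n, IsInnerNormalAt E x n}

open Classical in
/-- The inner unit normal `ν_E` on the reduced boundary (and `0` elsewhere). -/
def innerNormal (E : Set ℂ) (x : ℂ) : ℂ :=
  if h : ∃ n, IsInnerNormalAt E x n then h.choose else 0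

/-- Clockwise rotation by `π/2`: `(a, b) ↦ (b, -a)`. -/
def perp (v : ℂ) : ℂ := ⟨v.im, -v.re⟩

/-- The parameters in `[0, L)` (the end points being identified) at which the curve is at `x`. -/
def preimages (L : ℝ) (γ : ℝ → ℂ) (x : ℂ) : Set ℝ := {s | s ∈ Ico 0 L ∧ γ s = x}

end ConfinedElastica

end

open ConfinedElastica

namespace ConfinedElastica

/-! ### The Cauchy kernel -/

/-! Compactness. Bounded energy gives a subsequence along which the second derivatives converge
weakly in L². Integration yields pointwise convergence of the tangents, which are 1/2-Hölder with a
common constant; hence the limit γ is a C¹ closed curve of unit speed and the curves converge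
uniformly (`exists_subseq_limit`). Tangency to the circle is the vanishing of the derivative of |γ|²
at a maximum. A transversal self-contact at (s, t) would be stable: for large k the map (a, b) ↦
γ_k(a) − γ_k(b) would have a zero near (s, t), and simplicity of γ_k would make the tangents at a
and b equal, although they are close to two different vectors (`deriv_eq_or_eq_neg_of_limit`).

Enclosed sets. Everything is expressed through the winding number. For a simple curve in the disk it
takes, off the trace, only the value 0 and one value σ = ±1, and σ marks the enclosed set
(`exists_wind_eq`); a subsequence makes σ constant. Off the trace of γ, which is a null set, the
winding numbers converge, so E = {winding number σ} is the limit almost everywhere and hence in L¹.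
The Cauchy–Pompeiu formula and Fubini give Green's formula for curves that need not be simple
(`integral_comp_mul_deriv`). With the orientation for which σ = −1 it says that Dχ_E is the image
under γ of γ'^⊥ ds. So E has finite perimeter, and its reduced boundary lies on the trace.

Normal. Let x be in the reduced boundary. All branches through x are tangent to one direction T; let
θ be the sum of their tangents. To first order Dχ_E(B_r(x)) is 2rθ^⊥ (`tendsto_integral_ball`), and
across the tangent line the winding number jumps by θ/T (`tendsto_wind_sub`), so |θ| is 0 or 1. If
|θ| = 1, the blow-up forces ν_E(x) = θ^⊥. If θ = 0, the winding number agrees on both sides, so E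
has density 0 or 1 at x. This is excluded by `not_tendsto_density_zero`, applied to E or to its
complement, through a De Giorgi iteration. Where the normal is nearly constant on average, perimeter
is controlled by area; a Cauchy potential estimate then bounds the area in a smaller disk by the
square of the area in a larger one. Small density therefore becomes zero area, and x would leave the
support of |Dχ_E|. The formula thus holds at every point of the reduced boundary, not only almost
everywhere. -/

theorem lintegral_ball_inv_norm_le {ρ : ℝ} (hρ : 0 < ρ) (y : ℂ) :
    ∫⁻ z in Metric.ball y ρ, ENNReal.ofReal ‖y - z‖⁻¹ ≤ ENNReal.ofReal (2 * Real.pi * ρ) := by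
  have h0 : ∫⁻ z in Metric.ball y ρ, ENNReal.ofReal ‖y - z‖⁻¹ =
      ∫⁻ z : ℂ, (Metric.ball (0 : ℂ) ρ).indicator (fun z => ENNReal.ofReal ‖z‖⁻¹) z := by
    rw [← lintegral_indicator measurableSet_ball, ← lintegral_sub_left_eq_self _ y]
    congr 1
    ext z
    by_cases h : ‖z‖ < ρ
    · rw [indicator_of_mem (by simpa [dist_eq_norm] using h), indicator_of_mem (by simpa using h)]
      simp
    · rw [indicator_of_notMem (by simpa [dist_eq_norm] using h),
        indicator_of_notMem (by simpa using h)]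
  have hS : MeasurableSet (Ioo (0 : ℝ) ρ ×ˢ Ioo (-Real.pi) Real.pi) :=
    measurableSet_Ioo.prod measurableSet_Ioo
  rw [h0, ← Complex.lintegral_comp_polarCoord_symm]
  calc _ ≤ ∫⁻ p in polarCoord.target,
        (Ioo (0 : ℝ) ρ ×ˢ Ioo (-Real.pi) Real.pi).indicator (fun _ => (1 : ENNReal)) p := by
        refine setLIntegral_mono (measurable_const.indicator hS) fun p hp => ?_
        have hp' : 0 < p.1 ∧ p.2 ∈ Ioo (-Real.pi) Real.pi := hp
        have hn := Complex.norm_polarCoord_symm p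
        rw [abs_of_pos hp'.1] at hn
        by_cases h : p.1 < ρ
        -- The Jacobian of polar coordinates cancels the kernel.
        · rw [indicator_of_mem (by rw [mem_ball_zero_iff, hn]; exact h),
            indicator_of_mem (by exact ⟨⟨hp'.1, h⟩, hp'.2⟩), hn, smul_eq_mul,
            ← ENNReal.ofReal_mul hp'.1.le, mul_inv_cancel₀ hp'.1.ne', ENNReal.ofReal_one]
        · rw [indicator_of_notMem (by rw [mem_ball_zero_iff, hn]; exact h)]
          simp
    _ ≤ ∫⁻ p, (Ioo (0 : ℝ) ρ ×ˢ Ioo (-Real.pi) Real.pi).indicator (fun _ => (1 : ENNReal)) p :=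
        setLIntegral_le_lintegral _ _
    _ = ENNReal.ofReal (2 * Real.pi * ρ) := by
        rw [lintegral_indicator hS, setLIntegral_one, Measure.volume_eq_prod, Measure.prod_prod,
          Real.volume_Ioo, Real.volume_Ioo, ← ENNReal.ofReal_mul (by linarith)]
        congr 1; ring

theorem measurable_inv_norm_sub (y : ℂ) : Measurable fun z : ℂ => ENNReal.ofReal ‖y - z‖⁻¹ := by
  fun_prop

/-- The potential of a planar set is bounded by the square root of its area. -/
theorem lintegral_inv_norm_le {V : ℝ} (hV : 0 < V) {F : Set ℂ}
    (hF : volume F ≤ ENNReal.ofReal (V ^ 2)) (y : ℂ) :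
    ∫⁻ z in F, ENNReal.ofReal ‖y - z‖⁻¹ ≤ ENNReal.ofReal ((2 * Real.pi + 1) * V) := by
  -- Split at distance V from the pole: inside, polar coordinates give 2πV; outside, the kernel is
  -- at most 1/V on an area of at most V².
  rw [← lintegral_inter_add_sdiff _ F (measurableSet_ball (x := y) (ε := V))]
  have h1 : ∫⁻ z in F ∩ Metric.ball y V, ENNReal.ofReal ‖y - z‖⁻¹ ≤
      ENNReal.ofReal (2 * Real.pi * V) :=
    (lintegral_mono_set inter_subset_right).trans (lintegral_ball_inv_norm_le hV y)
  have h2 : ∫⁻ z in F \ Metric.ball y V, ENNReal.ofReal ‖y - z‖⁻¹ ≤ ENNReal.ofReal V := by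
    calc _ ≤ ∫⁻ z in F \ Metric.ball y V, ENNReal.ofReal V⁻¹ := by
          refine setLIntegral_mono measurable_const fun z hz => ?_
          refine ENNReal.ofReal_le_ofReal (inv_anti₀ hV ?_)
          have := hz.2
          rw [Metric.mem_ball, dist_comm, dist_eq_norm] at this
          exact not_lt.mp this
      _ ≤ ENNReal.ofReal V⁻¹ * ENNReal.ofReal (V ^ 2) := by
          rw [setLIntegral_const]
          exact mul_le_mul_right ((measure_mono sdiff_subset).trans hF) _
      _ = ENNReal.ofReal V := by
          rw [← ENNReal.ofReal_mul (by positivity)]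
          congr 1; field_simp
  calc _ ≤ ENNReal.ofReal (2 * Real.pi * V) + ENNReal.ofReal V := add_le_add h1 h2
    _ = _ := by
      rw [← ENNReal.ofReal_add (by positivity) hV.le]
      congr 1; ring

/-- The Cauchy kernel is integrable against continuous weights of compact support, uniformly in its
pole. -/
theorem exists_lintegral_div_sub_le {G : ℂ → ℂ} (hG : Continuous G) (hc : HasCompactSupport G) :
    ∃ B < (⊤ : ENNReal), ∀ ζ, ∫⁻ z, ‖G z / (ζ - z)‖ₑ ≤ B := by
  obtain ⟨C, hC⟩ := hc.exists_bound_of_continuous hG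
  obtain ⟨V, hV, hVs⟩ : ∃ V : ℝ, 0 < V ∧ volume (tsupport G) ≤ ENNReal.ofReal (V ^ 2) := by
    have hfin : volume (tsupport G) < ⊤ := hc.isCompact.measure_lt_top
    refine ⟨(volume (tsupport G)).toReal + 1, by positivity, ?_⟩
    refine (ENNReal.ofReal_toReal hfin.ne).symm.le.trans (ENNReal.ofReal_le_ofReal ?_)
    nlinarith [@ENNReal.toReal_nonneg (volume (tsupport G))]
  refine ⟨ENNReal.ofReal C * ENNReal.ofReal ((2 * Real.pi + 1) * V), by finiteness, fun ζ => ?_⟩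
  calc ∫⁻ z, ‖G z / (ζ - z)‖ₑ = ∫⁻ z in tsupport G, ‖G z / (ζ - z)‖ₑ := by
        rw [setLIntegral_eq_of_support_subset]
        intro z hz
        refine subset_tsupport _ fun h0 => hz ?_
        simp [h0]
    _ ≤ ∫⁻ z in tsupport G, ENNReal.ofReal C * ENNReal.ofReal ‖ζ - z‖⁻¹ := by
        refine lintegral_mono fun z => ?_
        rw [← ENNReal.ofReal_mul ((norm_nonneg _).trans (hC z)), ← ofReal_norm]
        refine ENNReal.ofReal_le_ofReal ?_
        rw [norm_div, div_eq_mul_inv]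
        exact mul_le_mul_of_nonneg_right (hC z) (by positivity)
    _ ≤ ENNReal.ofReal C * ENNReal.ofReal ((2 * Real.pi + 1) * V) := by
        rw [lintegral_const_mul _ (measurable_inv_norm_sub _)]
        gcongr
        exact lintegral_inv_norm_le hV hVs _

/-- The Wirtinger derivative `∂φ/∂z̄`. -/
noncomputable def dbar (φ : ℂ → ℂ) (z : ℂ) : ℂ :=
  (1 / 2) * (fderiv ℝ φ z 1 + Complex.I * fderiv ℝ φ z Complex.I)

theorem continuous_dbar {φ : ℂ → ℂ} (hφ : ContDiff ℝ 1 φ) : Continuous (dbar φ) := by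
  have h := hφ.continuous_fderiv (by norm_num)
  unfold dbar
  fun_prop

theorem hasCompactSupport_dbar {φ : ℂ → ℂ} (hc : HasCompactSupport φ) :
    HasCompactSupport (dbar φ) := by
  refine (hc.fderiv (𝕜 := ℝ)).mono fun z hz h0 => hz ?_
  have : fderiv ℝ φ z = 0 := h0
  simp [dbar, this]

theorem fderiv_apply_re_im (φ : ℂ → ℂ) (z w : ℂ) :
    fderiv ℝ φ z w = w.re * fderiv ℝ φ z 1 + w.im * fderiv ℝ φ z Complex.I := by
  have : w = w.re • (1 : ℂ) + w.im • Complex.I := by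
    simp
  conv_lhs => rw [this, map_add, map_smul, map_smul]
  simp

/-- Cauchy–Pompeiu formula for compactly supported functions. -/
theorem integral_dbar_div {φ : ℂ → ℂ} (hφ : ContDiff ℝ 1 φ) (hc : HasCompactSupport φ) (ζ : ℂ) :
    ∫ z, dbar φ z / (ζ - z) = Real.pi * φ ζ := by
  set e : ℝ → ℂ := fun θ => Real.cos θ + Real.sin θ * Complex.I with he
  have hnorm : ∀ θ, ‖e θ‖ = 1 := fun θ => by
    have := Complex.norm_polarCoord_symm (1, θ)
    simpa only [Complex.polarCoord_symm_apply, Complex.ofReal_one, one_mul, abs_one] using this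
  have hec : Continuous e := by fun_prop
  have hed : ∀ θ, HasDerivAt e (Complex.I * e θ) θ := by
    intro θ
    have := ((Complex.hasDerivAt_exp (θ * Complex.I)).comp θ
      ((Complex.ofRealCLM.hasDerivAt (x := θ)).mul_const Complex.I))
    have h2 : e = Complex.exp ∘ fun y : ℝ => Complex.ofRealCLM y * Complex.I := by
      ext y; simp [he, Complex.exp_mul_I]
    have h3 : Complex.I * e θ = Complex.exp (θ * Complex.I) * (Complex.ofRealCLM 1 * Complex.I) := by
      rw [h2]; simp [mul_comm]
    rw [h3, h2]
    exact this
  -- In polar coordinates about ζ, the integrand times the Jacobian is −(A + iB)/2, where A is the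
  -- radial derivative of φ and B is the angular derivative divided by the radius. A integrates
  -- along each ray to −φ(ζ); B integrates over each circle to 0.
  set A : ℝ × ℝ → ℂ := fun p => fderiv ℝ φ (ζ + p.1 * e p.2) (e p.2) with hA
  set B : ℝ × ℝ → ℂ := fun p => fderiv ℝ φ (ζ + p.1 * e p.2) (Complex.I * e p.2) with hB
  have hfc := hφ.continuous_fderiv (by norm_num)
  have hAc : Continuous A := by fun_prop
  have hBc : Continuous B := by fun_prop
  obtain ⟨R, hR0, hR⟩ : ∃ R : ℝ, 0 < R ∧ ∀ z, R < ‖z‖ → φ (ζ + z) = 0 ∧ fderiv ℝ φ (ζ + z) = 0 := by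
    obtain ⟨R, hR⟩ := hc.isCompact.isBounded.subset_closedBall ζ
    refine ⟨max R 1, by positivity, fun z hz => ?_⟩
    have hn : ζ + z ∉ tsupport φ := fun h => by
      have := hR h
      rw [Metric.mem_closedBall, dist_eq_norm, add_sub_cancel_left] at this
      exact absurd hz (not_lt.mpr (this.trans (le_max_left _ _)))
    exact ⟨image_eq_zero_of_notMem_tsupport hn,
      image_eq_zero_of_notMem_tsupport fun h => hn (tsupport_fderiv_subset ℝ h)⟩
  have hzero : ∀ p : ℝ × ℝ, R < p.1 → fderiv ℝ φ (ζ + p.1 * e p.2) = 0 := by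
    intro p hp
    refine (hR _ ?_).2
    rw [norm_mul, hnorm]
    simpa using hp.trans_le (le_abs_self _)
  have hint : ∀ G : ℝ × ℝ → ℂ, Continuous G → (∀ p : ℝ × ℝ, R < p.1 → G p = 0) →
      IntegrableOn G (Ioi (0 : ℝ) ×ˢ Ioo (-Real.pi) Real.pi) := by
    intro G hG h0
    have h1 : IntegrableOn G (Icc (0 : ℝ) R ×ˢ Icc (-Real.pi) Real.pi) :=
      hG.continuousOn.integrableOn_compact (isCompact_Icc.prod isCompact_Icc)
    refine (h1.of_forall_sdiff_eq_zero (measurableSet_Ioi.prod measurableSet_Ioo) ?_)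
    rintro p ⟨⟨hp1, hp2⟩, hp3⟩
    refine h0 p ?_
    by_contra hle
    exact hp3 ⟨⟨le_of_lt hp1, not_lt.mp hle⟩, Ioo_subset_Icc_self hp2⟩
  have hAi := hint A hAc fun p hp => by simp [hA, hzero p hp]
  have hBi := hint B hBc fun p hp => by simp [hB, hzero p hp]
  have hAint : ∫ p in Ioi (0 : ℝ) ×ˢ Ioo (-Real.pi) Real.pi, A p = -(2 * Real.pi * φ ζ) := by
    rw [Measure.volume_eq_prod, ← Measure.prod_restrict, integral_prod_symm]
    · have : ∀ θ, ∫ r in Ioi (0 : ℝ), A (r, θ) = -φ ζ := by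
        intro θ
        have hd : ∀ r : ℝ, HasDerivAt (fun r : ℝ => φ (ζ + r * e θ)) (A (r, θ)) r := by
          intro r
          have h1 := (hφ.differentiable (by norm_num) (ζ + r * e θ)).hasFDerivAt
          have h2 : HasDerivAt (fun r : ℝ => ζ + r * e θ) (e θ) r := by
            have := ((Complex.ofRealCLM.hasDerivAt (x := r)).mul_const (e θ)).const_add ζ
            simpa using this
          exact h1.comp_hasDerivAt r h2
        have hev : ∀ r : ℝ, R < r → φ (ζ + r * e θ) = 0 := fun r hr => by
          refine (hR _ ?_).1
          rw [norm_mul, hnorm]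
          simpa using hr.trans_le (le_abs_self _)
        rw [integral_Ioi_of_hasDerivAt_of_tendsto (m := 0) (f := fun r : ℝ => φ (ζ + r * e θ))
          (hd 0).continuousAt.continuousWithinAt (fun r _ => hd r)]
        · simp
        · have h1 : IntegrableOn (fun r => A (r, θ)) (Icc 0 R) :=
            (by fun_prop : Continuous fun r => A (r, θ)).continuousOn.integrableOn_compact
              isCompact_Icc
          refine h1.of_forall_sdiff_eq_zero measurableSet_Ioi fun r hr => ?_
          have : R < r := by
            by_contra hle
            exact hr.2 ⟨le_of_lt hr.1, not_lt.mp hle⟩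
          simp [hA, hzero (r, θ) this]
        · refine tendsto_const_nhds.congr' ?_
          filter_upwards [eventually_gt_atTop R] with r hr
          exact (hev r hr).symm
      simp_rw [this]
      rw [setIntegral_const, Real.volume_real_Ioo_of_le (by linarith [Real.pi_pos]),
        Complex.real_smul]
      push_cast; ring
    · rw [Measure.prod_restrict]; exact hAi
  have hBint : ∫ p in Ioi (0 : ℝ) ×ˢ Ioo (-Real.pi) Real.pi, B p = 0 := by
    rw [Measure.volume_eq_prod, setIntegral_prod _ hBi]
    refine setIntegral_eq_zero_of_forall_eq_zero fun r hr => ?_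
    have hr0 : (r : ℂ) ≠ 0 := by exact_mod_cast (ne_of_gt hr)
    have hd : ∀ θ : ℝ, HasDerivAt (fun θ : ℝ => (r : ℂ)⁻¹ * φ (ζ + r * e θ)) (B (r, θ)) θ := by
      intro θ
      have h1 := (hφ.differentiable (by norm_num) (ζ + r * e θ)).hasFDerivAt
      have h2 : HasDerivAt (fun θ : ℝ => ζ + r * e θ) (r * (Complex.I * e θ)) θ :=
        ((hed θ).const_mul (r : ℂ)).const_add ζ
      have h3 := (h1.comp_hasDerivAt θ h2).const_mul (r : ℂ)⁻¹
      have h4 : fderiv ℝ φ (ζ + r * e θ) (r * (Complex.I * e θ)) = r * B (r, θ) := by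
        have := (fderiv ℝ φ (ζ + r * e θ)).map_smul r (Complex.I * e θ)
        rwa [Complex.real_smul, Complex.real_smul] at this
      rw [h4, inv_mul_cancel_left₀ hr0] at h3
      exact h3
    rw [← integral_Ioc_eq_integral_Ioo,
      ← intervalIntegral.integral_of_le (by linarith [Real.pi_pos]),
      intervalIntegral.integral_eq_sub_of_hasDerivAt (fun θ _ => hd θ)]
    · simp [he]
    · exact (by fun_prop : Continuous fun θ => B (r, θ)).intervalIntegrable _ _
  rw [← integral_add_left_eq_self _ ζ, ← Complex.integral_comp_polarCoord_symm]
  change ∫ p in Ioi (0 : ℝ) ×ˢ Ioo (-Real.pi) Real.pi, _ = _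
  rw [setIntegral_congr_fun (g := fun p => (-1 / 2 : ℂ) * (A p + Complex.I * B p))
    (measurableSet_Ioi.prod measurableSet_Ioo), integral_const_mul, integral_add hAi
    (hBi.const_mul _), integral_const_mul, hAint, hBint]
  · ring
  · intro p hp
    have hp1 : (p.1 : ℂ) ≠ 0 := by exact_mod_cast (ne_of_gt hp.1)
    have hpe : e p.2 ≠ 0 := fun h => by simpa [h] using hnorm p.2
    simp only [Complex.polarCoord_symm_apply, Complex.real_smul]
    change (p.1 : ℂ) * (dbar φ (ζ + p.1 * e p.2) / (ζ - (ζ + p.1 * e p.2))) = _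
    have h1 : (e p.2).re = Real.cos p.2 := by
      simp [he, -Complex.ofReal_cos, -Complex.ofReal_sin]
    have h2 : (e p.2).im = Real.sin p.2 := by
      simp [he, -Complex.ofReal_cos, -Complex.ofReal_sin]
    have hAe : A p = Real.cos p.2 * fderiv ℝ φ (ζ + p.1 * e p.2) 1 +
        Real.sin p.2 * fderiv ℝ φ (ζ + p.1 * e p.2) Complex.I := by
      simp only [hA]
      rw [fderiv_apply_re_im, h1, h2]
    have hBe : B p = -Real.sin p.2 * fderiv ℝ φ (ζ + p.1 * e p.2) 1 +
        Real.cos p.2 * fderiv ℝ φ (ζ + p.1 * e p.2) Complex.I := by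
      simp only [hB]
      rw [fderiv_apply_re_im, Complex.I_mul_re, Complex.I_mul_im, h1, h2]
      push_cast; ring
    have hprod : (Real.cos p.2 - Complex.I * Real.sin p.2) * e p.2 = 1 := by
      have := Real.cos_sq_add_sin_sq p.2
      have h3 : (Real.cos p.2 : ℂ) ^ 2 + (Real.sin p.2 : ℂ) ^ 2 = 1 := by exact_mod_cast this
      simp only [he]
      linear_combination h3 - (Real.sin p.2 : ℂ) ^ 2 * Complex.I_sq
    rw [hAe, hBe, dbar]
    set g1 := fderiv ℝ φ (ζ + p.1 * e p.2) 1
    set g2 := fderiv ℝ φ (ζ + p.1 * e p.2) Complex.I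
    have hsub : ζ - (ζ + p.1 * e p.2) = -(p.1 * e p.2) := by ring
    rw [hsub]
    field_simp
    have : -(1 : ℂ) * (g1 + Complex.I * g2) = -(g1 + Complex.I * g2) *
      ((Real.cos p.2 - Complex.I * Real.sin p.2) * e p.2) := by rw [hprod]; ring
    linear_combination this + (Real.sin p.2 * g2 * e p.2) * Complex.I_sq

theorem integral_fderiv_apply_eq_zero {E : Type*} [NormedAddCommGroup E] [NormedSpace ℝ E]
    [FiniteDimensional ℝ E] [MeasurableSpace E] [BorelSpace E] {μ : Measure E}
    [μ.IsAddHaarMeasure] {φ : E → ℝ} (hφ : ContDiff ℝ 1 φ)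
    (hc : HasCompactSupport φ) (v : E) : ∫ z, fderiv ℝ φ z v ∂μ = 0 := by
  have hd : Continuous fun z => fderiv ℝ φ z v := by
    have := hφ.continuous_fderiv (by norm_num)
    fun_prop
  have hs : HasCompactSupport fun z => fderiv ℝ φ z v := hc.fderiv_apply (𝕜 := ℝ) v
  have := integral_mul_fderiv_eq_neg_fderiv_mul_of_integrable (μ := μ) (f := fun _ : E => (1 : ℝ))
    (g := φ) (v := v) (by simp) (by simpa using hd.integrable_of_hasCompactSupport hs)
    (by simpa using hφ.continuous.integrable_of_hasCompactSupport hc)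
    (fun _ _ => differentiableAt_const _) (fun z _ => hφ.differentiable (by norm_num) z)
  simpa using this

/-! ### Closed curves parametrized by arclength and their winding number -/

/-- An `L`-periodic `C¹` curve parametrized by arclength. -/
structure IsArcCurve (L : ℝ) (γ : ℝ → ℂ) : Prop where
  pos : 0 < L
  contDiff : ContDiff ℝ 1 γ
  periodic : Function.Periodic γ L
  norm_deriv : ∀ s, ‖deriv γ s‖ = 1

theorem periodic_deriv {L : ℝ} {γ : ℝ → ℂ} (h : Function.Periodic γ L) :
    Function.Periodic (deriv γ) L := by
  intro s
  have : (fun x => γ (x + L)) = γ := funext h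
  rw [← deriv_comp_add_const, this]

namespace IsArcCurve

variable {L : ℝ} {γ : ℝ → ℂ}

theorem continuous (h : IsArcCurve L γ) : Continuous γ := h.contDiff.continuous

theorem continuous_deriv (h : IsArcCurve L γ) : Continuous (deriv γ) :=
  h.contDiff.continuous_deriv (by norm_num)

theorem hasDerivAt (h : IsArcCurve L γ) (s : ℝ) : HasDerivAt γ (deriv γ s) s :=
  (h.contDiff.differentiable (by norm_num) s).hasDerivAt

theorem image_Icc (h : IsArcCurve L γ) : γ '' Icc 0 L = range γ := by
  simpa using h.periodic.image_Icc h.pos 0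

theorem isCompact_range (h : IsArcCurve L γ) : IsCompact (range γ) := by
  rw [← h.image_Icc]
  exact isCompact_Icc.image h.continuous

theorem isOpen_compl_range (h : IsArcCurve L γ) : IsOpen (range γ)ᶜ :=
  h.isCompact_range.isClosed.isOpen_compl

/-- A C¹ image of the line has Hausdorff dimension at most 1, hence is null for the two-dimensional
Hausdorff measure, which is a Haar measure on the plane. -/
theorem volume_range (h : IsArcCurve L γ) : volume (range γ) = 0 := by
  have h1 : dimH (range γ) ≤ 1 := by simpa using h.contDiff.dimH_range_le
  have h2 : μH[((2 : NNReal) : ℝ)] (range γ) = 0 :=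
    hausdorffMeasure_of_dimH_lt (h1.trans_lt (by norm_num))
  have h3 : (μH[(2 : ℝ)] : Measure ℂ).IsAddHaarMeasure := by
    have := isAddHaarMeasure_hausdorffMeasure (E := ℂ)
    simpa [Complex.finrank_real_complex] using this
  exact Measure.absolutelyContinuous_isAddHaarMeasure volume (μH[(2 : ℝ)] : Measure ℂ)
    (by simpa using h2)

theorem ae_notMem_range (h : IsArcCurve L γ) : ∀ᵐ z : ℂ, z ∉ range γ :=
  measure_eq_zero_iff_ae_notMem.mp h.volume_range

end IsArcCurve

/-- The winding number of a closed curve around a point. -/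
noncomputable def wind (L : ℝ) (γ : ℝ → ℂ) (z : ℂ) : ℂ :=
  (2 * Real.pi * Complex.I)⁻¹ * ∫ s in (0 : ℝ)..L, deriv γ s / (γ s - z)

namespace IsArcCurve

variable {L : ℝ} {γ : ℝ → ℂ}

theorem continuous_windIntegrand (h : IsArcCurve L γ) {z : ℂ} (hz : z ∉ range γ) :
    Continuous fun s => deriv γ s / (γ s - z) :=
  h.continuous_deriv.div (h.continuous.sub continuous_const)
    fun s hs => hz ⟨s, sub_eq_zero.mp hs⟩

/-- The quotient (γ − z')/(γ − z) stays in the unit disk about 1, so its principal logarithm is a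
periodic primitive of the difference of the two integrands. -/
theorem wind_eq_of_norm_sub_lt (h : IsArcCurve L γ) {z z' : ℂ}
    (hz : ∀ s, ‖z' - z‖ < ‖γ s - z‖) : wind L γ z' = wind L γ z := by
  have hne : ∀ s, γ s - z ≠ 0 := fun s hs => by
    have := hz s
    rw [hs, norm_zero] at this
    exact absurd this (not_lt.mpr (norm_nonneg _))
  have hne' : ∀ s, γ s - z' ≠ 0 := fun s hs => by
    have := hz s
    rw [← sub_eq_zero.mp hs] at this
    exact lt_irrefl _ this
  have hq : ∀ s, (γ s - z') / (γ s - z) ∈ Complex.slitPlane := by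
    intro s
    have : (γ s - z') / (γ s - z) = 1 + -((z' - z) / (γ s - z)) := by
      field_simp [hne s]; ring
    rw [this]
    refine Complex.mem_slitPlane_of_norm_lt_one ?_
    rw [norm_neg, norm_div, div_lt_one (norm_pos_iff.mpr (hne s))]
    exact hz s
  have hd : ∀ s, HasDerivAt (fun s => Complex.log ((γ s - z') / (γ s - z)))
      (deriv γ s / (γ s - z') - deriv γ s / (γ s - z)) s := by
    intro s
    have h1 := ((h.hasDerivAt s).sub_const z').div ((h.hasDerivAt s).sub_const z) (hne s)
    convert! h1.clog_real (hq s) using 1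
    have h2 := hne s
    have h3 := hne' s
    simp only [Pi.div_apply]
    field_simp
  have hzr : z ∉ range γ := by
    rintro ⟨s, hs⟩; exact hne s (sub_eq_zero.mpr hs)
  have hzr' : z' ∉ range γ := by
    rintro ⟨s, hs⟩; exact hne' s (sub_eq_zero.mpr hs)
  have hi := (h.continuous_windIntegrand hzr).intervalIntegrable (μ := volume) 0 L
  have hi' := (h.continuous_windIntegrand hzr').intervalIntegrable (μ := volume) 0 L
  have := intervalIntegral.integral_eq_sub_of_hasDerivAt (fun s _ => hd s) (hi'.sub hi)
  rw [intervalIntegral.integral_sub hi' hi, h.periodic.eq, sub_self, sub_eq_zero] at this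
  rw [wind, wind, this]

theorem exists_forall_le_norm_sub (h : IsArcCurve L γ) {z : ℂ} (hz : z ∉ range γ) :
    ∃ d > 0, ∀ s, d ≤ ‖γ s - z‖ := by
  obtain ⟨d, hd, hb⟩ := Metric.isOpen_iff.mp h.isOpen_compl_range z hz
  refine ⟨d, hd, fun s => ?_⟩
  by_contra hlt
  exact hb (show γ s ∈ Metric.ball z d by rw [Metric.mem_ball, dist_eq_norm]; exact not_le.mp hlt)
    ⟨s, rfl⟩

theorem eventually_wind_eq (h : IsArcCurve L γ) {z : ℂ} (hz : z ∉ range γ) :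
    ∀ᶠ z' in 𝓝 z, wind L γ z' = wind L γ z := by
  obtain ⟨d, hd, hb⟩ := h.exists_forall_le_norm_sub hz
  filter_upwards [Metric.ball_mem_nhds z hd] with z' hz'
  refine h.wind_eq_of_norm_sub_lt fun s => lt_of_lt_of_le ?_ (hb s)
  rwa [← dist_eq_norm]

theorem wind_eq_of_isPreconnected (h : IsArcCurve L γ) {S : Set ℂ} (hS : IsPreconnected S)
    (hd : S ⊆ (range γ)ᶜ) {z z' : ℂ} (hz : z ∈ S) (hz' : z' ∈ S) : wind L γ z = wind L γ z' := by
  refine hS.induction₂ (fun x y => wind L γ x = wind L γ y) (fun x hx => ?_)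
    (fun _ _ _ _ _ _ h1 h2 => h1.trans h2) (fun _ _ _ _ h1 => h1.symm) hz hz'
  filter_upwards [nhdsWithin_le_nhds (h.eventually_wind_eq (hd hx))] with y hy using hy.symm

theorem isOpen_wind_eq (h : IsArcCurve L γ) (S : Set ℂ) :
    IsOpen {z | z ∉ range γ ∧ wind L γ z ∈ S} := by
  rw [isOpen_iff_mem_nhds]
  rintro z ⟨hz, hw⟩
  filter_upwards [h.isOpen_compl_range.mem_nhds hz, h.eventually_wind_eq hz] with z' h1 h2
  exact ⟨h1, by rwa [h2]⟩

theorem norm_wind_le (h : IsArcCurve L γ) {z : ℂ} {d : ℝ} (hd : 0 < d)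
    (hz : ∀ s, d ≤ ‖γ s - z‖) : ‖wind L γ z‖ ≤ (2 * Real.pi)⁻¹ * (d⁻¹ * L) := by
  have h1 : ‖∫ s in (0 : ℝ)..L, deriv γ s / (γ s - z)‖ ≤ d⁻¹ * |L - 0| := by
    refine intervalIntegral.norm_integral_le_of_norm_le_const fun s _ => ?_
    rw [norm_div, h.norm_deriv, one_div]
    exact inv_anti₀ hd (hz s)
  rw [sub_zero, abs_of_pos h.pos] at h1
  rw [wind, norm_mul]
  have : ‖(2 * Real.pi * Complex.I : ℂ)⁻¹‖ = (2 * Real.pi)⁻¹ := by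
    simp [abs_of_pos Real.pi_pos]
  rw [this]
  gcongr

/-- The ray from a point outside the unit disk away from the origin avoids the disk. -/
theorem ray_subset {γ : ℝ → ℂ} (hb : ∀ s, ‖γ s‖ < 1) {z : ℂ} (hz : 1 ≤ ‖z‖) :
    (fun t : ℝ => (t : ℂ) * z) '' Ici 1 ⊆ (range γ)ᶜ := by
  rintro _ ⟨t, ht, rfl⟩ ⟨s, hs⟩
  have ht : 1 ≤ t := ht
  have := hb s
  rw [hs, norm_mul, Complex.norm_real, Real.norm_of_nonneg (by linarith)] at this
  nlinarith

theorem isPreconnected_ray (z : ℂ) :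
    IsPreconnected ((fun t : ℝ => (t : ℂ) * z) '' Ici 1) :=
  isPreconnected_Ici.image _ (by fun_prop)

/-- The winding number is constant along the ray from z to infinity and is O(1/distance) there. -/
theorem wind_eq_zero_of_one_le_norm (h : IsArcCurve L γ) (hb : ∀ s, ‖γ s‖ < 1) {z : ℂ}
    (hz : 1 ≤ ‖z‖) : wind L γ z = 0 := by
  have h1 : ∀ t : ℝ, 1 < t → ‖wind L γ z‖ ≤ (2 * Real.pi)⁻¹ * ((t - 1)⁻¹ * L) := by
    intro t ht
    rw [h.wind_eq_of_isPreconnected (isPreconnected_ray z) (ray_subset hb hz)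
      ⟨1, mem_Ici.mpr le_rfl, by simp⟩ ⟨t, ht.le, rfl⟩]
    refine h.norm_wind_le (by linarith) fun s => ?_
    have h2 : ‖(t : ℂ) * z‖ = t * ‖z‖ := by
      rw [norm_mul, Complex.norm_real, Real.norm_of_nonneg (by linarith)]
    have h3 := norm_sub_norm_le ((t : ℂ) * z) (γ s)
    rw [norm_sub_rev] at h3
    nlinarith [hb s]
  have h2 : Tendsto (fun t : ℝ => (2 * Real.pi)⁻¹ * ((t - 1)⁻¹ * L)) atTop (𝓝 0) := by
    have : Tendsto (fun t : ℝ => (t - 1)⁻¹) atTop (𝓝 0) :=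
      tendsto_inv_atTop_zero.comp (tendsto_atTop_add_const_right _ (-1) tendsto_id)
    simpa using (this.mul_const L).const_mul (2 * Real.pi)⁻¹
  have h3 : ‖wind L γ z‖ ≤ 0 :=
    ge_of_tendsto h2 ((eventually_gt_atTop 1).mono h1)
  exact norm_le_zero_iff.mp h3

/-- Green's formula in terms of the winding number. -/
theorem integral_comp_mul_deriv (h : IsArcCurve L γ) {φ : ℂ → ℂ} (hφ : ContDiff ℝ 1 φ)
    (hc : HasCompactSupport φ) :
    ∫ s in (0 : ℝ)..L, φ (γ s) * deriv γ s = 2 * Complex.I * ∫ z, wind L γ z * dbar φ z := by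
  have hdc := continuous_dbar hφ
  have hds := hasCompactSupport_dbar hc
  -- Fubini for this kernel: integrating first in z gives π φ(γ) γ' by Cauchy–Pompeiu, integrating
  -- first in s gives 2πi times the winding number times `dbar φ z`.
  set K : ℝ → ℂ → ℂ := fun s z => dbar φ z / (γ s - z) * deriv γ s with hK
  have hKm : Measurable (Function.uncurry K) := by
    have h1 := h.continuous.measurable
    have h2 := h.continuous_deriv.measurable
    have h3 := hdc.measurable
    exact ((h3.comp measurable_snd).div ((h1.comp measurable_fst).sub measurable_snd)).mul
      (h2.comp measurable_fst)
  have hKi : Integrable (Function.uncurry K) ((volume.restrict (Ioc 0 L)).prod volume) := by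
    refine ⟨hKm.aestronglyMeasurable, ?_⟩
    rw [hasFiniteIntegral_iff_enorm, lintegral_prod _ hKm.enorm.aemeasurable]
    obtain ⟨B, hB, hGB⟩ := exists_lintegral_div_sub_le hdc hds
    have hb : ∀ s, ∫⁻ z, ‖K s z‖ₑ ≤ B := fun s => by
      simpa only [hK, enorm_mul, ← ofReal_norm (deriv γ s), h.norm_deriv, ENNReal.ofReal_one,
        mul_one] using hGB (γ s)
    calc _ ≤ ∫⁻ s in Ioc 0 L, B := lintegral_mono fun s => hb s
      _ < ⊤ := by
          rw [setLIntegral_const, Real.volume_Ioc]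
          exact ENNReal.mul_lt_top hB ENNReal.ofReal_lt_top
  have hswap := integral_integral_swap hKi
  have h1 : ∀ s, ∫ z, K s z = Real.pi * (φ (γ s) * deriv γ s) := by
    intro s
    simp only [hK]
    rw [integral_mul_const, integral_dbar_div hφ hc, mul_assoc]
  have h2 : ∀ z, ∫ s in Ioc 0 L, K s z =
      (2 * Real.pi * Complex.I) * (wind L γ z * dbar φ z) := by
    intro z
    have : ∀ s, K s z = dbar φ z * (deriv γ s / (γ s - z)) := fun s => by simp only [hK]; ring
    simp_rw [this]
    rw [integral_const_mul, wind, intervalIntegral.integral_of_le h.pos.le]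
    field_simp
  simp_rw [h1, h2] at hswap
  rw [integral_const_mul, integral_const_mul, ← intervalIntegral.integral_of_le h.pos.le] at hswap
  have hpi : (Real.pi : ℂ) ≠ 0 := by exact_mod_cast Real.pi_ne_zero
  apply mul_left_cancel₀ hpi
  rw [hswap]; ring

end IsArcCurve

/-! ### The Gauss–Green formula -/

theorem two_mul_dbar_conj_re {η : ℂ → ℂ} {z : ℂ} (hη : DifferentiableAt ℝ η z) :
    (2 * dbar (fun z => (starRingEnd ℂ) (η z)) z).re = divergence η z := by
  have h : fderiv ℝ (fun z => (starRingEnd ℂ) (η z)) z =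
      (Complex.conjCLE : ℂ →L[ℝ] ℂ).comp (fderiv ℝ η z) :=
    ((Complex.conjCLE : ℂ →L[ℝ] ℂ).hasFDerivAt.comp z hη.hasFDerivAt).fderiv
  rw [dbar, h, divergence]
  simp

theorem contDiff_conj_comp {η : ℂ → ℂ} (hη : ContDiff ℝ 1 η) :
    ContDiff ℝ 1 fun z => (starRingEnd ℂ) (η z) :=
  (Complex.conjCLE : ℂ →L[ℝ] ℂ).contDiff.comp hη

theorem hasCompactSupport_conj_comp {η : ℂ → ℂ} (hη : HasCompactSupport η) :
    HasCompactSupport fun z => (starRingEnd ℂ) (η z) :=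
  hη.comp_left (map_zero _)

/-- Dictionary between real fields and complex integrands: for φ the conjugate of η, the flux
density of η along γ is the imaginary part of φ(γ) γ', and its divergence is the real part of twice
`dbar φ`. -/
theorem inner_perp (a b : ℂ) : inner ℝ a (perp b) = ((starRingEnd ℂ) a * b).im := by
  simp [Complex.inner, perp]
  ring

/-- The set around which a curve winds once clockwise. -/
def clockwiseSet (L : ℝ) (γ : ℝ → ℂ) : Set ℂ := {z | z ∉ range γ ∧ wind L γ z = -1}

theorem IsArcCurve.isOpen_clockwiseSet {L : ℝ} {γ : ℝ → ℂ} (h : IsArcCurve L γ) :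
    IsOpen (clockwiseSet L γ) := h.isOpen_wind_eq {-1}

/-- Gauss–Green formula for the set around which a curve winds clockwise. -/
theorem IsArcCurve.setIntegral_divergence {L : ℝ} {γ : ℝ → ℂ} (h : IsArcCurve L γ)
    (hw : ∀ z ∉ range γ, wind L γ z = 0 ∨ wind L γ z = -1) {η : ℂ → ℂ} (hη : ContDiff ℝ 1 η)
    (hc : HasCompactSupport η) :
    ∫ z in clockwiseSet L γ, divergence η z =
      -∫ s in (0 : ℝ)..L, inner ℝ (η (γ s)) (perp (deriv γ s)) := by
  have hφ := contDiff_conj_comp hη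
  have hφc := hasCompactSupport_conj_comp hc
  set φ : ℂ → ℂ := fun z => (starRingEnd ℂ) (η z) with hφd
  have hG := h.integral_comp_mul_deriv hφ hφc
  have hE : MeasurableSet (clockwiseSet L γ) := h.isOpen_clockwiseSet.measurableSet
  -- Off the null trace the winding number is minus the indicator of the clockwise set.
  have h1 : ∫ z, wind L γ z * dbar φ z = -∫ z in clockwiseSet L γ, dbar φ z := by
    rw [← integral_indicator hE, ← integral_neg]
    refine integral_congr_ae ?_
    filter_upwards [h.ae_notMem_range] with z hz
    rcases hw z hz with h0 | h0
    · rw [indicator_of_notMem, h0]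
      · simp
      · rintro ⟨_, h1⟩
        rw [h0] at h1
        norm_num at h1
    · rw [indicator_of_mem (by exact ⟨hz, h0⟩), h0]
      simp
  have hint : Integrable (dbar φ) (volume.restrict (clockwiseSet L γ)) :=
    ((continuous_dbar hφ).integrable_of_hasCompactSupport (hasCompactSupport_dbar hφc)).restrict
  have h2 : ∫ z in clockwiseSet L γ, divergence η z =
      (2 * ∫ z in clockwiseSet L γ, dbar φ z).re := by
    rw [← integral_const_mul]
    have := integral_re (hint.const_mul (2 : ℂ))
    simp only [RCLike.re_eq_complex_re] at this
    rw [← this]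
    exact integral_congr_ae (Eventually.of_forall fun z =>
      (two_mul_dbar_conj_re (hη.differentiable (by norm_num) z)).symm)
  have h3 : ∫ s in (0 : ℝ)..L, inner ℝ (η (γ s)) (perp (deriv γ s)) =
      (∫ s in (0 : ℝ)..L, φ (γ s) * deriv γ s).im := by
    simp_rw [inner_perp, intervalIntegral.integral_of_le h.pos.le]
    have hi : Integrable (fun s => φ (γ s) * deriv γ s) (volume.restrict (Ioc 0 L)) :=
      (((hφ.continuous.comp h.continuous).mul h.continuous_deriv).intervalIntegrable
        (μ := volume) 0 L).1
    exact integral_im hi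
  rw [h2, h3, hG, h1]
  set I := ∫ z in clockwiseSet L γ, dbar φ z
  simp

/-! ### Local structure of a curve near a point -/

namespace IsArcCurve

variable {L : ℝ} {γ : ℝ → ℂ}

theorem deriv_uniform (h : IsArcCurve L γ) {ε : ℝ} (hε : 0 < ε) :
    ∃ δ > 0, ∀ s s', |s' - s| ≤ δ → ‖deriv γ s' - deriv γ s‖ ≤ ε := by
  -- Periodicity moves s into [0, L); with δ ≤ L the second parameter stays in [−L, 2L], where
  -- continuity is uniform.
  have hu := isCompact_Icc.uniformContinuousOn_of_continuous
    (h.continuous_deriv.continuousOn (s := Icc (-L) (2 * L)))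
  obtain ⟨δ, hδ, hb⟩ := Metric.uniformContinuousOn_iff.mp hu ε hε
  refine ⟨min (δ / 2) L, lt_min (by positivity) h.pos, fun s s' hs => ?_⟩
  have hp := periodic_deriv h.periodic
  have hs0 := sub_toIcoDiv_zsmul_mem_Ico h.pos 0 s
  set n := toIcoDiv h.pos 0 s
  rw [zero_add] at hs0
  rw [← hp.sub_zsmul_eq n (x := s), ← hp.sub_zsmul_eq n (x := s')]
  have h1 := (abs_le.mp (hs.trans (min_le_right _ _)))
  have h2 : |s' - n • L - (s - n • L)| ≤ δ / 2 := by
    rw [sub_sub_sub_cancel_right]; exact hs.trans (min_le_left _ _)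
  have := hb (s' - n • L) ⟨by linarith [hs0.1, h1.1], by linarith [hs0.2, h1.2]⟩ (s - n • L)
    ⟨by linarith [hs0.1, h.pos], by linarith [hs0.2, h.pos]⟩ (by rw [Real.dist_eq]; linarith)
  rw [dist_eq_norm] at this
  exact this.le

theorem linear_approx (h : IsArcCurve L γ) {ε : ℝ} (hε : 0 < ε) :
    ∃ δ > 0, ∀ s s', |s' - s| ≤ δ →
      ‖γ s' - γ s - ((s' - s : ℝ) : ℂ) * deriv γ s‖ ≤ ε * |s' - s| := by
  obtain ⟨δ, hδ, hb⟩ := h.deriv_uniform hε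
  refine ⟨δ, hδ, fun s s' hs => ?_⟩
  have hd : ∀ x ∈ Metric.closedBall s δ, HasDerivWithinAt (fun x : ℝ => γ x - (x : ℂ) * deriv γ s)
      (deriv γ x - deriv γ s) (Metric.closedBall s δ) x := by
    intro x _
    have := (Complex.ofRealCLM.hasDerivAt (x := x)).mul_const (deriv γ s)
    simp only [Complex.ofRealCLM_apply, Complex.ofReal_one, one_mul] at this
    exact ((h.hasDerivAt x).sub this).hasDerivWithinAt
  have := (convex_closedBall s δ).norm_image_sub_le_of_norm_hasDerivWithin_le hd
    (fun x hx => hb s x (by simpa [Real.dist_eq] using hx))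
    (Metric.mem_closedBall_self hδ.le) (y := s') (by simpa [Real.dist_eq] using hs)
  rw [Real.norm_eq_abs] at this
  have he : γ s' - γ s - ((s' - s : ℝ) : ℂ) * deriv γ s =
      γ s' - s' * deriv γ s - (γ s - s * deriv γ s) := by
    push_cast; ring
  rwa [he]

theorem exists_bi_lipschitz (h : IsArcCurve L γ) :
    ∃ δ > 0, ∀ s s', |s' - s| ≤ δ → |s' - s| / 2 ≤ ‖γ s' - γ s‖ := by
  obtain ⟨δ, hδ, hb⟩ := h.linear_approx (ε := 1 / 2) (by norm_num)
  refine ⟨δ, hδ, fun s s' hs => ?_⟩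
  have h1 := hb s s' hs
  have h2 := norm_sub_norm_le (((s' - s : ℝ) : ℂ) * deriv γ s) (γ s' - γ s)
  rw [norm_sub_rev (((s' - s : ℝ) : ℂ) * deriv γ s), norm_mul, h.norm_deriv, mul_one, Complex.norm_real, Real.norm_eq_abs] at h2
  linarith

/-- The fibre is compact, and discrete by local injectivity. -/
theorem finite_preimage_Icc (h : IsArcCurve L γ) (x : ℂ) (a b : ℝ) :
    {s | s ∈ Icc a b ∧ γ s = x}.Finite := by
  obtain ⟨δ, hδ, hb⟩ := h.exists_bi_lipschitz
  have hc : IsCompact {s | s ∈ Icc a b ∧ γ s = x} :=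
    isCompact_Icc.inter_right (isClosed_singleton.preimage h.continuous)
  refine hc.finite ⟨discreteTopology_subtype_iff.mpr fun s hs => ?_⟩
  rw [inf_principal_eq_bot]
  have : Metric.ball s δ ∈ 𝓝 s := Metric.ball_mem_nhds s hδ
  rw [mem_nhdsWithin]
  refine ⟨Metric.ball s δ, Metric.isOpen_ball, Metric.mem_ball_self hδ, ?_⟩
  rintro s' ⟨h1, h2⟩ ⟨_, h4⟩
  have h5 := hb s s' (by rw [← Real.dist_eq]; exact (Metric.mem_ball.mp h1).le)
  rw [h4, hs.2, sub_self, norm_zero] at h5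
  have : |s' - s| = 0 := le_antisymm (by linarith) (abs_nonneg _)
  exact h2 (sub_eq_zero.mp (abs_eq_zero.mp this))

theorem finite_preimages (h : IsArcCurve L γ) (x : ℂ) : (preimages L γ x).Finite :=
  (h.finite_preimage_Icc x 0 L).subset fun _ hs => ⟨Ico_subset_Icc_self hs.1, hs.2⟩

/-- A period `[-η, L - η]` in the interior of which lie all the preimages of a point. -/
theorem exists_window (h : IsArcCurve L γ) (x : ℂ) :
    ∃ η > 0, (∀ s ∈ Icc (-η) (L - η), γ s = x → s ∈ preimages L γ x) ∧
      ∀ s ∈ preimages L γ x, -η < s ∧ s < L - η := by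
  obtain ⟨δ, hδ, hb⟩ := h.exists_bi_lipschitz
  -- Just before the parameter 0 the curve avoids x: by local injectivity if γ(0) = x, by continuity
  -- otherwise.
  obtain ⟨η, hη, hηL, hη'⟩ : ∃ η > 0, η < L ∧ ∀ s ∈ Ico (-η) 0, γ s ≠ x := by
    by_cases h0 : γ 0 = x
    · refine ⟨min δ (L / 2), lt_min hδ (by linarith [h.pos]),
        (min_le_right _ _).trans_lt (by linarith [h.pos]), fun s hs hsx => ?_⟩
      have h1 := hb 0 s (by
        rw [sub_zero, abs_of_neg hs.2]
        linarith [hs.1, min_le_left δ (L / 2)])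
      rw [hsx, h0, sub_self, norm_zero, sub_zero] at h1
      have : |s| = 0 := le_antisymm (by linarith) (abs_nonneg _)
      exact hs.2.ne (abs_eq_zero.mp this)
    · have : ∀ᶠ s in 𝓝 (0 : ℝ), γ s ≠ x := h.continuous.continuousAt.eventually_ne h0
      obtain ⟨ε, hε, hb'⟩ := Metric.eventually_nhds_iff.mp this
      refine ⟨min (ε / 2) (L / 2), lt_min (by positivity) (by linarith [h.pos]),
        (min_le_right _ _).trans_lt (by linarith [h.pos]), fun s hs => hb' ?_⟩
      rw [Real.dist_eq, sub_zero, abs_of_neg hs.2]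
      linarith [hs.1, min_le_left (ε / 2) (L / 2)]
  have hper : ∀ s ∈ Ico (L - η) L, γ s ≠ x := fun s hs => by
    have := hη' (s - L) ⟨by linarith [hs.1], by linarith [hs.2]⟩
    rwa [h.periodic.sub_eq] at this
  refine ⟨η, hη, fun s hs hsx => ?_, fun s hs => ?_⟩
  · refine ⟨⟨?_, by linarith [hs.2]⟩, hsx⟩
    by_contra hlt
    exact hη' s ⟨hs.1, not_le.mp hlt⟩ hsx
  · refine ⟨by linarith [hs.1.1], ?_⟩
    by_contra hle
    exact hper s ⟨not_lt.mp hle, hs.1.2⟩ hs.2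

end IsArcCurve

/-- Substitution u = s + rv and dominated convergence; (1 + v²)⁻¹ is the integrable majorant, suited
both to compactly supported profiles and to the Poisson kernel. -/
theorem tendsto_setIntegral_rescale {δ C s : ℝ} (hδ : 0 < δ) {f : ℝ → ℝ → ℂ} {g : ℝ → ℂ}
    (hfm : ∀ r, Measurable (f r))
    (hlim : ∀ᵐ v : ℝ, Tendsto (fun r : ℝ => (r : ℂ) * f r (s + r * v)) (𝓝[>] 0) (𝓝 (g v)))
    (hdom : ∀ᶠ r : ℝ in 𝓝[>] 0, ∀ v : ℝ, |r * v| < δ →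
      ‖(r : ℂ) * f r (s + r * v)‖ ≤ C * (1 + v ^ 2)⁻¹) :
    Tendsto (fun r => ∫ u in Ioo (s - δ) (s + δ), f r u) (𝓝[>] 0) (𝓝 (∫ v, g v)) := by
  set F : ℝ → ℝ → ℂ := fun r v =>
    (r : ℂ) * (Ioo (s - δ) (s + δ)).indicator (f r) (s + r * v) with hF
  have hmem : ∀ r v : ℝ, s + r * v ∈ Ioo (s - δ) (s + δ) ↔ |r * v| < δ := by
    intro r v
    rw [abs_lt, mem_Ioo]
    constructor <;> rintro ⟨h1, h2⟩ <;> constructor <;> linarith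
  have hev : (fun r => ∫ u in Ioo (s - δ) (s + δ), f r u) =ᶠ[𝓝[>] 0] fun r => ∫ v, F r v := by
    filter_upwards [self_mem_nhdsWithin] with r hr
    have hr : 0 < r := hr
    rw [← integral_indicator measurableSet_Ioo]
    simp only [hF]
    rw [integral_const_mul, Measure.integral_comp_mul_left
      (fun y => (Ioo (s - δ) (s + δ)).indicator (f r) (s + y)) r,
      integral_add_left_eq_self (fun y => (Ioo (s - δ) (s + δ)).indicator (f r) y) s,
      abs_of_pos (inv_pos.mpr hr), Complex.real_smul, ← mul_assoc, ← Complex.ofReal_mul,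
      mul_inv_cancel₀ hr.ne', Complex.ofReal_one, one_mul]
  refine Tendsto.congr' hev.symm ?_
  refine tendsto_integral_filter_of_dominated_convergence (fun v => C * (1 + v ^ 2)⁻¹)
    (Eventually.of_forall fun r => ?_) ?_ (integrable_inv_one_add_sq.const_mul C) ?_
  · exact ((((hfm r).indicator measurableSet_Ioo).comp (by fun_prop)).const_mul _).aestronglyMeasurable
  · filter_upwards [hdom] with r hr
    refine Eventually.of_forall fun v => ?_
    by_cases hv : |r * v| < δ
    · simp only [hF]
      rw [indicator_of_mem ((hmem r v).mpr hv)]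
      exact hr v hv
    · simp only [hF]
      rw [indicator_of_notMem (fun h => hv ((hmem r v).mp h)), mul_zero, norm_zero]
      have h0 := (norm_nonneg _).trans (hr 0 (by simpa using hδ))
      have : 0 ≤ C := by simpa using h0
      positivity
  · filter_upwards [hlim] with v hv
    refine hv.congr' ?_
    have h1 : Tendsto (fun r : ℝ => |r * v|) (𝓝[>] 0) (𝓝 0) := by
      have : Tendsto (fun r : ℝ => |r * v|) (𝓝 0) (𝓝 |0 * v|) := by
        apply Continuous.tendsto; fun_prop
      rw [zero_mul, abs_zero] at this
      exact this.mono_left nhdsWithin_le_nhds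
    filter_upwards [h1.eventually_lt_const hδ] with r hr
    simp only [hF]
    rw [indicator_of_mem ((hmem r v).mpr hr)]

/-- Integrals of functions concentrating at finitely many points at scale `r → 0`. -/
theorem tendsto_integral_concentrating {a b δ C : ℝ} (hδ : 0 < δ) (hab : a ≤ b) {S : Finset ℝ}
    (hin : ∀ s ∈ S, a ≤ s - δ ∧ s + δ ≤ b)
    (hsep : ∀ s ∈ S, ∀ s' ∈ S, s ≠ s' → 2 * δ ≤ |s - s'|) {f g : ℝ → ℝ → ℂ}
    (hfm : ∀ r, Measurable (f r))
    (hlim : ∀ s ∈ S, ∀ᵐ v : ℝ,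
      Tendsto (fun r : ℝ => (r : ℂ) * f r (s + r * v)) (𝓝[>] 0) (𝓝 (g s v)))
    (hdom : ∀ᶠ r : ℝ in 𝓝[>] 0, ∀ s ∈ S, ∀ v : ℝ, |r * v| < δ →
      ‖(r : ℂ) * f r (s + r * v)‖ ≤ C * (1 + v ^ 2)⁻¹)
    (hfar : ∀ᶠ r : ℝ in 𝓝[>] 0, ∀ s ∈ Icc a b, (∀ s₀ ∈ S, δ ≤ |s - s₀|) → ‖f r s‖ ≤ C * r) :
    Tendsto (fun r => ∫ s in a..b, f r s) (𝓝[>] 0) (𝓝 (∑ s ∈ S, ∫ v, g s v)) := by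
  set J : ℝ → Set ℝ := fun s => Ioo (s - δ) (s + δ) with hJ
  set R : Set ℝ := Icc a b \ ⋃ s ∈ S, J s with hR
  have hJm : ∀ s, MeasurableSet (J s) := fun s => measurableSet_Ioo
  have hUm : MeasurableSet (⋃ s ∈ S, J s) := S.measurableSet_biUnion fun s _ => hJm s
  have hRm : MeasurableSet R := measurableSet_Icc.diff hUm
  have hmemJ : ∀ s u, u ∈ J s ↔ |u - s| < δ := by
    intro s u
    rw [abs_lt, hJ, mem_Ioo]
    constructor <;> rintro ⟨h1, h2⟩ <;> constructor <;> linarith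
  have hRfar : ∀ u ∈ R, ∀ s₀ ∈ S, δ ≤ |u - s₀| := by
    intro u hu s₀ hs₀
    by_contra hlt
    exact hu.2 (mem_biUnion hs₀ ((hmemJ s₀ u).mpr (not_le.mp hlt)))
  have hsub : (⋃ s ∈ S, J s) ⊆ Icc a b := by
    intro u hu
    obtain ⟨s, hs, hus⟩ := mem_iUnion₂.mp hu
    exact ⟨by linarith [(hin s hs).1, hus.1], by linarith [(hin s hs).2, hus.2]⟩
  have hdisj : (S : Set ℝ).PairwiseDisjoint J := by
    intro s hs s' hs' hne
    refine disjoint_left.mpr fun u hu hu' => ?_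
    rw [hmemJ] at hu hu'
    have h1 := hsep s hs s' hs' hne
    have h2 := abs_sub_le s u s'
    rw [abs_sub_comm s u] at h2
    linarith
  have hRv : volume R ≠ ⊤ := ((measure_mono sdiff_subset).trans_lt measure_Icc_lt_top).ne
  -- Away from the concentration points the integrand is O(r) on a set of finite measure.
  have hrest : Tendsto (fun r => ∫ u in R, f r u) (𝓝[>] 0) (𝓝 0) := by
    have hz : Tendsto (fun r : ℝ => C * r * volume.real R) (𝓝[>] 0) (𝓝 0) := by
      have : Tendsto (fun r : ℝ => C * r * volume.real R) (𝓝 0) (𝓝 (C * 0 * volume.real R)) := by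
        apply Continuous.tendsto; fun_prop
      simp only [mul_zero, zero_mul] at this
      exact this.mono_left nhdsWithin_le_nhds
    refine squeeze_zero_norm' ?_ hz
    filter_upwards [hfar] with r hr
    exact norm_setIntegral_le_of_norm_le_const hRv.lt_top
      fun u hu => hr u hu.1 (hRfar u hu)
  have hsum : Tendsto (fun r => ∑ s ∈ S, ∫ u in J s, f r u) (𝓝[>] 0)
      (𝓝 (∑ s ∈ S, ∫ v, g s v)) := by
    refine tendsto_finsetSum S fun s hs => ?_
    refine tendsto_setIntegral_rescale (C := C) hδ hfm (hlim s hs) ?_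
    filter_upwards [hdom] with r hr using hr s hs
  have htot := hrest.add hsum
  rw [zero_add] at htot
  refine htot.congr' ?_
  filter_upwards [hdom, hfar, self_mem_nhdsWithin] with r hr1 hr2 hr
  have hr : 0 < r := hr
  have hRi : IntegrableOn (f r) R := by
    refine Measure.integrableOn_of_bounded (M := C * r) hRv (hfm r).aestronglyMeasurable ?_
    exact (ae_restrict_iff' hRm).mpr (Eventually.of_forall fun u hu => hr2 u hu.1 (hRfar u hu))
  have hJi : ∀ s ∈ S, IntegrableOn (f r) (J s) := by
    intro s hs
    have h0 := (norm_nonneg _).trans (hr1 s hs 0 (by simpa using hδ))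
    have hC : 0 ≤ C := by simpa using h0
    refine Measure.integrableOn_of_bounded (M := r⁻¹ * C) measure_Ioo_lt_top.ne
      (hfm r).aestronglyMeasurable ?_
    refine (ae_restrict_iff' (hJm s)).mpr (Eventually.of_forall fun u hu => ?_)
    have h1 := hr1 s hs (r⁻¹ * (u - s)) (by
      rw [mul_inv_cancel_left₀ hr.ne']; exact (hmemJ s u).mp hu)
    rw [mul_inv_cancel_left₀ hr.ne', add_sub_cancel, norm_mul, Complex.norm_real,
      Real.norm_of_nonneg hr.le] at h1
    have h2 : C * (1 + (r⁻¹ * (u - s)) ^ 2)⁻¹ ≤ C * 1 := by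
      gcongr
      exact inv_le_one_of_one_le₀ (by nlinarith [sq_nonneg (r⁻¹ * (u - s))])
    rw [inv_mul_eq_div, le_div_iff₀ hr]
    linarith
  have hUi : IntegrableOn (f r) (⋃ s ∈ S, J s) := by
    rw [integrableOn_finset_iUnion]
    exact hJi
  rw [intervalIntegral.integral_of_le hab, ← integral_Icc_eq_integral_Ioc,
    ← integral_biUnion_finset S (fun s _ => hJm s) hdisj hJi,
    ← setIntegral_union disjoint_sdiff_left hUm hRi hUi, sdiff_union_of_subset hsub]

namespace IsArcCurve

variable {L : ℝ} {γ : ℝ → ℂ}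

/-- Near a point, a closed curve consists of finitely many almost straight branches. -/
theorem exists_branches (h : IsArcCurve L γ) (x : ℂ) {ε : ℝ} (hε : 0 < ε) :
    ∃ (S : Finset ℝ) (η δ c : ℝ), (S : Set ℝ) = preimages L γ x ∧ 0 < δ ∧ 0 < c ∧
      (∀ s ∈ S, -η ≤ s - δ ∧ s + δ ≤ L - η) ∧
      (∀ s ∈ S, ∀ s' ∈ S, s ≠ s' → 2 * δ ≤ |s - s'|) ∧
      (∀ s s', |s' - s| ≤ δ →
        ‖γ s' - γ s - ((s' - s : ℝ) : ℂ) * deriv γ s‖ ≤ ε * |s' - s|) ∧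
      ∀ s ∈ Icc (-η) (L - η), (∀ s₀ ∈ S, δ ≤ |s - s₀|) → c ≤ ‖γ s - x‖ := by
  obtain ⟨η, hη, hw1, hw2⟩ := h.exists_window x
  obtain ⟨δ₀, hδ₀, hlin⟩ := h.linear_approx hε
  set S := (h.finite_preimages x).toFinset with hS
  have hmem : ∀ s, s ∈ S ↔ s ∈ preimages L γ x := fun s => by simp [hS]
  have hsmall : ∀ d : ℝ, 0 < d → ∀ᶠ δ : ℝ in 𝓝[>] 0, δ ≤ d := fun d hd =>
    nhdsWithin_le_nhds ((eventually_lt_nhds hd).mono fun _ => le_of_lt)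
  have h1 : ∀ᶠ δ : ℝ in 𝓝[>] 0, ∀ s ∈ S, δ ≤ s + η ∧ δ ≤ L - η - s := by
    rw [eventually_all_finset]
    intro s hs
    have := hw2 s ((hmem s).mp hs)
    exact (hsmall _ (by linarith)).and (hsmall _ (by linarith))
  have h2 : ∀ᶠ δ : ℝ in 𝓝[>] 0, ∀ s ∈ S, ∀ s' ∈ S, s ≠ s' → 2 * δ ≤ |s - s'| := by
    rw [eventually_all_finset]
    intro s hs
    rw [eventually_all_finset]
    intro s' hs'
    by_cases hne : s = s'
    · exact Eventually.of_forall fun _ h => absurd hne h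
    · have : 0 < |s - s'| := abs_pos.mpr (sub_ne_zero.mpr hne)
      filter_upwards [hsmall (|s - s'| / 2) (by positivity)] with δ hδ _
      linarith
  obtain ⟨δ, hδ1, hδ2, hδ3, hδ⟩ :=
    (h1.and (h2.and ((hsmall δ₀ hδ₀).and self_mem_nhdsWithin))).exists
  have hδ : 0 < δ := hδ
  obtain ⟨c, hc, hcb⟩ : ∃ c > 0, ∀ s ∈ Icc (-η) (L - η), (∀ s₀ ∈ S, δ ≤ |s - s₀|) →
      c ≤ ‖γ s - x‖ := by
    -- What remains of the period is compact and contains no preimage of x, so the distance to x has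
    -- a positive minimum on it.
    set K := Icc (-η) (L - η) ∩ ⋂ s₀ ∈ S, {s : ℝ | δ ≤ |s - s₀|} with hK
    have hKc : IsCompact K := by
      refine isCompact_Icc.inter_right (isClosed_biInter fun s₀ _ => ?_)
      exact isClosed_le continuous_const (by fun_prop)
    have hmK : ∀ s, s ∈ K ↔ s ∈ Icc (-η) (L - η) ∧ ∀ s₀ ∈ S, δ ≤ |s - s₀| := by
      intro s; simp [hK]
    rcases K.eq_empty_or_nonempty with hemp | hne
    · exact ⟨1, one_pos, fun s hs hs' => absurd ((hmK s).mpr ⟨hs, hs'⟩) (by simp [hemp])⟩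
    · obtain ⟨s₁, hs₁, hmin⟩ := hKc.exists_isMinOn hne
        ((h.continuous.sub continuous_const).norm (E := ℂ)).continuousOn (f := fun s => ‖γ s - x‖)
      have hs₁' := (hmK s₁).mp hs₁
      refine ⟨‖γ s₁ - x‖, norm_pos_iff.mpr fun h0 => ?_, fun s hs hs' =>
        hmin ((hmK s).mpr ⟨hs, hs'⟩)⟩
      have := hs₁'.2 s₁ ((hmem s₁).mpr (hw1 s₁ hs₁'.1 (sub_eq_zero.mp h0)))
      rw [sub_self, abs_zero] at this
      linarith
  exact ⟨S, η, δ, c, by simp [hS], hδ, hc,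
    fun s hs => ⟨by linarith [(hδ1 s hs).1], by linarith [(hδ1 s hs).2]⟩, hδ2,
    fun s s' hs => hlin s s' (hs.trans hδ3), hcb⟩

theorem tendsto_rescale (h : IsArcCurve L γ) (s v : ℝ) :
    Tendsto (fun r : ℝ => (γ (s + r * v) - γ s) / r) (𝓝[>] 0) (𝓝 (v * deriv γ s)) := by
  have h1 : HasDerivAt (fun r : ℝ => γ (s + r * v)) (v * deriv γ s) 0 := by
    have h2 : HasDerivAt (fun r : ℝ => s + r * v) v 0 := by
      simpa using ((hasDerivAt_id (0 : ℝ)).mul_const v).const_add s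
    have h3 : HasDerivAt γ (deriv γ s) (s + 0 * v) := by simpa using h.hasDerivAt s
    have := h3.scomp (0 : ℝ) h2
    rwa [Complex.real_smul] at this
  have h4 := h1.tendsto_slope_zero_right
  refine h4.congr fun r => ?_
  rw [Complex.real_smul, zero_add, zero_mul, add_zero, Complex.ofReal_inv, inv_mul_eq_div]

theorem tendsto_deriv_rescale (h : IsArcCurve L γ) (s v : ℝ) :
    Tendsto (fun r : ℝ => deriv γ (s + r * v)) (𝓝[>] 0) (𝓝 (deriv γ s)) := by
  have : Tendsto (fun r : ℝ => deriv γ (s + r * v)) (𝓝 0) (𝓝 (deriv γ (s + 0 * v))) := by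
    apply Continuous.tendsto
    exact h.continuous_deriv.comp (by fun_prop)
  rw [zero_mul, add_zero] at this
  exact this.mono_left nhdsWithin_le_nhds

theorem integral_window {f : ℝ → ℂ} (hf : Function.Periodic f L) (η : ℝ) :
    ∫ s in (-η)..(L - η), f s = ∫ s in (0 : ℝ)..L, f s := by
  have := hf.intervalIntegral_add_eq (-η) 0
  rwa [zero_add, neg_add_eq_sub] at this

open Classical in
/-- The part of the curve in a small disk, to first order. -/
theorem tendsto_integral_ball (h : IsArcCurve L γ) (x : ℂ) :
    Tendsto (fun r : ℝ => ∫ s in (0 : ℝ)..L,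
      (r : ℂ)⁻¹ * (γ ⁻¹' Metric.ball x r).indicator (deriv γ) s) (𝓝[>] 0)
      (𝓝 (2 * ∑ᶠ s ∈ preimages L γ x, deriv γ s)) := by
  obtain ⟨S, η, δ, c, hS, hδ, hc, hin, hsep, hlin, hfar⟩ :=
    h.exists_branches x (ε := 1 / 2) (by norm_num)
  have hmem : ∀ s ∈ S, γ s = x := fun s hs =>
    (show s ∈ preimages L γ x by rw [← hS]; exact hs).2
  set f : ℝ → ℝ → ℂ := fun r s => (r : ℂ)⁻¹ * (γ ⁻¹' Metric.ball x r).indicator (deriv γ) s with hf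
  have hball : ∀ r s, s ∈ γ ⁻¹' Metric.ball x r ↔ ‖γ s - x‖ < r := fun r s => by
    rw [mem_preimage, Metric.mem_ball, dist_eq_norm]
  have hper : ∀ r, Function.Periodic (f r) L := by
    intro r s
    simp only [hf, indicator, hball]
    rw [h.periodic s, periodic_deriv h.periodic s]
  -- At scale r a branch fills the disk for |v| < 1, which gives the mass 2γ'(s). The bound 5 comes
  -- from |v| < 2 on the part of the branch in the disk, so that 1 + v² ≤ 5.
  have hkey := tendsto_integral_concentrating (a := -η) (b := L - η) (C := 5) (f := f)
    (g := fun s v => (Ioo (-1 : ℝ) 1).indicator (fun _ => deriv γ s) v) hδ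
    (by linarith [h.pos]) hin hsep ?_ ?_ ?_ ?_
  · simp_rw [integral_window (hper _) η] at hkey
    convert hkey using 2
    rw [← hS, finsum_mem_coe_finset, Finset.mul_sum]
    refine Finset.sum_congr rfl fun s _ => ?_
    rw [integral_indicator measurableSet_Ioo, setIntegral_const,
      Real.volume_real_Ioo_of_le (by norm_num), Complex.real_smul]
    norm_num
  · intro r
    exact (h.continuous_deriv.measurable.indicator
      (h.continuous.measurable measurableSet_ball)).const_mul _
  · intro s hs
    -- At v = ±1 the branch is on the boundary circle to first order and membership in the disk is
    -- undecided.
    have hne : ∀ᵐ v : ℝ, v ∉ ({1, -1} : Set ℝ) :=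
      measure_eq_zero_iff_ae_notMem.mp ((Set.toFinite _).measure_zero _)
    filter_upwards [hne] with v hv
    have hv : |v| ≠ 1 := fun h1 => by
      rcases eq_or_eq_neg_of_abs_eq h1 with h2 | h2 <;> simp [h2] at hv
    have h1 := (h.tendsto_rescale s v).norm
    rw [norm_mul, h.norm_deriv, mul_one, Complex.norm_real, Real.norm_eq_abs, hmem s hs] at h1
    have hd := h.tendsto_deriv_rescale s v
    rcases lt_or_gt_of_ne hv with hlt | hgt
    · rw [indicator_of_mem (by exact abs_lt.mp hlt)]
      refine hd.congr' ?_
      filter_upwards [h1.eventually_lt_const hlt, self_mem_nhdsWithin] with r hr hr0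
      have hr0 : 0 < r := hr0
      rw [norm_div, Complex.norm_real, Real.norm_of_nonneg hr0.le, div_lt_one hr0] at hr
      simp only [hf]
      rw [indicator_of_mem ((hball _ _).mpr hr), mul_inv_cancel_left₀]
      exact_mod_cast hr0.ne'
    · rw [indicator_of_notMem (show v ∉ Ioo (-1 : ℝ) 1 from
        fun h2 => absurd hgt (not_lt.mpr (abs_lt.mpr h2).le))]
      refine tendsto_const_nhds.congr' ?_
      filter_upwards [h1.eventually_const_lt hgt, self_mem_nhdsWithin] with r hr hr0
      have hr0 : 0 < r := hr0
      rw [norm_div, Complex.norm_real, Real.norm_of_nonneg hr0.le, one_lt_div hr0] at hr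
      simp only [hf]
      rw [indicator_of_notMem (fun h2 => absurd hr (not_lt.mpr ((hball _ _).mp h2).le))]
      simp
  · filter_upwards [self_mem_nhdsWithin] with r hr0 s hs v hv
    have hr0 : 0 < r := hr0
    have hrc : (r : ℂ) ≠ 0 := by exact_mod_cast hr0.ne'
    simp only [hf]
    rw [mul_inv_cancel_left₀ hrc]
    by_cases hb : s + r * v ∈ γ ⁻¹' Metric.ball x r
    · rw [indicator_of_mem hb, h.norm_deriv]
      rw [hball] at hb
      have h1 := hlin s (s + r * v) (by rw [add_sub_cancel_left]; exact hv.le)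
      rw [hmem s hs, add_sub_cancel_left] at h1
      have h2 := norm_sub_norm_le (((r * v : ℝ) : ℂ) * deriv γ s) (γ (s + r * v) - x)
      rw [norm_sub_rev (((r * v : ℝ) : ℂ) * deriv γ s), norm_mul, h.norm_deriv, mul_one,
        Complex.norm_real, Real.norm_eq_abs] at h2
      have h3 : |r * v| < 2 * r := by linarith
      rw [abs_mul, abs_of_pos hr0, mul_comm] at h3
      have h4 : |v| < 2 := lt_of_mul_lt_mul_right h3 hr0.le
      have h5 : v ^ 2 < 4 := by
        rw [← sq_abs]
        nlinarith [abs_nonneg v]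
      rw [← div_eq_mul_inv, le_div_iff₀ (by positivity)]
      linarith
    · rw [indicator_of_notMem hb, norm_zero]
      positivity
  · filter_upwards [nhdsWithin_le_nhds (eventually_lt_nhds hc), self_mem_nhdsWithin] with r hr hr0 s
      hs hs'
    have hr0 : 0 < r := hr0
    have := hfar s hs hs'
    simp only [hf]
    rw [indicator_of_notMem (fun h2 => absurd ((hball _ _).mp h2) (by linarith)), mul_zero, norm_zero]
    positivity

theorem integral_poisson (a : ℂ) : ∫ v : ℝ, (a / Real.pi) * ((1 + v ^ 2)⁻¹ : ℝ) = a := by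
  rw [integral_const_mul, integral_complex_ofReal, integral_univ_inv_one_add_sq]
  have hpi : (Real.pi : ℂ) ≠ 0 := by exact_mod_cast Real.pi_ne_zero
  field_simp

/-- The jump of the winding number across a curve all of whose branches through the point `x` are
tangent to the direction `T`. -/
theorem tendsto_wind_sub (h : IsArcCurve L γ) {x T : ℂ} (hT : ‖T‖ = 1)
    (hpar : ∀ s ∈ preimages L γ x, deriv γ s = T ∨ deriv γ s = -T) :
    Tendsto (fun r : ℝ => wind L γ (x + r * (Complex.I * T)) - wind L γ (x - r * (Complex.I * T)))
      (𝓝[>] 0) (𝓝 (∑ᶠ s ∈ preimages L γ x, deriv γ s / T)) ∧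
    ∀ᶠ r : ℝ in 𝓝[>] 0,
      x + r * (Complex.I * T) ∉ range γ ∧ x - r * (Complex.I * T) ∉ range γ := by
  have hT0 : T ≠ 0 := fun h0 => by simp [h0] at hT
  obtain ⟨S, η, δ, c, hS, hδ, hc, hin, hsep, hlin, hfar⟩ :=
    h.exists_branches x (ε := 1 / 4) (by norm_num)
  have hmem' : ∀ s ∈ S, s ∈ preimages L γ x := fun s hs => by rw [← hS]; exact hs
  have hmem : ∀ s ∈ S, γ s = x := fun s hs => (hmem' s hs).2
  -- The difference of the Cauchy kernels with poles x ± irT, over the common denominator D, is a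
  -- complex Poisson kernel for the tangent line.
  set D : ℝ → ℝ → ℂ := fun r s => (γ s - x) ^ 2 + r ^ 2 * T ^ 2 with hD
  set f : ℝ → ℝ → ℂ := fun r s => (r / Real.pi) * T * deriv γ s / D r s with hf
  have hDper : ∀ r, Function.Periodic (D r) L := fun r s => by
    simp only [hD]; rw [h.periodic s]
  have hper : ∀ r, Function.Periodic (f r) L := by
    intro r s
    simp only [hf]
    rw [periodic_deriv h.periodic s, hDper r s]
  have hnear : ∀ r : ℝ, 0 < r → ∀ s ∈ S, ∀ v : ℝ, |r * v| < δ →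
      r ^ 2 * (1 + v ^ 2) / 2 ≤ ‖D r (s + r * v)‖ := by
    intro r hr s hs v hv
    have h1 := hlin s (s + r * v) (by rw [add_sub_cancel_left]; exact hv.le)
    rw [hmem s hs, add_sub_cancel_left] at h1
    -- In the frame of T the branch is the real number ±rv up to an error |rv|/4. Hence Re(w² + r²)
    -- ≥ (9/16 − 1/16)(rv)² + r², which is at least r²(1 + v²)/2.
    set w : ℂ := (γ (s + r * v) - x) / T with hw
    obtain ⟨τ, hτ, hτv⟩ : ∃ τ : ℝ, deriv γ s = τ * T ∧ τ ^ 2 = 1 := by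
      rcases hpar s (hmem' s hs) with h2 | h2
      · exact ⟨1, by simp [h2], by norm_num⟩
      · exact ⟨-1, by simp [h2], by norm_num⟩
    have hDw : D r (s + r * v) = T ^ 2 * (w ^ 2 + r ^ 2) := by
      simp only [hD, hw]; field_simp
    have hwe : ‖w - ((r * v * τ : ℝ) : ℂ)‖ ≤ 1 / 4 * |r * v| := by
      have : w - ((r * v * τ : ℝ) : ℂ) = (γ (s + r * v) - x - ((r * v : ℝ) : ℂ) * deriv γ s) / T := by
        rw [hw, hτ]; field_simp; push_cast; ring
      rw [this, norm_div, hT, div_one]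
      exact h1
    have hre := (Complex.abs_re_le_norm _).trans hwe
    have him := (Complex.abs_im_le_norm _).trans hwe
    rw [Complex.sub_re, Complex.ofReal_re] at hre
    rw [Complex.sub_im, Complex.ofReal_im, sub_zero] at him
    have hre2 : (9 / 16) * (r * v) ^ 2 ≤ w.re ^ 2 := by
      have h2 : |r * v * τ| = |r * v| := by
        rw [abs_mul, show |τ| = 1 from by rw [← sq_eq_sq₀ (abs_nonneg _) zero_le_one, sq_abs, hτv]; norm_num,
          mul_one]
      have h3 := abs_sub_abs_le_abs_sub (r * v * τ) w.re
      rw [abs_sub_comm, h2] at h3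
      have h4 : 3 / 4 * |r * v| ≤ |w.re| := by linarith
      rw [← sq_abs (r * v), ← sq_abs w.re]
      nlinarith [abs_nonneg (r * v)]
    have him2 : w.im ^ 2 ≤ (1 / 16) * (r * v) ^ 2 := by
      rw [← sq_abs (r * v), ← sq_abs w.im]
      nlinarith [abs_nonneg (r * v), abs_nonneg w.im]
    rw [hDw, norm_mul, norm_pow, hT, one_pow, one_mul]
    refine le_trans ?_ (Complex.re_le_norm _)
    have : (w ^ 2 + (r : ℂ) ^ 2).re = w.re ^ 2 - w.im ^ 2 + r ^ 2 := by
      simp [sq]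
    rw [this]
    nlinarith [sq_nonneg (r * v), sq_nonneg r]
  have hfarD : ∀ r : ℝ, 0 < r → r ^ 2 < c ^ 2 / 2 → ∀ s ∈ Icc (-η) (L - η),
      (∀ s₀ ∈ S, δ ≤ |s - s₀|) → c ^ 2 / 2 ≤ ‖D r s‖ := by
    intro r hr hrc s hs hs'
    have h1 := hfar s hs hs'
    have h2 := norm_sub_le_norm_add ((γ s - x) ^ 2) ((r : ℂ) ^ 2 * T ^ 2)
    rw [norm_pow, norm_mul, norm_pow, norm_pow, hT, Complex.norm_real, Real.norm_of_nonneg hr.le]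
      at h2
    simp only [hD]
    nlinarith
  have hsmall : ∀ᶠ r : ℝ in 𝓝[>] 0, r ^ 2 < c ^ 2 / 2 := by
    have : Tendsto (fun r : ℝ => r ^ 2) (𝓝 0) (𝓝 (0 ^ 2)) := by
      apply Continuous.tendsto; fun_prop
    rw [zero_pow two_ne_zero] at this
    exact nhdsWithin_le_nhds (this.eventually_lt_const (by positivity))
  -- Each parameter, reduced to the window, is either close to a branch point or far from all of
  -- them, and D is bounded below in both cases.
  have hDne : ∀ᶠ r : ℝ in 𝓝[>] 0, ∀ s, D r s ≠ 0 := by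
    filter_upwards [hsmall, self_mem_nhdsWithin] with r hr hr0 s
    have hr0 : 0 < r := hr0
    obtain ⟨s', hs', hss⟩ := (hDper r).exists_mem_Ico h.pos s (-η)
    have hs'' : s' ∈ Icc (-η) (L - η) := ⟨hs'.1, by linarith [hs'.2]⟩
    rw [hss, ← norm_pos_iff]
    by_cases hcase : ∀ s₀ ∈ S, δ ≤ |s' - s₀|
    · exact lt_of_lt_of_le (by positivity) (hfarD r hr0 hr s' hs'' hcase)
    · push Not at hcase
      obtain ⟨s₀, hs₀, hlt⟩ := hcase
      have := hnear r hr0 s₀ hs₀ (r⁻¹ * (s' - s₀)) (by rwa [mul_inv_cancel_left₀ hr0.ne'])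
      rw [mul_inv_cancel_left₀ hr0.ne', add_sub_cancel] at this
      exact lt_of_lt_of_le (by positivity) this
  have hfact : ∀ (r s : ℝ), D r s = (γ s - (x + r * (Complex.I * T))) *
      (γ s - (x - r * (Complex.I * T))) := by
    intro r s
    simp only [hD]
    linear_combination ((r : ℂ) ^ 2 * T ^ 2) * Complex.I_sq
  have hoff : ∀ᶠ r : ℝ in 𝓝[>] 0,
      x + r * (Complex.I * T) ∉ range γ ∧ x - r * (Complex.I * T) ∉ range γ := by
    filter_upwards [hDne] with r hr
    constructor <;> rintro ⟨s, hs⟩ <;> refine hr s ?_ <;> rw [hfact, hs] <;> simp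
  refine ⟨?_, hoff⟩
  have hpi := Real.pi_pos
  -- Each branch contributes a Poisson kernel of total mass γ'(s)/T = ±1. The constant adds the
  -- bound 2/π near the branches to 2/(πc²) away from them.
  have hkey := tendsto_integral_concentrating (a := -η) (b := L - η)
    (C := 2 / Real.pi + 2 / (Real.pi * c ^ 2)) (f := f)
    (g := fun s v => (deriv γ s / T / Real.pi) * ((1 + v ^ 2)⁻¹ : ℝ)) hδ
    (by linarith [h.pos]) hin hsep ?_ ?_ ?_ ?_
  · simp_rw [integral_poisson, integral_window (hper _) η] at hkey
    rw [← hS, finsum_mem_coe_finset]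
    refine hkey.congr' ?_
    filter_upwards [hoff, hDne] with r hr hrD
    have hi1 := (h.continuous_windIntegrand hr.1).intervalIntegrable (μ := volume) 0 L
    have hi2 := (h.continuous_windIntegrand hr.2).intervalIntegrable (μ := volume) 0 L
    rw [wind, wind, ← mul_sub, ← intervalIntegral.integral_sub hi1 hi2,
      ← intervalIntegral.integral_const_mul]
    refine intervalIntegral.integral_congr fun s _ => ?_
    have hD0 := hrD s
    have h1 : γ s - (x + r * (Complex.I * T)) ≠ 0 := fun h0 => hD0 (by rw [hfact, h0, zero_mul])
    have h2 : γ s - (x - r * (Complex.I * T)) ≠ 0 := fun h0 => hD0 (by rw [hfact, h0, mul_zero])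
    have hpic : (Real.pi : ℂ) ≠ 0 := by exact_mod_cast Real.pi_ne_zero
    simp only [hf]
    rw [hfact]
    have hBA : (γ s - (x - r * (Complex.I * T))) - (γ s - (x + r * (Complex.I * T))) =
        2 * Complex.I * r * T := by ring
    generalize γ s - (x - r * (Complex.I * T)) = B at *
    generalize γ s - (x + r * (Complex.I * T)) = A at *
    rw [div_sub_div _ _ h1 h2, mul_comm A (deriv γ s), ← mul_sub, hBA]
    field_simp
  · intro r
    have h1 := h.continuous_deriv.measurable
    have h2 := h.continuous.measurable
    simp only [hf, hD]
    fun_prop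
  · intro s hs
    refine Eventually.of_forall fun v => ?_
    have h1 := h.tendsto_rescale s v
    have h2 := h.tendsto_deriv_rescale s v
    rw [hmem s hs] at h1
    have hsq : deriv γ s ^ 2 = T ^ 2 := by
      rcases hpar s (hmem' s hs) with h3 | h3 <;> rw [h3]; ring
    have hne : (1 + (v : ℂ) ^ 2) ≠ 0 := by
      have : (0 : ℝ) < 1 + v ^ 2 := by positivity
      exact_mod_cast this.ne'
    have hden : (v * deriv γ s) ^ 2 + T ^ 2 ≠ 0 := by
      have : (v * deriv γ s) ^ 2 + T ^ 2 = T ^ 2 * (1 + (v : ℂ) ^ 2) := by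
        rw [mul_pow, hsq]; ring
      rw [this]
      exact mul_ne_zero (pow_ne_zero _ hT0) hne
    have h3 := ((h2.const_mul (T / Real.pi)).div ((h1.pow 2).add_const (T ^ 2)) hden)
    have hlimeq : T / Real.pi * deriv γ s / ((v * deriv γ s) ^ 2 + T ^ 2) =
        (deriv γ s / T / Real.pi) * ((1 + v ^ 2)⁻¹ : ℝ) := by
      have : (v * deriv γ s) ^ 2 + T ^ 2 = T ^ 2 * (1 + (v : ℂ) ^ 2) := by
        rw [mul_pow, hsq]; ring
      rw [this]
      push_cast
      field_simp
    rw [← hlimeq]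
    refine h3.congr' ?_
    filter_upwards [self_mem_nhdsWithin] with r hr0
    have hrc : (r : ℂ) ≠ 0 := by exact_mod_cast (ne_of_gt hr0)
    simp only [hf, hD, Pi.div_apply]
    have : (((γ (s + r * v) - x) / r) ^ 2 + T ^ 2) =
        ((γ (s + r * v) - x) ^ 2 + r ^ 2 * T ^ 2) / r ^ 2 := by
      field_simp
    rw [this, div_div_eq_mul_div]
    ring
  · filter_upwards [self_mem_nhdsWithin] with r hr0 s hs v hv
    have hr0 : 0 < r := hr0
    have h1 := hnear r hr0 s hs v hv
    simp only [hf]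
    rw [norm_mul, norm_div, norm_mul, norm_mul, norm_div, hT, h.norm_deriv, Complex.norm_real,
      Complex.norm_real, Real.norm_of_nonneg hr0.le, Real.norm_of_nonneg hpi.le, mul_one, mul_one]
    have h2 : 0 < r ^ 2 * (1 + v ^ 2) / 2 := by positivity
    calc r * (r / Real.pi / ‖D r (s + r * v)‖) ≤ r * (r / Real.pi / (r ^ 2 * (1 + v ^ 2) / 2)) := by
          gcongr
      _ = 2 / Real.pi * (1 + v ^ 2)⁻¹ := by field_simp
      _ ≤ _ := by
          gcongr
          have : 0 ≤ 2 / (Real.pi * c ^ 2) := by positivity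
          linarith
  · filter_upwards [hsmall, self_mem_nhdsWithin] with r hr hr0 s hs hs'
    have hr0 : 0 < r := hr0
    have h1 := hfarD r hr0 hr s hs hs'
    simp only [hf]
    rw [norm_div, norm_mul, norm_mul, norm_div, hT, h.norm_deriv, Complex.norm_real,
      Complex.norm_real, Real.norm_of_nonneg hr0.le, Real.norm_of_nonneg hpi.le, mul_one, mul_one]
    have h2 : 0 < c ^ 2 / 2 := by positivity
    calc r / Real.pi / ‖D r s‖ ≤ r / Real.pi / (c ^ 2 / 2) := by gcongr
      _ = 2 / (Real.pi * c ^ 2) * r := by field_simp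
      _ ≤ _ := by
          gcongr
          have : 0 ≤ 2 / Real.pi := by positivity
          linarith

end IsArcCurve

/-! ### The set enclosed by a simple closed curve -/

namespace IsArcCurve

variable {L : ℝ} {γ : ℝ → ℂ}

theorem exists_int_of_eq (h : IsArcCurve L γ) (hinj : InjOn γ (Ico 0 L)) {s s' : ℝ}
    (hs : γ s = γ s') : ∃ n : ℤ, s' = s + n * L := by
  have h1 := sub_toIcoDiv_zsmul_mem_Ico h.pos 0 s
  have h2 := sub_toIcoDiv_zsmul_mem_Ico h.pos 0 s'
  rw [zero_add] at h1 h2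
  set n := toIcoDiv h.pos 0 s
  set n' := toIcoDiv h.pos 0 s'
  have h3 := hinj h1 h2 (by rw [h.periodic.sub_zsmul_eq, h.periodic.sub_zsmul_eq, hs])
  refine ⟨n' - n, ?_⟩
  simp only [zsmul_eq_mul] at h3
  push_cast
  linarith

/-- Compactness: a zero of the distance would make τ a multiple of the period, which no τ in [δ, L −
δ] is. -/
theorem exists_le_norm_sub_of_injOn (h : IsArcCurve L γ) (hinj : InjOn γ (Ico 0 L)) {δ : ℝ}
    (hδ : 0 < δ) : ∃ c > 0, ∀ s τ, δ ≤ τ → τ ≤ L - δ → c ≤ ‖γ (s + τ) - γ s‖ := by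
  by_cases hδL : δ ≤ L - δ
  · have hK : IsCompact (Icc (0 : ℝ) L ×ˢ Icc δ (L - δ)) := isCompact_Icc.prod isCompact_Icc
    have hcont : Continuous fun p : ℝ × ℝ => ‖γ (p.1 + p.2) - γ p.1‖ := by
      have := h.continuous
      fun_prop
    obtain ⟨p, hp, hmin⟩ := hK.exists_isMinOn
      ⟨(0, δ), ⟨by simp [h.pos.le], by simp [hδL]⟩⟩ hcont.continuousOn
    refine ⟨_, norm_pos_iff.mpr (fun h0 => ?_ : γ (p.1 + p.2) - γ p.1 ≠ 0), fun s τ h1 h2 => ?_⟩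
    · obtain ⟨n, hn⟩ := h.exists_int_of_eq hinj (sub_eq_zero.mp h0).symm
      have h3 : p.2 = n * L := by linarith
      have h4 := hp.2
      rw [h3] at h4
      have h5 : (0 : ℝ) < n := by
        by_contra hle
        have := mul_nonpos_of_nonpos_of_nonneg (not_lt.mp hle) h.pos.le
        linarith [h4.1]
      have h6 : (1 : ℝ) ≤ n := by exact_mod_cast (by exact_mod_cast h5 : (0 : ℤ) < n)
      nlinarith [h4.2, h.pos]
    · have h3 := sub_toIcoDiv_zsmul_mem_Ico h.pos 0 s
      rw [zero_add] at h3
      set n := toIcoDiv h.pos 0 s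
      have h4 := hmin (show (s - n • L, τ) ∈ Icc (0 : ℝ) L ×ˢ Icc δ (L - δ) from
        ⟨⟨h3.1, h3.2.le⟩, h1, h2⟩)
      have h5 : s - n • L + τ = s + τ - n • L := by ring
      simpa only [mem_ofPred_eq, h5, h.periodic.sub_zsmul_eq] using h4
  · exact ⟨1, one_pos, fun s τ h1 h2 => absurd (h1.trans h2) hδL⟩

/-- A simple closed curve has a tubular neighbourhood of positive width. -/
theorem exists_reach (h : IsArcCurve L γ) (hinj : InjOn γ (Ico 0 L)) :
    ∃ ε > 0, ∀ s t : ℝ, t ≠ 0 → |t| < ε → γ s + t * (Complex.I * deriv γ s) ∉ range γ := by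
  obtain ⟨δ, hδ, hlin⟩ := h.linear_approx (ε := 1 / 2) (by norm_num)
  obtain ⟨c, hc, hcb⟩ := h.exists_le_norm_sub_of_injOn hinj hδ
  refine ⟨c, hc, ?_⟩
  rintro s t ht htc ⟨s₁, hs₁⟩
  obtain ⟨s', hs', hss⟩ := h.periodic.exists_mem_Ico h.pos s₁ (s - δ)
  rw [hss] at hs₁
  -- The parameter s' lies in one period starting at s − δ. If it is close to s, the almost straight
  -- arc has a tangential displacement that a normal vector lacks. If not, the arcs are at distance
  -- at least c > |t|.
  by_cases hcase : s' - s ≤ δ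
  · have h1 := hlin s s' (abs_le.mpr ⟨by linarith [hs'.1], hcase⟩)
    have h0 : deriv γ s ≠ 0 := fun h0 => by
      have := h.norm_deriv s
      rw [h0, norm_zero] at this
      exact zero_ne_one this
    have h2 : γ s' - γ s - ((s' - s : ℝ) : ℂ) * deriv γ s =
        (t * Complex.I - ((s' - s : ℝ) : ℂ)) * deriv γ s := by
      rw [hs₁]; ring
    rw [h2, norm_mul, h.norm_deriv, mul_one] at h1
    have h3 := (Complex.abs_re_le_norm _).trans h1
    have h4 : (t * Complex.I - ((s' - s : ℝ) : ℂ)).re = -(s' - s) := by simp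
    rw [h4, abs_neg] at h3
    have h5 : |s' - s| = 0 := le_antisymm (by linarith) (abs_nonneg _)
    have h6 := (Complex.abs_im_le_norm _).trans h1
    have h7 : (t * Complex.I - ((s' - s : ℝ) : ℂ)).im = t := by simp
    rw [h7, h5, mul_zero] at h6
    exact ht (abs_eq_zero.mp (le_antisymm h6 (abs_nonneg _)))
  · have h1 := hcb s (s' - s) (not_le.mp hcase).le (by linarith [hs'.2])
    rw [add_sub_cancel, hs₁, add_sub_cancel_left, norm_mul, norm_mul, h.norm_deriv,
      Complex.norm_I, Complex.norm_real, Real.norm_eq_abs] at h1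
    linarith

/-- The nearest point projection: from a point off the curve one reaches a point of the curve
along the normal, without meeting the curve. -/
theorem exists_normal_segment (h : IsArcCurve L γ) {z : ℂ} (hz : z ∉ range γ) :
    ∃ s t : ℝ, t ≠ 0 ∧ z = γ s + t * (Complex.I * deriv γ s) ∧
      ∀ u ∈ Ioc (0 : ℝ) 1, γ s + (u * t : ℝ) * (Complex.I * deriv γ s) ∉ range γ := by
  have hcont : Continuous fun s => ‖γ s - z‖ ^ 2 := (h.continuous.sub continuous_const).norm.pow 2
  obtain ⟨s, -, hmin⟩ := isCompact_Icc.exists_isMinOn ⟨0, by simp [h.pos.le]⟩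
    (hcont.continuousOn (s := Icc 0 L))
  have hmin' : ∀ s', ‖γ s - z‖ ^ 2 ≤ ‖γ s' - z‖ ^ 2 := by
    intro s'
    obtain ⟨s₁, hs₁, he⟩ := h.periodic.exists_mem_Ico₀ h.pos s'
    rw [he]
    exact hmin (Ico_subset_Icc_self hs₁)
  have hloc : IsLocalMin (fun s => ‖γ s - z‖ ^ 2) s := Eventually.of_forall hmin'
  have hd := ((h.hasDerivAt s).sub_const z).norm_sq
  have hzero := hloc.hasDerivAt_eq_zero hd
  have h0 : deriv γ s ≠ 0 := fun h0 => by
    have := h.norm_deriv s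
    rw [h0, norm_zero] at this
    exact zero_ne_one this
  set w := (z - γ s) / deriv γ s with hw
  have hzw : z - γ s = w * deriv γ s := by rw [hw]; field_simp
  have hre : w.re = 0 := by
    have h1 : inner ℝ (γ s - z) (deriv γ s) = 0 := by linarith
    have h2 : γ s - z = -(w * deriv γ s) := by rw [← hzw]; ring
    rw [h2, inner_neg_left, Complex.inner] at h1
    have h3 : deriv γ s * (starRingEnd ℂ) (w * deriv γ s) = (starRingEnd ℂ) w := by
      rw [mul_comm, map_mul, mul_assoc, Complex.conj_mul', h.norm_deriv]; simp
    rw [h3, Complex.conj_re] at h1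
    linarith
  have hwI : w = w.im * Complex.I := by
    apply Complex.ext <;> simp [hre]
  have hzs : z = γ s + w.im * (Complex.I * deriv γ s) := by
    rw [← mul_assoc, ← hwI, ← hzw]; ring
  have ht : w.im ≠ 0 := fun h1 => hz ⟨s, by rw [hzs, h1]; simp⟩
  refine ⟨s, w.im, ht, hzs, ?_⟩
  rintro u hu ⟨s', hs'⟩
  -- A point of the curve on the open part of the segment would be strictly closer to z than the
  -- nearest point γ(s).
  have h1 : ‖γ s' - z‖ = (1 - u) * |w.im| := by
    have : γ s' - z = ((u - 1 : ℝ) : ℂ) * (w.im * (Complex.I * deriv γ s)) := by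
      rw [hs']; push_cast; linear_combination -hzs
    rw [this, norm_mul, norm_mul, norm_mul, h.norm_deriv, Complex.norm_I, Complex.norm_real,
      Complex.norm_real, Real.norm_eq_abs, Real.norm_eq_abs, abs_of_nonpos (by linarith [hu.2])]
    ring
  have h2 : ‖γ s - z‖ = |w.im| := by
    have : γ s - z = -(w.im * (Complex.I * deriv γ s)) := by
      linear_combination -hzs
    rw [this, norm_neg, norm_mul, norm_mul, h.norm_deriv, Complex.norm_I, Complex.norm_real,
      Real.norm_eq_abs]
    ring
  have h3 := hmin' s'
  rw [h1, h2] at h3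
  have h4 : 0 < |w.im| := abs_pos.mpr ht
  have h5 := pow_le_pow_left₀ (mul_nonneg (by linarith [hu.2]) h4.le)
    (show (1 - u) * |w.im| ≤ (1 - u) * |w.im| from le_rfl) 2
  have h6 : (1 - u) * |w.im| < |w.im| := by nlinarith [hu.1]
  have h7 : 0 ≤ (1 - u) * |w.im| := mul_nonneg (by linarith [hu.2]) h4.le
  nlinarith

/-- Jordan curve theorem for simple closed `C¹` curves in the unit disk, with the winding number of
the enclosed set. -/
theorem exists_wind_eq (h : IsArcCurve L γ) (hinj : InjOn γ (Ico 0 L)) (hb : ∀ s, ‖γ s‖ < 1) :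
    ∃ σ : ℂ, (σ = 1 ∨ σ = -1) ∧ ∀ z ∉ range γ,
      (wind L γ z = 0 ∨ wind L γ z = σ) ∧ (z ∈ enclosed L γ ↔ wind L γ z = σ) := by
  obtain ⟨ε, hε, hreach⟩ := h.exists_reach hinj
  set N : ℝ × ℝ → ℂ := fun p => γ p.1 + p.2 * (Complex.I * deriv γ p.1) with hN
  have hNc : Continuous N := by
    have h1 := h.continuous
    have h2 := h.continuous_deriv
    fun_prop
  -- P and Q are the left and right collars of the curve. Each is the image of a connected strip, so
  -- the winding number is constant on it.
  set P : Set ℂ := N '' (univ ×ˢ Ioo 0 ε) with hP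
  set Q : Set ℂ := N '' (univ ×ˢ Ioo (-ε) 0) with hQ
  have hPc : IsPreconnected P :=
    (isPreconnected_univ.prod isPreconnected_Ioo).image _ hNc.continuousOn
  have hQc : IsPreconnected Q :=
    (isPreconnected_univ.prod isPreconnected_Ioo).image _ hNc.continuousOn
  have hPd : P ⊆ (range γ)ᶜ := by
    rintro _ ⟨⟨s, t⟩, ⟨-, ht⟩, rfl⟩
    exact hreach s t ht.1.ne' (by rw [abs_of_pos ht.1]; exact ht.2)
  have hQd : Q ⊆ (range γ)ᶜ := by
    rintro _ ⟨⟨s, t⟩, ⟨-, ht⟩, rfl⟩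
    exact hreach s t ht.2.ne (by rw [abs_of_neg ht.2]; linarith [ht.1])
  set p : ℂ := N (0, ε / 2) with hp
  set q : ℂ := N (0, -(ε / 2)) with hq
  have hpP : p ∈ P := ⟨_, ⟨mem_univ _, by constructor <;> linarith⟩, rfl⟩
  have hqQ : q ∈ Q := ⟨_, ⟨mem_univ _, by constructor <;> simp <;> linarith⟩, rfl⟩
  -- Through γ(0) passes a single branch, so the jump formula gives exactly 1 from right to left.
  have hjump : wind L γ p - wind L γ q = 1 := by
    have hpre : preimages L γ (γ 0) = {0} := by
      ext s
      constructor
      · rintro ⟨h1, h2⟩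
        exact hinj h1 ⟨le_rfl, h.pos⟩ h2
      · rintro rfl
        exact ⟨⟨le_rfl, h.pos⟩, rfl⟩
    have h1 := (h.tendsto_wind_sub (x := γ 0) (h.norm_deriv 0) (by
      intro s hs; rw [hpre] at hs; rw [hs]; exact Or.inl rfl)).1
    have h0 : deriv γ 0 ≠ 0 := fun h0 => by
      have := h.norm_deriv 0
      rw [h0, norm_zero] at this
      exact zero_ne_one this
    rw [hpre, finsum_mem_singleton, div_self h0] at h1
    refine tendsto_nhds_unique (tendsto_const_nhds.congr' ?_) h1
    filter_upwards [self_mem_nhdsWithin, nhdsWithin_le_nhds (eventually_lt_nhds hε)] with r hr hrε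
    have hr : 0 < r := hr
    rw [h.wind_eq_of_isPreconnected hPc hPd hpP
        (show γ 0 + r * (Complex.I * deriv γ 0) ∈ P from ⟨(0, r), ⟨mem_univ _, hr, hrε⟩, rfl⟩),
      h.wind_eq_of_isPreconnected hQc hQd hqQ
        (show γ 0 - r * (Complex.I * deriv γ 0) ∈ Q from ⟨(0, -r), ⟨mem_univ _, by
          constructor <;> simp <;> linarith⟩, by simp [hN]; ring⟩)]
  -- The normal segment to a nearest point enters one of the collars. Hence every component of the
  -- complement contains P or Q, and there are at most two.
  have hside : ∀ z ∉ range γ, (P ⊆ connectedComponentIn (range γ)ᶜ z ∧ wind L γ z = wind L γ p) ∨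
      (Q ⊆ connectedComponentIn (range γ)ᶜ z ∧ wind L γ z = wind L γ q) := by
    intro z hz
    obtain ⟨s, t, ht, hzs, hseg⟩ := h.exists_normal_segment hz
    set A : Set ℂ := (fun u : ℝ => γ s + (u * t : ℝ) * (Complex.I * deriv γ s)) '' Ioc 0 1 with hA
    have hAc : IsPreconnected A := isPreconnected_Ioc.image _ (by fun_prop)
    have hAd : A ⊆ (range γ)ᶜ := by
      rintro _ ⟨u, hu, rfl⟩
      exact hseg u hu
    have hzA : z ∈ A := ⟨1, by simp, by simp [hzs]⟩
    obtain ⟨u, hu, hut⟩ : ∃ u ∈ Ioc (0 : ℝ) 1, u * |t| < ε := by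
      refine ⟨min 1 (ε / (2 * |t|)), ⟨lt_min one_pos (by positivity), min_le_left _ _⟩, ?_⟩
      have h1 : 0 < |t| := abs_pos.mpr ht
      calc _ ≤ ε / (2 * |t|) * |t| := by gcongr; exact min_le_right _ _
        _ = ε / 2 := by field_simp
        _ < ε := by linarith
    set y := γ s + (u * t : ℝ) * (Complex.I * deriv γ s) with hy
    have hyA : y ∈ A := ⟨u, hu, rfl⟩
    have hAz : A ⊆ connectedComponentIn (range γ)ᶜ z := hAc.subset_connectedComponentIn hzA hAd
    have hcomp := connectedComponentIn_eq (hAz hyA)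
    have hwy := h.wind_eq_of_isPreconnected hAc hAd hzA hyA
    rcases lt_or_gt_of_ne ht with hneg | hpos
    · right
      rw [abs_of_neg hneg] at hut
      have hyQ : y ∈ Q := ⟨(s, u * t), ⟨mem_univ _, by
        constructor
        · simp; linarith
        · simp; nlinarith [hu.1]⟩, rfl⟩
      rw [hcomp]
      exact ⟨hQc.subset_connectedComponentIn hyQ hQd,
        hwy.trans (h.wind_eq_of_isPreconnected hQc hQd hyQ hqQ)⟩
    · left
      rw [abs_of_pos hpos] at hut
      have hyP : y ∈ P := ⟨(s, u * t), ⟨mem_univ _, by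
        constructor
        · simp; nlinarith [hu.1]
        · simpa using hut⟩, rfl⟩
      rw [hcomp]
      exact ⟨hPc.subset_connectedComponentIn hyP hPd,
        hwy.trans (h.wind_eq_of_isPreconnected hPc hPd hyP hpP)⟩
  have hinf0 : wind L γ 1 = 0 := h.wind_eq_zero_of_one_le_norm hb (by simp)
  have hinf : (1 : ℂ) ∉ range γ := by
    rintro ⟨s, hs⟩
    have := hb s
    rw [hs, norm_one] at this
    exact lt_irrefl _ this
  have hunb : ¬ Bornology.IsBounded (connectedComponentIn (range γ)ᶜ 1) := by
    intro hbd
    obtain ⟨R, hR⟩ := hbd.subset_closedBall 0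
    have h1 := (isPreconnected_ray 1).subset_connectedComponentIn (x := (1 : ℂ))
      ⟨1, mem_Ici.mpr le_rfl, by simp⟩ (ray_subset hb (by simp))
    have h2 := hR (h1 ⟨max 1 (R + 1), mem_Ici.mpr (le_max_left _ _), rfl⟩)
    simp only [mem_closedBall_zero_iff, mul_one, Complex.norm_real] at h2
    linarith [le_max_right 1 (R + 1), Real.le_norm_self (max 1 (R + 1))]
  -- The winding numbers of P and Q differ, so winding number zero places z in the component of the
  -- exterior point 1, which is unbounded. A component with nonzero winding number stays in the unit
  -- disk.
  have hencl : ∀ z ∉ range γ, (z ∈ enclosed L γ ↔ wind L γ z ≠ 0) := by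
    intro z hz
    rw [enclosed, mem_ofPred_eq, h.image_Icc]
    constructor
    · rintro ⟨-, hbd⟩ h0
      have key : ∀ A : Set ℂ, A.Nonempty → A ⊆ connectedComponentIn (range γ)ᶜ z →
          A ⊆ connectedComponentIn (range γ)ᶜ 1 → False := by
        rintro A ⟨y, hy⟩ h1 h2
        rw [connectedComponentIn_eq (h1 hy), ← connectedComponentIn_eq (h2 hy)] at hbd
        exact hunb hbd
      rcases hside z hz with ⟨h1, h2⟩ | ⟨h1, h2⟩ <;>
      rcases hside 1 hinf with ⟨h3, h4⟩ | ⟨h3, h4⟩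
      · exact key P ⟨p, hpP⟩ h1 h3
      · rw [← h2, ← h4, h0, hinf0] at hjump; simp at hjump
      · rw [← h2, ← h4, h0, hinf0] at hjump; simp at hjump
      · exact key Q ⟨q, hqQ⟩ h1 h3
    · intro hne
      refine ⟨hz, ?_⟩
      refine Metric.isBounded_ball.subset (t := Metric.ball 0 1) fun y hy => ?_
      by_contra hy1
      rw [mem_ball_zero_iff, not_lt] at hy1
      have h1 := h.wind_eq_of_isPreconnected isPreconnected_connectedComponentIn
        (connectedComponentIn_subset (range γ)ᶜ z) (mem_connectedComponentIn hz) hy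
      exact hne (h1.trans (h.wind_eq_zero_of_one_le_norm hb hy1))
  -- The side on which the exterior lies decides the orientation: exterior on the left gives −1
  -- inside, exterior on the right gives 1.
  rcases hside 1 hinf with ⟨-, h1⟩ | ⟨-, h1⟩
  · rw [hinf0] at h1
    have hq1 : wind L γ q = -1 := by rw [← h1] at hjump; linear_combination -hjump
    refine ⟨-1, Or.inr rfl, fun z hz => ?_⟩
    have hv : wind L γ z = 0 ∨ wind L γ z = -1 := by
      rcases hside z hz with ⟨-, h2⟩ | ⟨-, h2⟩
      · left; rw [h2, ← h1]
      · right; rw [h2, hq1]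
    refine ⟨hv, (hencl z hz).trans ⟨fun hne => hv.resolve_left hne, fun h2 => ?_⟩⟩
    rw [h2]; norm_num
  · rw [hinf0] at h1
    have hp1 : wind L γ p = 1 := by rw [← h1] at hjump; linear_combination hjump
    refine ⟨1, Or.inl rfl, fun z hz => ?_⟩
    have hv : wind L γ z = 0 ∨ wind L γ z = 1 := by
      rcases hside z hz with ⟨-, h2⟩ | ⟨-, h2⟩
      · right; rw [h2, hp1]
      · left; rw [h2, ← h1]
    refine ⟨hv, (hencl z hz).trans ⟨fun hne => hv.resolve_left hne, fun h2 => ?_⟩⟩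
    rw [h2]; norm_num

end IsArcCurve

/-! ### Radial cut-off functions -/

theorem hasDerivAt_sq_max (t : ℝ) : HasDerivAt (fun t : ℝ => (max 0 t) ^ 2) (2 * max 0 t) t := by
  rcases lt_trichotomy t 0 with ht | rfl | ht
  · rw [max_eq_left ht.le, mul_zero]
    refine (hasDerivAt_const t (0 : ℝ)).congr_of_eventuallyEq ?_
    filter_upwards [eventually_lt_nhds ht] with u hu
    rw [max_eq_left hu.le]; norm_num
  · rw [max_self, mul_zero, hasDerivAt_iff_isLittleO_nhds_zero]
    simp only [zero_add, max_self, smul_zero, sub_zero, ne_eq, OfNat.ofNat_ne_zero,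
      not_false_eq_true, zero_pow]
    have h1 : (fun h : ℝ => (max 0 h) ^ 2) =O[𝓝 0] fun h : ℝ => h ^ 2 := by
      refine Asymptotics.IsBigO.of_bound 1 (Eventually.of_forall fun h => ?_)
      rw [one_mul, Real.norm_of_nonneg (sq_nonneg _), Real.norm_of_nonneg (sq_nonneg _)]
      rcases le_total h 0 with h2 | h2
      · rw [max_eq_left h2]; simpa using sq_nonneg h
      · rw [max_eq_right h2]
    exact h1.trans_isLittleO (by simpa using Asymptotics.isLittleO_pow_id (𝕜 := ℝ) one_lt_two)
  · rw [max_eq_right ht.le]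
    have h1 : HasDerivAt (fun t : ℝ => t ^ 2) (2 * t) t := by simpa using hasDerivAt_pow 2 t
    refine h1.congr_of_eventuallyEq ?_
    filter_upwards [eventually_gt_nhds ht] with u hu
    rw [max_eq_right hu.le]

theorem contDiff_sq_max : ContDiff ℝ 1 fun t : ℝ => (max 0 t) ^ 2 := by
  rw [contDiff_one_iff_deriv]
  refine ⟨fun t => (hasDerivAt_sq_max t).differentiableAt, ?_⟩
  rw [funext fun t => (hasDerivAt_sq_max t).deriv]
  fun_prop

/-- A `C¹` cut-off function supported in the disk of radius `r` around `x`. -/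
noncomputable def cutoff (x : ℂ) (r : ℝ) (z : ℂ) : ℝ := (max 0 (r ^ 2 - ‖z - x‖ ^ 2)) ^ 2

theorem contDiff_cutoff (x : ℂ) (r : ℝ) : ContDiff ℝ 1 (cutoff x r) :=
  contDiff_sq_max.comp (contDiff_const.sub ((contDiff_id.sub contDiff_const).norm_sq ℝ))

theorem cutoff_nonneg (x : ℂ) (r : ℝ) (z : ℂ) : 0 ≤ cutoff x r z := by
  unfold cutoff; positivity

theorem cutoff_eq_zero {x : ℂ} {r : ℝ} (hr : 0 < r) {z : ℂ} (hz : z ∉ Metric.ball x r) :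
    cutoff x r z = 0 := by
  rw [Metric.mem_ball, dist_eq_norm, not_lt] at hz
  rw [cutoff, max_eq_left (by nlinarith)]
  norm_num

theorem cutoff_eq {x : ℂ} {r : ℝ} {z : ℂ} (hz : z ∈ Metric.ball x r) :
    cutoff x r z = (r ^ 2 - ‖z - x‖ ^ 2) ^ 2 := by
  rw [Metric.mem_ball, dist_eq_norm] at hz
  rw [cutoff, max_eq_right (by nlinarith [norm_nonneg (z - x)])]

theorem cutoff_pos {x : ℂ} {r : ℝ} {z : ℂ} (hz : z ∈ Metric.ball x r) : 0 < cutoff x r z := by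
  rw [cutoff_eq hz]
  rw [Metric.mem_ball, dist_eq_norm] at hz
  have : 0 < r ^ 2 - ‖z - x‖ ^ 2 := by nlinarith [norm_nonneg (z - x)]
  positivity

theorem cutoff_le (x : ℂ) (r : ℝ) (z : ℂ) : cutoff x r z ≤ r ^ 4 := by
  rw [cutoff, show r ^ 4 = (r ^ 2) ^ 2 by ring]
  gcongr
  exact max_le (by positivity) (by linarith [sq_nonneg ‖z - x‖])

theorem hasCompactSupport_cutoff (x : ℂ) {r : ℝ} (hr : 0 < r) :
    HasCompactSupport (cutoff x r) :=
  HasCompactSupport.intro (isCompact_closedBall x r) fun _ hz =>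
    cutoff_eq_zero hr fun h => hz (Metric.ball_subset_closedBall h)

theorem fderiv_cutoff (x : ℂ) (r : ℝ) (z v : ℂ) : fderiv ℝ (cutoff x r) z v =
    -(4 * max 0 (r ^ 2 - ‖z - x‖ ^ 2) * inner ℝ (z - x) v) := by
  have h1 : HasFDerivAt (fun z : ℂ => r ^ 2 - ‖z - x‖ ^ 2) (-(2 • (innerSL ℝ (z - x)).comp
      (ContinuousLinearMap.id ℝ ℂ))) z :=
    (((hasFDerivAt_id z).sub_const x).norm_sq).const_sub _
  have h2 := (hasDerivAt_sq_max (r ^ 2 - ‖z - x‖ ^ 2)).comp_hasFDerivAt z h1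
  have h3 : HasFDerivAt (cutoff x r) _ z := h2
  rw [h3.fderiv]
  simp [innerSL_apply_apply]
  ring

theorem abs_fderiv_cutoff_le (x : ℂ) {r : ℝ} (hr : 0 < r) (z v : ℂ) :
    |fderiv ℝ (cutoff x r) z v| ≤ (Metric.ball x r).indicator (fun _ => 4 * r ^ 3) z * ‖v‖ := by
  rw [fderiv_cutoff]
  by_cases hz : z ∈ Metric.ball x r
  · rw [indicator_of_mem hz]
    rw [Metric.mem_ball, dist_eq_norm] at hz
    have h1 : max 0 (r ^ 2 - ‖z - x‖ ^ 2) ≤ r ^ 2 :=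
      max_le (by positivity) (by linarith [sq_nonneg ‖z - x‖])
    have h2 := abs_real_inner_le_norm (z - x) v
    rw [abs_neg, abs_mul, abs_of_nonneg (by positivity : 0 ≤ 4 * max 0 (r ^ 2 - ‖z - x‖ ^ 2))]
    calc _ ≤ 4 * r ^ 2 * (r * ‖v‖) := by gcongr; exact h2.trans (by gcongr)
      _ = _ := by ring
  · rw [indicator_of_notMem hz, zero_mul]
    rw [Metric.mem_ball, dist_eq_norm, not_lt] at hz
    rw [max_eq_left (by nlinarith)]
    simp

/-- Layer-cake formula: the weight on the disks is nonnegative for t ≤ r, so estimates for averages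
over concentric disks pass to the cut-off function. -/
theorem cutoff_eq_integral (x : ℂ) {r : ℝ} (hr : 0 < r) (z : ℂ) :
    cutoff x r z =
      ∫ t in Ioc 0 r, 4 * t * (r ^ 2 - t ^ 2) * (Metric.ball x t).indicator (fun _ => 1) z := by
  have hind : ∀ t : ℝ, (Metric.ball x t).indicator (fun _ => (1 : ℝ)) z =
      (Ioi ‖z - x‖).indicator (fun _ => 1) t := by
    intro t
    simp only [indicator, Metric.mem_ball, dist_eq_norm, mem_Ioi]
  simp_rw [hind]
  have hpt : ∀ t : ℝ, 4 * t * (r ^ 2 - t ^ 2) * (Ioi ‖z - x‖).indicator (fun _ => (1 : ℝ)) t =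
      (Ioi ‖z - x‖).indicator (fun t => 4 * t * (r ^ 2 - t ^ 2)) t := by
    intro t
    by_cases h : t ∈ Ioi ‖z - x‖
    · rw [indicator_of_mem h, indicator_of_mem h, mul_one]
    · rw [indicator_of_notMem h, indicator_of_notMem h, mul_zero]
  simp_rw [hpt]
  rw [setIntegral_indicator measurableSet_Ioi]
  have hset : Ioc 0 r ∩ Ioi ‖z - x‖ = Ioc ‖z - x‖ r := by
    ext t
    simp only [mem_inter_iff, mem_Ioc, mem_Ioi]
    constructor
    · rintro ⟨⟨_, h1⟩, h2⟩; exact ⟨h2, h1⟩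
    · rintro ⟨h1, h2⟩; exact ⟨⟨(norm_nonneg _).trans_lt h1, h2⟩, h1⟩
  rw [hset]
  by_cases hz : ‖z - x‖ < r
  · rw [← intervalIntegral.integral_of_le hz.le,
      intervalIntegral.integral_eq_sub_of_hasDerivAt (f := fun t => -(r ^ 2 - t ^ 2) ^ 2)]
    · rw [cutoff_eq (by rwa [Metric.mem_ball, dist_eq_norm])]
      ring
    · intro t _
      have h1 : HasDerivAt (fun t : ℝ => r ^ 2 - t ^ 2) (-(2 * t)) t := by
        simpa using (hasDerivAt_pow 2 t).const_sub (r ^ 2)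
      convert! (h1.pow 2).neg using 1
      ring
    · exact (by fun_prop : Continuous fun t : ℝ => 4 * t * (r ^ 2 - t ^ 2)).intervalIntegrable _ _
  · rw [Ioc_eq_empty (by exact hz), Measure.restrict_empty, integral_zero_measure,
      cutoff_eq_zero hr (by rwa [Metric.mem_ball, dist_eq_norm])]

/-! ### Density of a set of finite perimeter at points of its reduced boundary -/

namespace IsPolarGradient

variable {F : Set ℂ} {μ : Measure ℂ} {ν : ℂ → ℂ}

/-- Complex form of the defining identity: testing with the conjugate of φ gives the real part, and
replacing φ by −iφ gives the imaginary part. -/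
theorem integral_mul (h : IsPolarGradient F μ ν) {φ : ℂ → ℂ} (hφ : ContDiff ℝ 1 φ)
    (hc : HasCompactSupport φ) : ∫ z in F, 2 * dbar φ z = -∫ z, φ z * ν z ∂μ := by
  obtain ⟨hμ, hνm, hν1, hg⟩ := h
  have key : ∀ φ : ℂ → ℂ, ContDiff ℝ 1 φ → HasCompactSupport φ →
      (∫ z in F, 2 * dbar φ z).re = -(∫ z, φ z * ν z ∂μ).re := by
    intro φ hφ hc
    have hi1 : Integrable (fun z => 2 * dbar φ z) (volume.restrict F) :=
      (((continuous_dbar hφ).integrable_of_hasCompactSupport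
        (hasCompactSupport_dbar hc)).const_mul _).restrict
    obtain ⟨C, hC⟩ := hc.exists_bound_of_continuous hφ.continuous
    have hi2 : Integrable (fun z => φ z * ν z) μ := by
      refine Integrable.of_bound (hφ.continuous.measurable.mul hνm).aestronglyMeasurable C ?_
      filter_upwards [hν1] with z hz
      rw [norm_mul, hz, mul_one]
      exact hC z
    have h1 := hg _ (contDiff_conj_comp hφ) (hasCompactSupport_conj_comp hc)
    have h2 := integral_re hi1
    have h3 := integral_re hi2
    simp only [RCLike.re_eq_complex_re] at h2 h3
    have h4 : ∀ z, (2 * dbar φ z).re = divergence (fun z => (starRingEnd ℂ) (φ z)) z := by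
      intro z
      rw [← two_mul_dbar_conj_re ((contDiff_conj_comp hφ).differentiable (by norm_num) z)]
      simp
    have h5 : ∀ z, (φ z * ν z).re = inner ℝ ((starRingEnd ℂ) (φ z)) (ν z) := by
      intro z
      simp [Complex.inner, mul_comm]
    rw [← h2, ← h3]
    simp_rw [h4, h5]
    exact h1
  apply Complex.ext
  · rw [Complex.neg_re]; exact key φ hφ hc
  · have hd : ∀ z, dbar (fun z => -Complex.I * φ z) z = -Complex.I * dbar φ z := by
      intro z
      have : fderiv ℝ (fun z => -Complex.I * φ z) z = -Complex.I • fderiv ℝ φ z :=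
        fderiv_const_mul (hφ.differentiable (by norm_num) z) _
      rw [dbar, dbar, this]
      simp only [smul_apply, smul_eq_mul]
      ring
    have := key (fun z => -Complex.I * φ z) (contDiff_const.mul hφ) hc.mul_left
    simp_rw [hd] at this
    have e1 : ∫ z in F, 2 * (-Complex.I * dbar φ z) = -Complex.I * ∫ z in F, 2 * dbar φ z := by
      rw [← integral_const_mul]
      congr 1; ext z; ring
    have e2 : ∫ z, -Complex.I * φ z * ν z ∂μ = -Complex.I * ∫ z, φ z * ν z ∂μ := by
      rw [← integral_const_mul]
      congr 1; ext z; ring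
    rw [e1, e2] at this
    simpa using this

end IsPolarGradient

/-! ### Potential estimate and decay of the area -/

theorem integrable_div_sub {G : ℂ → ℂ} (hG : Continuous G) (hc : HasCompactSupport G) (ζ : ℂ) :
    Integrable fun z => G z / (ζ - z) := by
  refine ⟨(hG.measurable.div (measurable_const.sub measurable_id)).aestronglyMeasurable, ?_⟩
  rw [hasFiniteIntegral_iff_enorm]
  obtain ⟨B, hB, hGB⟩ := exists_lintegral_div_sub_le hG hc
  exact (hGB ζ).trans_lt hB

theorem hasFDerivAt_inv_sub {z y : ℂ} (h : z - y ≠ 0) :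
    HasFDerivAt (𝕜 := ℝ) (fun y => (z - y)⁻¹)
      (((z - y) ^ 2)⁻¹ • ContinuousLinearMap.id ℝ ℂ) y := by
  have h1 : HasDerivAt (fun y => (z - y)⁻¹) (((z - y) ^ 2)⁻¹) y := by
    have : HasDerivAt (fun y => (z - y)⁻¹) (-(-1) / (z - y) ^ 2) y :=
      ((hasDerivAt_id y).const_sub z).inv h
    rwa [neg_neg, one_div] at this
  have h2 := h1.hasFDerivAt.restrictScalars ℝ
  convert! h2 using 1
  ext
  simp [mul_comm]

/-- The Cauchy kernel is holomorphic away from its pole, so only G is differentiated. -/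
theorem dbar_div {G : ℂ → ℂ} {z y : ℂ} (hG : DifferentiableAt ℝ G y) (h : z - y ≠ 0) :
    dbar (fun y => G y / (z - y)) y = dbar G y / (z - y) := by
  have h1 := hG.hasFDerivAt.mul (hasFDerivAt_inv_sub h)
  have h2 : fderiv ℝ (fun y => G y / (z - y)) y = _ := HasFDerivAt.fderiv h1
  rw [dbar, dbar, h2]
  simp only [add_apply, smul_apply, smul_eq_mul, ContinuousLinearMap.id_apply]
  field_simp
  linear_combination G y * Complex.I_sq

namespace IsPolarGradient

variable {F : Set ℂ} {μ : Measure ℂ} {ν : ℂ → ℂ}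

theorem integrable_inner (h : IsPolarGradient F μ ν) {g : ℂ → ℝ} (hg : Measurable g) {C : ℝ}
    (hC : ∀ z, |g z| ≤ C) (n : ℂ) : Integrable (fun z => g z * inner ℝ n (ν z)) μ := by
  have := h.1
  refine Integrable.of_bound
    (hg.mul (measurable_const.inner h.2.1)).aestronglyMeasurable (C * ‖n‖) ?_
  filter_upwards [h.2.2.1] with z hz
  rw [norm_mul, Real.norm_eq_abs]
  refine mul_le_mul (hC z) ?_ (norm_nonneg _) ((abs_nonneg _).trans (hC z))
  exact (norm_inner_le_norm _ _).trans (by rw [hz, mul_one])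

/-- If the normal is close to `n` on average on all small disks around `x`, then the weighted
perimeter is controlled by the area. -/
theorem integral_cutoff_le (h : IsPolarGradient F μ ν) {x n : ℂ} (hn : ‖n‖ = 1)
    {r : ℝ} (hr : 0 < r)
    (hav : ∀ t, 0 < t → t ≤ r → μ.real (Metric.ball x t) / 2 ≤ ∫ z in Metric.ball x t, inner ℝ n (ν z) ∂μ) :
    ∫ z, cutoff x r z ∂μ ≤ 8 * r ^ 3 * volume.real (F ∩ Metric.ball x r) := by
  have hμ := h.1
  have hbd : ∀ z, |cutoff x r z| ≤ r ^ 4 := fun z => by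
    rw [abs_of_nonneg (cutoff_nonneg _ _ _)]; exact cutoff_le _ _ _
  have hcm : Measurable (cutoff x r) := (contDiff_cutoff x r).continuous.measurable
  have hci : Integrable (cutoff x r) μ :=
    Integrable.of_bound hcm.aestronglyMeasurable (r ^ 4) (Eventually.of_forall hbd)
  -- By the layer-cake formula and Fubini this is a superposition with nonnegative weights of the
  -- hypothesis on the disks. Hence the weighted perimeter is at most twice the weighted integral of
  -- ⟨n, ν⟩.
  have h1 : 0 ≤ ∫ z, cutoff x r z * (inner ℝ n (ν z) - 1 / 2) ∂μ := by
    set k : ℝ → ℝ := fun t => 4 * t * (r ^ 2 - t ^ 2) with hk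
    set G : ℂ → ℝ → ℝ := fun z t =>
      k t * (Metric.ball x t).indicator (fun _ => 1) z * (inner ℝ n (ν z) - 1 / 2) with hG
    have hGm : Measurable (Function.uncurry G) := by
      have hs : MeasurableSet {p : ℂ × ℝ | ‖p.1 - x‖ < p.2} :=
        measurableSet_lt (by fun_prop) (by fun_prop)
      have hm1 : Measurable fun p : ℂ × ℝ => (Metric.ball x p.2).indicator (fun _ => (1 : ℝ)) p.1 := by
        have : (fun p : ℂ × ℝ => (Metric.ball x p.2).indicator (fun _ => (1 : ℝ)) p.1) =
            {p : ℂ × ℝ | ‖p.1 - x‖ < p.2}.indicator fun _ => 1 := by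
          ext p; simp [indicator, Metric.mem_ball, dist_eq_norm]
        rw [this]
        exact measurable_const.indicator hs
      have hm2 : Measurable fun p : ℂ × ℝ => k p.2 := by simp only [hk]; fun_prop
      have hm3 : Measurable fun p : ℂ × ℝ => (inner ℝ n (ν p.1) : ℝ) :=
        measurable_const.inner (h.2.1.comp measurable_fst)
      exact (hm2.mul hm1).mul (hm3.sub_const _)
    have hkb : ∀ t ∈ Ioc 0 r, 0 ≤ k t ∧ k t ≤ 4 * r ^ 3 := by
      intro t ht
      have h1 : t ^ 2 ≤ r ^ 2 := pow_le_pow_left₀ ht.1.le ht.2 2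
      refine ⟨mul_nonneg (by linarith [ht.1]) (by linarith), ?_⟩
      have : k t ≤ 4 * r * r ^ 2 := by
        simp only [hk]
        have := ht.1
        exact mul_le_mul (by linarith [ht.2]) (by nlinarith) (by linarith) (by linarith)
      linarith [this, show 4 * r * r ^ 2 = 4 * r ^ 3 by ring]
    have hGi : Integrable (Function.uncurry G) (μ.prod (volume.restrict (Ioc 0 r))) := by
      refine Integrable.of_bound hGm.aestronglyMeasurable (4 * r ^ 3 * (3 / 2)) ?_
      have hae : ∀ᵐ p ∂(μ.prod (volume.restrict (Ioc 0 r))), ‖ν p.1‖ = 1 ∧ p.2 ∈ Ioc 0 r :=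
        ((Measure.quasiMeasurePreserving_fst).ae h.2.2.1).and
          ((Measure.quasiMeasurePreserving_snd).ae (ae_restrict_mem measurableSet_Ioc))
      filter_upwards [hae] with p hp
      have h2 : |(inner ℝ n (ν p.1) : ℝ)| ≤ 1 := by
        refine (abs_real_inner_le_norm _ _).trans ?_
        rw [hn, hp.1, one_mul]
      have h3 : |(Metric.ball x p.2).indicator (fun _ => (1 : ℝ)) p.1| ≤ 1 := by
        unfold indicator; split_ifs <;> simp
      simp only [Function.uncurry, hG]
      rw [norm_mul, norm_mul, Real.norm_eq_abs, Real.norm_eq_abs, Real.norm_eq_abs,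
        abs_of_nonneg (hkb p.2 hp.2).1]
      have h4 : |(inner ℝ n (ν p.1) : ℝ) - 1 / 2| ≤ 3 / 2 := by
        rw [abs_le] at h2 ⊢
        constructor <;> linarith [h2.1, h2.2]
      calc _ ≤ 4 * r ^ 3 * 1 * (3 / 2) := by
            gcongr
            exact (hkb p.2 hp.2).2
        _ = _ := by ring
    have hsw := integral_integral_swap hGi
    have h5 : ∀ z, ∫ t in Ioc 0 r, G z t = cutoff x r z * (inner ℝ n (ν z) - 1 / 2) := by
      intro z
      simp only [hG]
      rw [integral_mul_const, ← cutoff_eq_integral x hr z]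
    simp_rw [h5] at hsw
    rw [hsw]
    refine setIntegral_nonneg measurableSet_Ioc fun t ht => ?_
    have h6 : ∀ z, G z t = k t *
        (Metric.ball x t).indicator (fun z => inner ℝ n (ν z) - 1 / 2) z := by
      intro z
      simp only [hG]
      by_cases hz : z ∈ Metric.ball x t
      · rw [indicator_of_mem hz, indicator_of_mem hz]; ring
      · rw [indicator_of_notMem hz, indicator_of_notMem hz]; ring
    simp_rw [h6]
    rw [integral_const_mul, integral_indicator measurableSet_ball]
    refine mul_nonneg (hkb t ht).1 ?_
    have hi : Integrable (fun z => (inner ℝ n (ν z) : ℝ)) μ := by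
      simpa using h.integrable_inner (g := fun _ => 1) measurable_const (C := 1) (by simp) n
    rw [integral_sub hi.restrict (integrable_const _), setIntegral_const, smul_eq_mul]
    have := hav t ht.1 ht.2
    linarith
  have hqi := h.integrable_inner hcm hbd n
  have h2 : ∫ z, cutoff x r z * (inner ℝ n (ν z) - 1 / 2) ∂μ =
      (∫ z, cutoff x r z * inner ℝ n (ν z) ∂μ) - (∫ z, cutoff x r z ∂μ) * (1 / 2) := by
    simp_rw [mul_sub]
    rw [integral_sub hqi (hci.mul_const _), integral_mul_const]
  -- Testing with this field turns the integral of ⟨n, ν⟩ into an area integral of a directional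
  -- derivative, which is at most 4r³ on the disk; the factor two above makes it 8r³.
  have hη : ContDiff ℝ 1 fun z => cutoff x r z • n := (contDiff_cutoff x r).smul contDiff_const
  have h3 := h.2.2.2 (fun z => cutoff x r z • n) hη (hasCompactSupport_cutoff x hr).smul_right
  simp_rw [real_inner_smul_left] at h3
  have hdiv : ∀ z, divergence (fun z => cutoff x r z • n) z = fderiv ℝ (cutoff x r) z n := by
    intro z
    have hd := (contDiff_cutoff x r).differentiable (by norm_num) z
    have e : fderiv ℝ (fun z => cutoff x r z • n) z = (fderiv ℝ (cutoff x r) z).smulRight n :=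
      (hd.hasFDerivAt.smul_const n).fderiv
    have hnn : n = n.re • (1 : ℂ) + n.im • Complex.I := by simp
    rw [divergence, e]
    conv_rhs => rw [hnn, map_add, map_smul, map_smul]
    simp [mul_comm]
  have h4 : |∫ z in F, divergence (fun z => cutoff x r z • n) z| ≤
      4 * r ^ 3 * volume.real (F ∩ Metric.ball x r) := by
    simp_rw [hdiv]
    calc |∫ z in F, fderiv ℝ (cutoff x r) z n| ≤
        ∫ z in F, (Metric.ball x r).indicator (fun _ => 4 * r ^ 3) z := by
          rw [← Real.norm_eq_abs]
          refine norm_integral_le_of_norm_le ?_ (Eventually.of_forall fun z => ?_)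
          · exact ((integrable_indicator_iff measurableSet_ball).mpr
              (integrableOn_const measure_ball_lt_top.ne)).restrict
          · have := abs_fderiv_cutoff_le x hr z n
            rwa [hn, mul_one] at this
      _ = 4 * r ^ 3 * volume.real (F ∩ Metric.ball x r) := by
          rw [setIntegral_indicator measurableSet_ball, setIntegral_const, smul_eq_mul, mul_comm]
  rw [h2] at h1
  rw [h3] at h4
  have h5 := (abs_le.mp h4).1
  rw [abs_neg] at h4
  have h6 := (abs_le.mp h4).2
  linarith

/-- Potential estimate for the characteristic function of an open set of finite perimeter. -/
theorem cutoff_le_lintegral (h : IsPolarGradient F μ ν) (hF : IsOpen F) {x : ℂ} {r : ℝ}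
    (hr : 0 < r) {z : ℂ} (hz : z ∈ F) :
    ENNReal.ofReal (Real.pi * cutoff x r z) ≤
      ENNReal.ofReal (4 * r ^ 3) * (∫⁻ y in F ∩ Metric.ball x r, ENNReal.ofReal ‖z - y‖⁻¹) +
      ∫⁻ y, ENNReal.ofReal (cutoff x r y) * ENNReal.ofReal ‖z - y‖⁻¹ ∂μ := by
  have hμ := h.1
  obtain ⟨ρ, hρ, hρF⟩ := Metric.isOpen_iff.mp hF z hz
  -- The bump, equal to 1 near the pole z and supported inside F, splits the cut-off function into a
  -- singular part, to which Cauchy–Pompeiu applies on the whole plane, and a part that vanishes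
  -- near z and so is a legitimate test function after division by z − y.
  set χ : ContDiffBump z := ⟨ρ / 4, ρ / 2, by positivity, by linarith⟩ with hχ
  set B : ℂ → ℂ := fun y => (cutoff x r y : ℂ) with hB
  set X : ℂ → ℂ := fun y => (χ y : ℂ) with hX
  have hBs : ContDiff ℝ 1 B := Complex.ofRealCLM.contDiff.comp (contDiff_cutoff x r)
  have hXs : ContDiff ℝ 1 X := Complex.ofRealCLM.contDiff.comp χ.contDiff
  have hBc : HasCompactSupport B := (hasCompactSupport_cutoff x hr).comp_left Complex.ofReal_zero
  have hBXs : ContDiff ℝ 1 fun y => B y * X y := hBs.mul hXs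
  have hBXc : HasCompactSupport fun y => B y * X y := hBc.mul_right
  set G : ℂ → ℂ := fun y => B y - B y * X y with hG
  have hGs : ContDiff ℝ 1 G := hBs.sub hBXs
  set φ : ℂ → ℂ := fun y => G y / (z - y) with hφ
  have hnear : ∀ y ∈ Metric.ball z (ρ / 4), G y = 0 := by
    intro y hy
    have : χ y = 1 := χ.one_of_mem_closedBall (Metric.ball_subset_closedBall hy)
    simp [hG, hX, this]
  have hφz : φ =ᶠ[𝓝 z] fun _ => 0 := by
    filter_upwards [Metric.ball_mem_nhds z (by positivity : 0 < ρ / 4)] with y hy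
    simp [hφ, hnear y hy]
  have hφs : ContDiff ℝ 1 φ := by
    rw [contDiff_iff_contDiffAt]
    intro y
    by_cases hy : y = z
    · rw [hy]
      exact contDiffAt_const.congr_of_eventuallyEq hφz
    · simp only [hφ, div_eq_mul_inv]
      exact hGs.contDiffAt.mul
        ((contDiffAt_const.sub contDiffAt_id).inv (sub_ne_zero.mpr (Ne.symm hy)))
  have hφc : HasCompactSupport φ := by
    refine hBc.mono fun y hy hy0 => hy ?_
    have : B y = 0 := hy0
    simp [hφ, hG, this]
  have hdφ : ∀ y, 2 * dbar φ y =
      2 * (dbar B y / (z - y)) - 2 * (dbar (fun y => B y * X y) y / (z - y)) := by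
    intro y
    have hsub : dbar G y = dbar B y - dbar (fun y => B y * X y) y := by
      have : fderiv ℝ G y = fderiv ℝ B y - fderiv ℝ (fun y => B y * X y) y :=
        fderiv_fun_sub (hBs.differentiable (by norm_num) y) (hBXs.differentiable (by norm_num) y)
      rw [dbar, dbar, dbar, this]
      simp only [sub_apply]
      ring
    -- At the pole both sides are zero: φ vanishes nearby, and division by zero has the value zero.
    by_cases hy : y = z
    · have h0 : fderiv ℝ φ y = 0 := by
        rw [hy, hφz.fderiv_eq]; simp
      rw [dbar, h0, hy]
      simp
    · rw [hφ, dbar_div (hGs.differentiable (by norm_num) y) (sub_ne_zero.mpr (Ne.symm hy)), hsub]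
      ring
  have hi1 := integrable_div_sub (continuous_dbar hBs) (hasCompactSupport_dbar hBc) z
  have hi2 := integrable_div_sub (continuous_dbar hBXs) (hasCompactSupport_dbar hBXc) z
  have hmain := h.integral_mul hφs hφc
  simp_rw [hdφ] at hmain
  rw [integral_sub (hi1.const_mul _).restrict (hi2.const_mul _).restrict, integral_const_mul,
    integral_const_mul] at hmain
  -- The support of the bump lies in F, so the integral over F is the integral over the plane.
  have hloc : ∫ y in F, dbar (fun y => B y * X y) y / (z - y) = Real.pi * cutoff x r z := by
    rw [setIntegral_eq_integral_of_forall_compl_eq_zero, integral_dbar_div hBXs hBXc]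
    · have : χ z = 1 := χ.one_of_mem_closedBall (Metric.mem_closedBall_self χ.rIn_pos.le)
      simp [hB, hX, this]
    · intro y hy
      have : (fun y => B y * X y) =ᶠ[𝓝 y] fun _ => 0 := by
        have hopen : IsOpen (Metric.closedBall z (ρ / 2))ᶜ := Metric.isClosed_closedBall.isOpen_compl
        have hy' : y ∈ (Metric.closedBall z (ρ / 2))ᶜ := fun h1 =>
          hy (hρF (Metric.closedBall_subset_ball (by linarith) h1))
        filter_upwards [hopen.mem_nhds hy'] with w hw
        have : χ w = 0 := χ.zero_of_le_dist (by
          rw [mem_compl_iff, Metric.mem_closedBall, not_le] at hw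
          exact hw.le)
        simp [hX, this]
      rw [dbar, this.fderiv_eq]
      simp
  rw [hloc] at hmain
  have hrep : ((Real.pi * cutoff x r z : ℝ) : ℂ) =
      (∫ y in F, dbar B y / (z - y)) + (1 / 2) * ∫ y, φ y * ν y ∂μ := by
    push_cast
    linear_combination (-1 / 2 : ℂ) * hmain
  have hpos : 0 ≤ Real.pi * cutoff x r z := mul_nonneg Real.pi_pos.le (cutoff_nonneg _ _ _)
  have hnormeq : ENNReal.ofReal (Real.pi * cutoff x r z) =
      ‖(∫ y in F, dbar B y / (z - y)) + (1 / 2) * ∫ y, φ y * ν y ∂μ‖ₑ := by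
    rw [← hrep, ← ofReal_norm, Complex.norm_real, Real.norm_of_nonneg hpos]
  rw [hnormeq]
  refine (enorm_add_le _ _).trans (add_le_add ?_ ?_)
  · calc ‖∫ y in F, dbar B y / (z - y)‖ₑ ≤ ∫⁻ y in F, ‖dbar B y / (z - y)‖ₑ :=
          enorm_integral_le_lintegral_enorm _
      _ ≤ ∫⁻ y in F, (Metric.ball x r).indicator
            (fun y => ENNReal.ofReal (4 * r ^ 3) * ENNReal.ofReal ‖z - y‖⁻¹) y := by
          refine lintegral_mono fun y => ?_
          have hfB : ∀ v, fderiv ℝ B y v = (fderiv ℝ (cutoff x r) y v : ℂ) := by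
            intro v
            have : fderiv ℝ B y = Complex.ofRealCLM.comp (fderiv ℝ (cutoff x r) y) :=
              (Complex.ofRealCLM.hasFDerivAt.comp y
                ((contDiff_cutoff x r).differentiable (by norm_num) y).hasFDerivAt).fderiv
            rw [this]; rfl
          have hd : ‖dbar B y‖ ≤ (Metric.ball x r).indicator (fun _ => 4 * r ^ 3) y := by
            have e1 := abs_fderiv_cutoff_le x hr y 1
            have e2 := abs_fderiv_cutoff_le x hr y Complex.I
            rw [norm_one, mul_one] at e1
            rw [Complex.norm_I, mul_one] at e2
            rw [dbar, hfB, hfB, norm_mul]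
            have e3 := norm_add_le (fderiv ℝ (cutoff x r) y 1 : ℂ)
              (Complex.I * (fderiv ℝ (cutoff x r) y Complex.I : ℂ))
            rw [norm_mul, Complex.norm_I, one_mul, Complex.norm_real, Complex.norm_real,
              Real.norm_eq_abs, Real.norm_eq_abs] at e3
            have e4 : ‖(1 / 2 : ℂ)‖ = 1 / 2 := by simp
            rw [e4]
            linarith
          by_cases hy : y ∈ Metric.ball x r
          · rw [indicator_of_mem hy] at hd ⊢
            rw [← ENNReal.ofReal_mul (by positivity), ← ofReal_norm, norm_div, div_eq_mul_inv]
            gcongr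
          · rw [indicator_of_notMem hy] at hd ⊢
            rw [norm_le_zero_iff.mp hd]; simp
      _ = _ := by
          rw [setLIntegral_indicator measurableSet_ball, inter_comm,
            lintegral_const_mul _ (measurable_inv_norm_sub _)]
  · calc ‖(1 / 2 : ℂ) * ∫ y, φ y * ν y ∂μ‖ₑ ≤ 1 * ∫⁻ y, ‖φ y * ν y‖ₑ ∂μ := by
          rw [enorm_mul]
          gcongr
          · rw [← ofReal_norm]
            simp
          · exact enorm_integral_le_lintegral_enorm _
      _ ≤ _ := by
          rw [one_mul]
          refine lintegral_mono_ae ?_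
          filter_upwards [h.2.2.1] with y hy
          rw [← ENNReal.ofReal_mul (cutoff_nonneg _ _ _), ← ofReal_norm]
          refine ENNReal.ofReal_le_ofReal ?_
          rw [norm_mul, hy, mul_one, hφ, norm_div, div_eq_mul_inv]
          gcongr
          have : G y = ((cutoff x r y * (1 - χ y) : ℝ) : ℂ) := by
            simp [hG, hB, hX]; ring
          rw [this, Complex.norm_real, Real.norm_of_nonneg (mul_nonneg (cutoff_nonneg _ _ _)
            (sub_nonneg.mpr χ.le_one))]
          exact mul_le_of_le_one_right (cutoff_nonneg _ _ _) (by linarith [χ.nonneg' y])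

end IsPolarGradient

/-- The square contributes the factor 16^(−2k), which absorbs the growth 16^k with one more power to
spare. -/
theorem le_of_sq_recursion {A a₀ : ℝ} (hA : 0 ≤ A) (h0 : 0 ≤ a₀) (hsmall : 16 * A * a₀ ≤ 1)
    {a : ℕ → ℝ} (ha : ∀ k, 0 ≤ a k) (ha0 : a 0 ≤ a₀)
    (hrec : ∀ k, a (k + 1) ≤ A * 16 ^ k * a k ^ 2) (k : ℕ) : a k ≤ a₀ * (1 / 16) ^ k := by
  induction k with
  | zero => simpa using ha0
  | succ k ih =>
    have h1 : a k ^ 2 ≤ (a₀ * (1 / 16) ^ k) ^ 2 := pow_le_pow_left₀ (ha k) ih 2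
    have h2 : (16 : ℝ) ^ k * (1 / 16) ^ k = 1 := by rw [← mul_pow]; norm_num
    calc a (k + 1) ≤ A * 16 ^ k * a k ^ 2 := hrec k
      _ ≤ A * 16 ^ k * (a₀ * (1 / 16) ^ k) ^ 2 := by gcongr
      _ = (A * a₀) * (16 ^ k * (1 / 16) ^ k) * (a₀ * (1 / 16) ^ k) := by ring
      _ = (16 * A * a₀) * (a₀ * (1 / 16) ^ (k + 1)) := by rw [h2]; ring
      _ ≤ 1 * (a₀ * (1 / 16) ^ (k + 1)) := by gcongr
      _ = _ := one_mul _

namespace IsPolarGradient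

variable {F : Set ℂ} {μ : Measure ℂ} {ν : ℂ → ℂ}

/-- Integrate the potential estimate over z in F ∩ B_s and exchange the integrals. The potential of
F ∩ B_s is bounded by a multiple of the square root of its area, and one such root cancels; the
perimeter term is bounded by the area in B_r through `integral_cutoff_le`. -/
theorem area_decay (h : IsPolarGradient F μ ν) (hF : IsOpen F) {x n : ℂ} (hn : ‖n‖ = 1)
    {r s : ℝ} (hs : 0 < s) (hsr : s < r)
    (hav : ∀ t, 0 < t → t ≤ r →
      μ.real (Metric.ball x t) / 2 ≤ ∫ z in Metric.ball x t, inner ℝ n (ν z) ∂μ) :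
    (r ^ 2 - s ^ 2) ^ 2 * √(volume.real (F ∩ Metric.ball x s)) ≤
      28 * r ^ 3 * volume.real (F ∩ Metric.ball x r) := by
  have hμ := h.1
  have hr : 0 < r := hs.trans hsr
  have hcut := h.integral_cutoff_le hn hr hav
  set Vr := volume.real (F ∩ Metric.ball x r) with hVr
  set G := F ∩ Metric.ball x s with hG
  have hGm : MeasurableSet G := hF.measurableSet.inter measurableSet_ball
  have hfinG : volume G ≠ ⊤ := ((measure_mono inter_subset_right).trans_lt measure_ball_lt_top).ne
  have hfinr : volume (F ∩ Metric.ball x r) ≠ ⊤ :=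
    ((measure_mono inter_subset_right).trans_lt measure_ball_lt_top).ne
  set v := √(volume.real G) with hv
  have hv0 : 0 ≤ v := Real.sqrt_nonneg _
  rcases hv0.eq_or_lt with hv0 | hv0
  · rw [← hv0, mul_zero]
    positivity
  have hvol : volume G = ENNReal.ofReal (v ^ 2) := by
    rw [hv, Real.sq_sqrt measureReal_nonneg, measureReal_def, ENNReal.ofReal_toReal hfinG]
  set K : ℝ := 2 * Real.pi + 1 with hK
  have hKpos : 0 < K := by positivity
  have hpot : ∀ y, ∫⁻ z in G, ENNReal.ofReal ‖z - y‖⁻¹ ≤ ENNReal.ofReal (K * v) := by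
    intro y
    simp_rw [norm_sub_rev _ y]
    exact lintegral_inv_norm_le hv0 hvol.le y
  have hkm : Measurable (Function.uncurry fun z y : ℂ => ENNReal.ofReal ‖z - y‖⁻¹) := by
    unfold Function.uncurry; fun_prop
  have hcm : Measurable (cutoff x r) := (contDiff_cutoff x r).continuous.measurable
  have hkm2 : Measurable (Function.uncurry fun z y : ℂ =>
      ENNReal.ofReal (cutoff x r y) * ENNReal.ofReal ‖z - y‖⁻¹) :=
    ((hcm.comp measurable_snd).ennreal_ofReal).mul hkm
  have hci : Integrable (cutoff x r) μ :=
    Integrable.of_bound hcm.aestronglyMeasurable (r ^ 4) (Eventually.of_forall fun z => by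
      rw [Real.norm_of_nonneg (cutoff_nonneg _ _ _)]; exact cutoff_le _ _ _)
  have h1 : ENNReal.ofReal (Real.pi * (r ^ 2 - s ^ 2) ^ 2) * ENNReal.ofReal (v ^ 2) ≤
      ENNReal.ofReal (4 * r ^ 3) * (ENNReal.ofReal (K * v) * ENNReal.ofReal Vr) +
        ENNReal.ofReal (K * v) * ENNReal.ofReal (8 * r ^ 3 * Vr) := by
    calc _ = ∫⁻ z in G, ENNReal.ofReal (Real.pi * (r ^ 2 - s ^ 2) ^ 2) := by
          rw [setLIntegral_const, hvol]
      _ ≤ ∫⁻ z in G, (ENNReal.ofReal (4 * r ^ 3) *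
            (∫⁻ y in F ∩ Metric.ball x r, ENNReal.ofReal ‖z - y‖⁻¹) +
            ∫⁻ y, ENNReal.ofReal (cutoff x r y) * ENNReal.ofReal ‖z - y‖⁻¹ ∂μ) := by
          refine setLIntegral_mono' hGm fun z hz => ?_
          refine le_trans (ENNReal.ofReal_le_ofReal ?_) (h.cutoff_le_lintegral hF hr hz.1)
          rw [cutoff_eq (Metric.ball_subset_ball hsr.le hz.2)]
          have h2 := hz.2
          rw [Metric.mem_ball, dist_eq_norm] at h2
          have h3 : ‖z - x‖ ^ 2 ≤ s ^ 2 := pow_le_pow_left₀ (norm_nonneg _) h2.le 2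
          have h4 : 0 ≤ r ^ 2 - s ^ 2 := by nlinarith
          gcongr
      _ = ENNReal.ofReal (4 * r ^ 3) *
            (∫⁻ z in G, ∫⁻ y in F ∩ Metric.ball x r, ENNReal.ofReal ‖z - y‖⁻¹) +
            ∫⁻ z in G, ∫⁻ y, ENNReal.ofReal (cutoff x r y) * ENNReal.ofReal ‖z - y‖⁻¹ ∂μ := by
          have hm : Measurable fun z => ∫⁻ y in F ∩ Metric.ball x r, ENNReal.ofReal ‖z - y‖⁻¹ :=
            hkm.lintegral_prod_right'
          rw [lintegral_add_left (hm.const_mul _), lintegral_const_mul _ hm]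
      _ = ENNReal.ofReal (4 * r ^ 3) *
            (∫⁻ y in F ∩ Metric.ball x r, ∫⁻ z in G, ENNReal.ofReal ‖z - y‖⁻¹) +
            ∫⁻ y, (∫⁻ z in G, ENNReal.ofReal (cutoff x r y) * ENNReal.ofReal ‖z - y‖⁻¹) ∂μ := by
          rw [lintegral_lintegral_swap hkm.aemeasurable, lintegral_lintegral_swap hkm2.aemeasurable]
      _ ≤ ENNReal.ofReal (4 * r ^ 3) *
            (∫⁻ y in F ∩ Metric.ball x r, ENNReal.ofReal (K * v)) +
            ∫⁻ y, ENNReal.ofReal (K * v) * ENNReal.ofReal (cutoff x r y) ∂μ := by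
          refine add_le_add (mul_le_mul_right (lintegral_mono fun y => hpot y) _)
            (lintegral_mono fun y => ?_)
          rw [lintegral_const_mul _ (by fun_prop), mul_comm]
          exact mul_le_mul_left (hpot y) _
      _ ≤ _ := by
          rw [setLIntegral_const, lintegral_const_mul _ hcm.ennreal_ofReal,
            ← ofReal_integral_eq_lintegral_ofReal hci (Eventually.of_forall (cutoff_nonneg x r)),
            hVr, ofReal_measureReal hfinr]
          gcongr
  rw [← ENNReal.ofReal_mul (by positivity), ← ENNReal.ofReal_mul (by positivity),
    ← ENNReal.ofReal_mul (by positivity), ← ENNReal.ofReal_mul (by positivity),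
    ← ENNReal.ofReal_add (by positivity) (by positivity),
    ENNReal.ofReal_le_ofReal_iff (by positivity)] at h1
  have h2 : Real.pi * ((r ^ 2 - s ^ 2) ^ 2 * v) ≤ 12 * K * r ^ 3 * Vr := by
    refine le_of_mul_le_mul_right ?_ hv0
    linarith
  have hpi3 := Real.pi_gt_three
  have hVr0 : 0 ≤ r ^ 3 * Vr := by positivity
  -- Here 12(2π + 1) ≤ 28π because π > 3.
  have h3 : 12 * K * r ^ 3 * Vr ≤ Real.pi * (28 * r ^ 3 * Vr) := by
    rw [hK]; nlinarith
  exact le_of_mul_le_mul_left (h2.trans h3) Real.pi_pos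

/-- An open set of finite perimeter does not have density zero at a point of its reduced
boundary. -/
theorem not_tendsto_density_zero (h : IsPolarGradient F μ ν) (hF : IsOpen F) {x n : ℂ}
    (hn : ‖n‖ = 1) (hpos : ∀ r : ℝ, 0 < r → 0 < μ (Metric.ball x r))
    (hlim : Tendsto (fun r : ℝ => ⨍ z in Metric.ball x r, ν z ∂μ) (𝓝[>] 0) (𝓝 n)) :
    ¬ Tendsto (fun r : ℝ => volume.real (F ∩ Metric.ball x r) / r ^ 2) (𝓝[>] 0) (𝓝 0) := by
  intro hV
  have hμ := h.1
  have hνi : Integrable ν μ := Integrable.of_bound h.2.1.aestronglyMeasurable 1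
    (h.2.2.1.mono fun z hz => hz.le)
  have hposr : ∀ r : ℝ, 0 < r → 0 < μ.real (Metric.ball x r) := fun r hr =>
    ENNReal.toReal_pos (hpos r hr).ne' (measure_ne_top _ _)
  -- The averages of ⟨n, ν⟩ tend to |n|² = 1, so they eventually exceed 1/2.
  have hav0 : ∀ᶠ r : ℝ in 𝓝[>] 0,
      μ.real (Metric.ball x r) / 2 ≤ ∫ z in Metric.ball x r, inner ℝ n (ν z) ∂μ := by
    have h1 : Tendsto (fun r : ℝ => (inner ℝ n (⨍ z in Metric.ball x r, ν z ∂μ) : ℝ)) (𝓝[>] 0)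
        (𝓝 (inner ℝ n n)) := tendsto_const_nhds.inner hlim
    rw [real_inner_self_eq_norm_sq, hn, one_pow] at h1
    filter_upwards [h1.eventually_const_lt (show (1 / 2 : ℝ) < 1 by norm_num),
      self_mem_nhdsWithin] with r hr hr0
    rw [setAverage_eq, real_inner_smul_right, ← integral_inner hνi.restrict] at hr
    have h2 := hposr r hr0
    rw [inv_mul_eq_div, lt_div_iff₀ h2] at hr
    linarith
  obtain ⟨r₀, hr₀, hav⟩ := mem_nhdsGT_iff_exists_Ioo_subset.mp hav0
  have hr₀ : 0 < r₀ := hr₀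
  -- The square of the constant 16 · 28 that appears in the bound for the square root of the area.
  set A : ℝ := 256 * 28 ^ 2 with hA
  obtain ⟨r, hr1, hr2, hr3⟩ : ∃ r : ℝ, 0 < r ∧ r < r₀ ∧
      volume.real (F ∩ Metric.ball x r) / r ^ 2 ≤ 1 / (16 * A) := by
    have hpos' : ∀ᶠ r : ℝ in 𝓝[>] 0, 0 < r := self_mem_nhdsWithin
    have hlt : ∀ᶠ r : ℝ in 𝓝[>] 0, r < r₀ := nhdsWithin_le_nhds (eventually_lt_nhds hr₀)
    obtain ⟨r, h1, h2, h3⟩ := ((hV.eventually_lt_const (show 0 < 1 / (16 * A) by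
      rw [hA]; norm_num)).and (hpos'.and hlt)).exists
    exact ⟨r, h2, h3, h1.le⟩
  have hav' : ∀ r', r' ≤ r → ∀ t, 0 < t → t ≤ r' →
      μ.real (Metric.ball x t) / 2 ≤ ∫ z in Metric.ball x t, inner ℝ n (ν z) ∂μ :=
    fun r' hr' t ht htr => hav ⟨ht, (htr.trans hr').trans_lt hr2⟩
  set V : ℝ → ℝ := fun t => volume.real (F ∩ Metric.ball x t) with hVd
  have hVnn : ∀ t, 0 ≤ V t := fun t => measureReal_nonneg
  have hVmono : ∀ s t, s ≤ t → V s ≤ V t := fun s t hst =>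
    measureReal_mono (inter_subset_inter_right _ (Metric.ball_subset_ball hst))
      ((measure_mono inter_subset_right).trans_lt measure_ball_lt_top).ne
  -- Radii decreasing from r towards r/2, with gaps proportional to 2^(−k); the gaps cause the
  -- growth 16^k in the recursion.
  set ρ : ℕ → ℝ := fun k => r * (1 + (1 / 2) ^ k) / 2 with hρ
  have hρpos : ∀ k, 0 < ρ k := fun k => by positivity
  have hρhalf : ∀ k, r / 2 ≤ ρ k := fun k => by
    have : 0 ≤ r * (1 / 2 : ℝ) ^ k := by positivity
    simp only [hρ]; linarith
  have hρle : ∀ k, ρ k ≤ r := fun k => by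
    have : (1 / 2 : ℝ) ^ k ≤ 1 := pow_le_one₀ (by norm_num) (by norm_num)
    simp only [hρ]; nlinarith
  have hρdiff : ∀ k, ρ k - ρ (k + 1) = r * (1 / 2) ^ k / 4 := fun k => by
    simp only [hρ]; ring
  have hrec : ∀ k, V (ρ (k + 1)) / r ^ 2 ≤ A * 16 ^ k * (V (ρ k) / r ^ 2) ^ 2 := by
    intro k
    have hd := hρdiff k
    have hdpos : 0 < r * (1 / 2 : ℝ) ^ k / 4 := by positivity
    have h1 := h.area_decay hF hn (hρpos (k + 1)) (by linarith : ρ (k + 1) < ρ k)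
      (hav' (ρ k) (hρle k))
    change (ρ k ^ 2 - ρ (k + 1) ^ 2) ^ 2 * √(V (ρ (k + 1))) ≤ 28 * ρ k ^ 3 * V (ρ k) at h1
    have h2 : r * (1 / 2 : ℝ) ^ k / 4 * r ≤ ρ k ^ 2 - ρ (k + 1) ^ 2 := by
      have : ρ k ^ 2 - ρ (k + 1) ^ 2 = (ρ k - ρ (k + 1)) * (ρ k + ρ (k + 1)) := by ring
      rw [this, hd]
      gcongr
      linarith [hρhalf k, hρhalf (k + 1)]
    have h3 : (r * (1 / 2 : ℝ) ^ k / 4 * r) ^ 2 * √(V (ρ (k + 1))) ≤ 28 * r ^ 3 * V (ρ k) := by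
      calc _ ≤ (ρ k ^ 2 - ρ (k + 1) ^ 2) ^ 2 * √(V (ρ (k + 1))) := by gcongr
        _ ≤ 28 * ρ k ^ 3 * V (ρ k) := h1
        _ ≤ _ := by
          have := hVnn (ρ k)
          have := (hρpos k).le
          gcongr
          exact hρle k
    have h4 : √(V (ρ (k + 1))) ≤ 16 * 28 * 4 ^ k * V (ρ k) / r := by
      rw [le_div_iff₀ hr1]
      have e1 : (4 : ℝ) ^ k * ((1 / 2) ^ k) ^ 2 = 1 := by
        rw [← pow_mul, mul_comm k 2, pow_mul, ← mul_pow]; norm_num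
      have e2 : (r * (1 / 2 : ℝ) ^ k / 4 * r) ^ 2 * √(V (ρ (k + 1))) * (16 * 4 ^ k) =
          r ^ 3 * (√(V (ρ (k + 1))) * r) * (4 ^ k * ((1 / 2) ^ k) ^ 2) := by ring
      rw [e1, mul_one] at e2
      have h5 := mul_le_mul_of_nonneg_right h3 (by positivity : (0 : ℝ) ≤ 16 * 4 ^ k)
      rw [e2] at h5
      refine le_of_mul_le_mul_left ?_ (by positivity : 0 < r ^ 3)
      linarith
    have h6 := pow_le_pow_left₀ (Real.sqrt_nonneg _) h4 2
    rw [Real.sq_sqrt (hVnn _)] at h6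
    calc V (ρ (k + 1)) / r ^ 2 ≤ (16 * 28 * 4 ^ k * V (ρ k) / r) ^ 2 / r ^ 2 := by gcongr
      _ = A * (4 ^ k) ^ 2 * (V (ρ k) / r ^ 2) ^ 2 := by rw [hA]; field_simp; ring
      _ = _ := by rw [← pow_mul, mul_comm k 2, pow_mul]; norm_num
  have hdecay := le_of_sq_recursion (A := A) (a₀ := 1 / (16 * A)) (by rw [hA]; norm_num)
    (by rw [hA]; norm_num) (by rw [hA]; norm_num) (a := fun k => V (ρ k) / r ^ 2)
    (fun k => div_nonneg (hVnn _) (by positivity)) (by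
      have : ρ 0 = r := by simp only [hρ]; ring
      simpa only [this] using hr3) hrec
  have hhalf : V (r / 2) = 0 := by
    have h1 : ∀ k : ℕ, V (r / 2) / r ^ 2 ≤ 1 / (16 * A) * (1 / 16) ^ k := fun k =>
      (div_le_div_of_nonneg_right (hVmono _ _ (hρhalf k)) (by positivity)).trans (hdecay k)
    have h2 : Tendsto (fun k : ℕ => 1 / (16 * A) * (1 / 16 : ℝ) ^ k) atTop (𝓝 0) := by
      simpa using (tendsto_pow_atTop_nhds_zero_of_lt_one (r := (1 / 16 : ℝ)) (by norm_num)
        (by norm_num)).const_mul (1 / (16 * A))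
    have h3 : V (r / 2) / r ^ 2 ≤ 0 := ge_of_tendsto' h2 h1
    refine le_antisymm ?_ (hVnn _)
    by_contra hlt
    exact absurd h3 (not_le.mpr (div_pos (not_le.mp hlt) (by positivity)))
  -- Zero area in the half disk gives zero weighted perimeter there, against the positivity of μ on
  -- every disk around x.
  have hfin := h.integral_cutoff_le hn (by linarith : 0 < r / 2) (hav' (r / 2) (by linarith))
  change _ ≤ 8 * (r / 2) ^ 3 * V (r / 2) at hfin
  rw [hhalf, mul_zero] at hfin
  have hcm : Measurable (cutoff x (r / 2)) := (contDiff_cutoff x (r / 2)).continuous.measurable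
  have hci : Integrable (cutoff x (r / 2)) μ :=
    Integrable.of_bound hcm.aestronglyMeasurable ((r / 2) ^ 4) (Eventually.of_forall fun z => by
      rw [Real.norm_of_nonneg (cutoff_nonneg _ _ _)]; exact cutoff_le _ _ _)
  have hgt : 0 < ∫ z, cutoff x (r / 2) z ∂μ := by
    rw [integral_pos_iff_support_of_nonneg (cutoff_nonneg x (r / 2)) hci]
    exact (hpos (r / 2) (by linarith)).trans_le (measure_mono fun z hz => (cutoff_pos hz).ne')
  linarith

end IsPolarGradient

/-! ### The perimeter measure of the set enclosed by a curve -/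

theorem perp_eq (v : ℂ) : perp v = -Complex.I * v := by
  apply Complex.ext <;> simp [perp]

theorem norm_perp (v : ℂ) : ‖perp v‖ = ‖v‖ := by
  rw [perp_eq, norm_mul, norm_neg, Complex.norm_I, one_mul]

/-- Conditioning a density on a curve to the points of its trace. -/
theorem exists_density_map {γ : ℝ → ℂ} (hγ : Measurable γ) {ρ : Measure ℝ} [IsFiniteMeasure ρ]
    {f : ℝ → ℝ} (hf : Integrable f ρ) :
    ∃ g : ℂ → ℝ, Measurable g ∧ Integrable g (ρ.map γ) ∧
      ∀ φ : ℂ → ℝ, Continuous φ → (∃ C, ∀ z, |φ z| ≤ C) →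
        ∫ s, φ (γ s) * f s ∂ρ = ∫ z, φ z * g z ∂(ρ.map γ) := by
  have hle := hγ.comap_le
  -- The conditional expectation of f given γ is a function g of γ; being measurable for the
  -- pulled-back σ-algebra, test functions φ ∘ γ can be taken out of it.
  have hsm : StronglyMeasurable[MeasurableSpace.comap γ inferInstance]
      (ρ[f | MeasurableSpace.comap γ inferInstance]) := stronglyMeasurable_condExp
  obtain ⟨g, hg, hge⟩ := hsm.measurable.exists_eq_measurable_comp
  have hgi : Integrable g (ρ.map γ) := by
    rw [integrable_map_measure hg.aestronglyMeasurable hγ.aemeasurable, ← hge]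
    exact integrable_condExp
  refine ⟨g, hg, hgi, fun φ hφ ⟨C, hC⟩ => ?_⟩
  have hφm : StronglyMeasurable[MeasurableSpace.comap γ inferInstance] (φ ∘ γ) :=
    (hφ.measurable.comp (comap_measurable γ)).stronglyMeasurable
  have hφf : Integrable ((φ ∘ γ) * f) ρ :=
    hf.bdd_mul (c := C) (hφ.measurable.comp hγ).aestronglyMeasurable
      (Eventually.of_forall fun s => hC _)
  have h1 := condExp_mul_of_stronglyMeasurable_left hφm hφf hf
  have h2 := integral_condExp (μ := ρ) (f := (φ ∘ γ) * f) hle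
  rw [integral_map (f := fun z => φ z * g z) hγ.aemeasurable
    (hφ.measurable.mul hg).aestronglyMeasurable]
  calc ∫ s, φ (γ s) * f s ∂ρ = ∫ s, ((φ ∘ γ) * f) s ∂ρ := rfl
    _ = ∫ s, ((φ ∘ γ) * ρ[f | MeasurableSpace.comap γ inferInstance]) s ∂ρ := by
        rw [← h2]; exact integral_congr_ae h1
    _ = _ := by rw [hge]; rfl

namespace IsArcCurve

variable {L : ℝ} {γ : ℝ → ℂ}

theorem continuous_perp_deriv (h : IsArcCurve L γ) : Continuous fun s => perp (deriv γ s) := by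
  simp_rw [perp_eq]
  exact continuous_const.mul h.continuous_deriv

/-- Gauss–Green expresses the gradient as the push-forward under γ of γ'^⊥ ds. Conditioning both
components gives a density g with respect to the push-forward of arclength, and |g|, g/|g| is the
polar form; cancellation between overlapping branches is thereby included. -/
theorem hasFinitePerimeter_clockwiseSet (h : IsArcCurve L γ)
    (hw : ∀ z ∉ range γ, wind L γ z = 0 ∨ wind L γ z = -1) :
    HasFinitePerimeter (clockwiseSet L γ) := by
  refine ⟨h.isOpen_clockwiseSet.measurableSet, ?_⟩
  set ρ : Measure ℝ := volume.restrict (Ioc 0 L) with hρ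
  have hγ := h.continuous.measurable
  have hc := h.continuous_perp_deriv
  have hbd : ∀ s, ‖perp (deriv γ s)‖ ≤ 1 := fun s => by rw [norm_perp, h.norm_deriv]
  have hi1 : Integrable (fun s => (perp (deriv γ s)).re) ρ :=
    Integrable.of_bound (Complex.continuous_re.comp hc).aestronglyMeasurable 1
      (Eventually.of_forall fun s => (Complex.abs_re_le_norm _).trans (hbd s))
  have hi2 : Integrable (fun s => (perp (deriv γ s)).im) ρ :=
    Integrable.of_bound (Complex.continuous_im.comp hc).aestronglyMeasurable 1
      (Eventually.of_forall fun s => (Complex.abs_im_le_norm _).trans (hbd s))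
  obtain ⟨g₁, hg1, hg1i, hg1e⟩ := exists_density_map hγ hi1
  obtain ⟨g₂, hg2, hg2i, hg2e⟩ := exists_density_map hγ hi2
  set l : Measure ℂ := ρ.map γ with hl
  set g : ℂ → ℂ := fun z => ⟨g₁ z, g₂ z⟩ with hg
  have hgm : Measurable g := by
    have : g = fun z => (g₁ z : ℂ) + g₂ z * Complex.I := by
      ext z; apply Complex.ext <;> simp [hg]
    rw [this]
    fun_prop
  have hgi : Integrable g l := by
    have : g = fun z => (g₁ z : ℂ) + g₂ z * Complex.I := by
      ext z; apply Complex.ext <;> simp [hg]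
    rw [this]
    exact hg1i.ofReal.add (hg2i.ofReal.mul_const _)
  refine ⟨l.withDensity fun z => ‖g z‖ₑ, fun z => (‖g z‖⁻¹ : ℝ) • g z, ?_, ?_, ?_, ?_⟩
  · exact isFiniteMeasure_withDensity hgi.2.ne
  · exact hgm.norm.inv.smul hgm
  · rw [ae_withDensity_iff hgm.enorm]
    refine Eventually.of_forall fun z hz => ?_
    have : ‖g z‖ ≠ 0 := by simpa using hz
    rw [norm_smul, norm_inv, norm_norm, inv_mul_cancel₀ this]
  · intro η hη hηc
    rw [h.setIntegral_divergence hw hη hηc, intervalIntegral.integral_of_le h.pos.le]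
    congr 1
    obtain ⟨C, hC⟩ := hηc.exists_bound_of_continuous hη.continuous
    have hre : Continuous fun z => (η z).re := Complex.continuous_re.comp hη.continuous
    have him : Continuous fun z => (η z).im := Complex.continuous_im.comp hη.continuous
    have hreC : ∀ z, |(η z).re| ≤ C := fun z => (Complex.abs_re_le_norm _).trans (hC z)
    have himC : ∀ z, |(η z).im| ≤ C := fun z => (Complex.abs_im_le_norm _).trans (hC z)
    have hin : ∀ a b : ℂ, (inner ℝ a b : ℝ) = a.re * b.re + a.im * b.im := fun a b => by
      simp [Complex.inner]; ring
    have e1 := hg1e _ hre ⟨C, hreC⟩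
    have e2 := hg2e _ him ⟨C, himC⟩
    have j1 : Integrable (fun s => (η (γ s)).re * (perp (deriv γ s)).re) ρ :=
      hi1.bdd_mul (c := C) (hre.comp h.continuous).aestronglyMeasurable
        (Eventually.of_forall fun s => hreC _)
    have j2 : Integrable (fun s => (η (γ s)).im * (perp (deriv γ s)).im) ρ :=
      hi2.bdd_mul (c := C) (him.comp h.continuous).aestronglyMeasurable
        (Eventually.of_forall fun s => himC _)
    have j3 : Integrable (fun z => (η z).re * g₁ z) l :=
      hg1i.bdd_mul (c := C) hre.aestronglyMeasurable (Eventually.of_forall fun s => hreC _)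
    have j4 : Integrable (fun z => (η z).im * g₂ z) l :=
      hg2i.bdd_mul (c := C) him.aestronglyMeasurable (Eventually.of_forall fun s => himC _)
    rw [integral_withDensity_eq_integral_toReal_smul hgm.enorm
      (Eventually.of_forall fun z => enorm_lt_top)]
    have e3 : ∀ z, (‖g z‖ₑ).toReal • (inner ℝ (η z) ((‖g z‖⁻¹ : ℝ) • g z) : ℝ) =
        (η z).re * g₁ z + (η z).im * g₂ z := by
      intro z
      rw [toReal_enorm, smul_eq_mul, real_inner_smul_right, ← mul_assoc]
      by_cases h0 : ‖g z‖ = 0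
      · have h1 : g z = 0 := norm_eq_zero.mp h0
        have h2 : g₁ z = 0 := congrArg Complex.re h1
        have h3 : g₂ z = 0 := congrArg Complex.im h1
        rw [h0, h2, h3]; simp
      · rw [mul_inv_cancel₀ h0, one_mul, hin]
    simp_rw [e3, hin]
    rw [integral_add j1 j2, integral_add j3 j4, e1, e2]

/-- The vector-valued perimeter measure of a disk is the integral of the rotated tangent over the
part of the curve in the disk. -/
theorem setIntegral_ball_normal (h : IsArcCurve L γ)
    (hw : ∀ z ∉ range γ, wind L γ z = 0 ∨ wind L γ z = -1) {μ : Measure ℂ} {ν : ℂ → ℂ}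
    (hp : IsPolarGradient (clockwiseSet L γ) μ ν) (x : ℂ) {r : ℝ} (hr : 0 < r) :
    ∫ z in Metric.ball x r, ν z ∂μ =
      perp (∫ s in (0 : ℝ)..L, (γ ⁻¹' Metric.ball x r).indicator (deriv γ) s) := by
  have hμ := hp.1
  have hνi : Integrable ν μ := Integrable.of_bound hp.2.1.aestronglyMeasurable 1
    (hp.2.2.1.mono fun z hz => hz.le)
  have hc := h.continuous_perp_deriv
  set ρ : Measure ℝ := volume.restrict (Ioc 0 L) with hρ
  have htest : ∀ φ : ℂ → ℝ, ContDiff ℝ 1 φ → HasCompactSupport φ →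
      ∫ z, φ z • ν z ∂μ = ∫ s, φ (γ s) • perp (deriv γ s) ∂ρ := by
    intro φ hφ hφc
    obtain ⟨C, hC⟩ := hφc.exists_bound_of_continuous hφ.continuous
    have j1 : Integrable (fun z => φ z • ν z) μ :=
      hνi.bdd_smul C hφ.continuous.aestronglyMeasurable (Eventually.of_forall hC)
    have j2 : Integrable (fun s => φ (γ s) • perp (deriv γ s)) ρ :=
      (((hφ.continuous.comp h.continuous).smul hc).intervalIntegrable (μ := volume) 0 L).1
    refine ext_inner_left ℝ fun v => ?_
    rw [← integral_inner j1, ← integral_inner j2]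
    have e1 := h.setIntegral_divergence hw (hφ.smul contDiff_const (g := fun _ => v)) hφc.smul_right
    have e2 := hp.2.2.2 _ (hφ.smul contDiff_const (g := fun _ => v)) hφc.smul_right
    rw [e1, neg_inj, intervalIntegral.integral_of_le h.pos.le] at e2
    simp_rw [real_inner_smul_right]
    simp_rw [Pi.smul_apply', real_inner_smul_left] at e2
    exact e2.symm
  -- These C¹ test functions converge pointwise, and boundedly, to the indicator of the open disk.
  set φ : ℕ → ℂ → ℝ := fun j z => j * cutoff x r z / (1 + j * cutoff x r z) with hφ
  have hden : ∀ (j : ℕ) z, 0 < 1 + j * cutoff x r z := fun j z => by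
    have := cutoff_nonneg x r z
    positivity
  have hφs : ∀ j, ContDiff ℝ 1 (φ j) := fun j =>
    (contDiff_const.mul (contDiff_cutoff x r)).div
      (contDiff_const.add (contDiff_const.mul (contDiff_cutoff x r))) fun z => (hden j z).ne'
  have hφc : ∀ j, HasCompactSupport (φ j) := fun j =>
    (hasCompactSupport_cutoff x hr).mono fun z hz h0 => hz (by
      have : cutoff x r z = 0 := h0
      simp [hφ, this])
  have hφb : ∀ j z, ‖φ j z‖ ≤ 1 := fun j z => by
    have h1 := cutoff_nonneg x r z
    rw [Real.norm_of_nonneg (by positivity), div_le_one (hden j z)]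
    linarith
  have hφl : ∀ z, Tendsto (fun j => φ j z) atTop
      (𝓝 ((Metric.ball x r).indicator (fun _ => 1) z)) := by
    intro z
    by_cases hz : z ∈ Metric.ball x r
    · rw [indicator_of_mem hz]
      have hq := cutoff_pos hz
      have h1 : Tendsto (fun j : ℕ => (j : ℝ) * cutoff x r z) atTop atTop :=
        tendsto_natCast_atTop_atTop.atTop_mul_const hq
      have h2 : Tendsto (fun j : ℕ => 1 - (1 + (j : ℝ) * cutoff x r z)⁻¹) atTop (𝓝 (1 - 0)) :=
        tendsto_const_nhds.sub (tendsto_inv_atTop_zero.comp (tendsto_atTop_add_const_left _ 1 h1))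
      rw [sub_zero] at h2
      refine h2.congr fun j => ?_
      have := (hden j z).ne'
      simp only [hφ]
      field_simp
      ring
    · rw [indicator_of_notMem hz]
      refine tendsto_const_nhds.congr fun j => ?_
      simp [hφ, cutoff_eq_zero hr hz]
  have hlim1 : Tendsto (fun j => ∫ z, φ j z • ν z ∂μ) atTop
      (𝓝 (∫ z, (Metric.ball x r).indicator (fun _ => (1 : ℝ)) z • ν z ∂μ)) := by
    refine tendsto_integral_of_dominated_convergence (fun _ => 1)
      (fun j => ((hφs j).continuous.aestronglyMeasurable.smul hp.2.1.aestronglyMeasurable))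
      (integrable_const _) (fun j => ?_) (Eventually.of_forall fun z => (hφl z).smul_const _)
    filter_upwards [hp.2.2.1] with z hz
    rw [norm_smul, hz, mul_one]
    exact hφb j z
  have hlim2 : Tendsto (fun j => ∫ s, φ j (γ s) • perp (deriv γ s) ∂ρ) atTop
      (𝓝 (∫ s, (Metric.ball x r).indicator (fun _ => (1 : ℝ)) (γ s) • perp (deriv γ s) ∂ρ)) := by
    refine tendsto_integral_of_dominated_convergence (fun _ => 1)
      (fun j => (((hφs j).continuous.comp h.continuous).smul hc).aestronglyMeasurable)
      (integrable_const _) (fun j => Eventually.of_forall fun s => ?_)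
      (Eventually.of_forall fun s => (hφl _).smul_const _)
    rw [norm_smul, norm_perp, h.norm_deriv, mul_one]
    exact hφb j _
  have heq : ∫ z, (Metric.ball x r).indicator (fun _ => (1 : ℝ)) z • ν z ∂μ =
      ∫ s, (Metric.ball x r).indicator (fun _ => (1 : ℝ)) (γ s) • perp (deriv γ s) ∂ρ :=
    tendsto_nhds_unique hlim1 (hlim2.congr fun j => (htest (φ j) (hφs j) (hφc j)).symm)
  have e1 : ∀ z, (Metric.ball x r).indicator (fun _ => (1 : ℝ)) z • ν z =
      (Metric.ball x r).indicator ν z := by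
    intro z
    by_cases hz : z ∈ Metric.ball x r <;> simp [hz]
  have e2 : ∀ s, (Metric.ball x r).indicator (fun _ => (1 : ℝ)) (γ s) • perp (deriv γ s) =
      -Complex.I * (γ ⁻¹' Metric.ball x r).indicator (deriv γ) s := by
    intro s
    by_cases hz : γ s ∈ Metric.ball x r
    · rw [indicator_of_mem hz, indicator_of_mem (by exact hz), one_smul, perp_eq]
    · rw [indicator_of_notMem hz, indicator_of_notMem (by exact hz)]; simp
  simp_rw [e1, e2] at heq
  rw [integral_indicator measurableSet_ball, integral_const_mul] at heq
  rw [heq, perp_eq, intervalIntegral.integral_of_le h.pos.le]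

/-- Off the trace the gradient of small disks vanishes, so the averages are 0 and cannot tend to a
unit vector. -/
theorem reducedBoundary_clockwiseSet_subset (h : IsArcCurve L γ)
    (hw : ∀ z ∉ range γ, wind L γ z = 0 ∨ wind L γ z = -1) :
    reducedBoundary (clockwiseSet L γ) ⊆ range γ := by
  rintro x ⟨n, μ, ν, hp, -, hlim, hn⟩
  by_contra hx
  obtain ⟨d, hd, hdb⟩ := h.exists_forall_le_norm_sub hx
  have h0 : Tendsto (fun r : ℝ => ⨍ z in Metric.ball x r, ν z ∂μ) (𝓝[>] 0) (𝓝 0) := by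
    refine tendsto_const_nhds.congr' ?_
    filter_upwards [self_mem_nhdsWithin, nhdsWithin_le_nhds (eventually_lt_nhds hd)] with r hr hrd
    rw [setAverage_eq, h.setIntegral_ball_normal hw hp x hr]
    have : ∀ s, (γ ⁻¹' Metric.ball x r).indicator (deriv γ) s = 0 := fun s => by
      refine indicator_of_notMem (fun hs => ?_) _
      rw [mem_preimage, Metric.mem_ball, dist_eq_norm] at hs
      linarith [hdb s]
    simp [this, perp_eq]
  rw [tendsto_nhds_unique hlim h0, norm_zero] at hn
  exact zero_ne_one hn

end IsArcCurve

/-! ### The inner normal of the set enclosed by a curve -/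

/-- A convex function of z is strictly below a linear one. Convexity makes the half sector
connected, so the winding number is constant on it once the curve avoids it. -/
theorem convex_sector (x T : ℂ) (r ε : ℝ) (hε : 0 ≤ ε) :
    Convex ℝ (Metric.ball x r ∩ {z | ε * ‖z - x‖ < ((z - x) / T).im}) := by
  refine (convex_ball x r).inter ?_
  intro z hz w hw a b ha hb hab
  simp only [mem_ofPred_eq] at hz hw ⊢
  have h1 : a • z + b • w - x = a • (z - x) + b • (w - x) := by
    have : x = (a + b) • x := by rw [hab, one_smul]
    rw [smul_sub, smul_sub]
    nth_rewrite 1 [this]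
    rw [add_smul]; abel
  have h2 : ‖a • (z - x) + b • (w - x)‖ ≤ a * ‖z - x‖ + b * ‖w - x‖ := by
    refine (norm_add_le _ _).trans ?_
    rw [norm_smul, norm_smul, Real.norm_of_nonneg ha, Real.norm_of_nonneg hb]
  have h3 : ((a • (z - x) + b • (w - x)) / T).im = a * ((z - x) / T).im + b * ((w - x) / T).im := by
    rw [add_div, Complex.add_im, smul_div_assoc, smul_div_assoc, Complex.smul_im, Complex.smul_im,
      smul_eq_mul, smul_eq_mul]
  rw [h1, h3]
  refine (mul_le_mul_of_nonneg_left h2 hε).trans_lt ?_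
  rcases ha.eq_or_lt with rfl | ha'
  · have : b = 1 := by linarith
    subst this; linarith
  · nlinarith

/-- After a translation and a rotation taking T to 1, the set lies in a box with sides 2r and 2εr.
-/
theorem volume_strip_le (x : ℂ) {T : ℂ} (hT : ‖T‖ = 1) {r ε : ℝ} (hr : 0 ≤ r) (hε : 0 ≤ ε) :
    volume {z : ℂ | ‖z - x‖ ≤ r ∧ |((z - x) / T).im| ≤ ε * ‖z - x‖} ≤
      ENNReal.ofReal (4 * ε * r ^ 2) := by
  set c : Circle := ⟨T⁻¹, mem_sphere_zero_iff_norm.2 (by rw [norm_inv, hT, inv_one])⟩ with hc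
  set R : Set ℂ := Icc (-r) r ×ℂ Icc (-(ε * r)) (ε * r) with hR
  have hRm : MeasurableSet R := (isClosed_Icc.reProdIm isClosed_Icc).measurableSet
  have hRv : volume R = ENNReal.ofReal (4 * ε * r ^ 2) := by
    have : R = Complex.measurableEquivRealProd ⁻¹' (Icc (-r) r ×ˢ Icc (-(ε * r)) (ε * r)) := rfl
    rw [this, Complex.volume_preserving_equiv_real_prod.measure_preimage
      (measurableSet_Icc.prod measurableSet_Icc).nullMeasurableSet, Measure.volume_eq_prod,
      Measure.prod_prod, Real.volume_Icc, Real.volume_Icc, ← ENNReal.ofReal_mul (by linarith)]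
    congr 1; ring
  have hmp : MeasurePreserving (fun z : ℂ => rotation c (z - x)) :=
    (rotation c).measurePreserving.comp (measurePreserving_sub_right volume x)
  rw [← hRv, ← hmp.measure_preimage hRm.nullMeasurableSet]
  refine measure_mono fun z hz => ?_
  have hrot : rotation c (z - x) = (z - x) / T := by
    rw [rotation_apply, div_eq_inv_mul]
  have hn : ‖(z - x) / T‖ = ‖z - x‖ := by rw [norm_div, hT, div_one]
  rw [mem_preimage, hrot, hR, Complex.mem_reProdIm]
  have h1 := (Complex.abs_re_le_norm ((z - x) / T)).trans (hn.le.trans hz.1)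
  have h2 := hz.2.trans (mul_le_mul_of_nonneg_left hz.1 hε)
  exact ⟨abs_le.mp h1, abs_le.mp h2⟩

namespace IsArcCurve

variable {L : ℝ} {γ : ℝ → ℂ}

/-- Near a point at which all branches are tangent to `T`, the curve lies in a thin double sector
around the tangent line. -/
theorem exists_sector (h : IsArcCurve L γ) {x T : ℂ} (hT : ‖T‖ = 1)
    (hpar : ∀ s ∈ preimages L γ x, deriv γ s = T ∨ deriv γ s = -T) {ε : ℝ} (hε : 0 < ε) :
    ∃ r > 0, ∀ z ∈ Metric.ball x r, ε * ‖z - x‖ < |((z - x) / T).im| → z ∉ range γ := by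
  have hT0 : T ≠ 0 := fun h0 => by simp [h0] at hT
  -- The accuracy 1/2 gives |s − s₀| ≤ 2|γ(s) − x|, and the accuracy ε/2 then bounds the deviation
  -- from the tangent by ε|γ(s) − x|.
  obtain ⟨S, η, δ, c, hS, hδ, hc, hin, hsep, hlin, hfar⟩ :=
    h.exists_branches x (ε := min (1 / 2) (ε / 2)) (by positivity)
  refine ⟨c, hc, ?_⟩
  rintro z hz him ⟨s', rfl⟩
  obtain ⟨s, hs, hss⟩ := h.periodic.exists_mem_Ico h.pos s' (-η)
  rw [hss] at hz him
  rw [Metric.mem_ball, dist_eq_norm] at hz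
  by_cases hex : ∃ s₀ ∈ S, |s - s₀| < δ
  · obtain ⟨s₀, hs₀, hd⟩ := hex
    have hs₀' : s₀ ∈ preimages L γ x := by rw [← hS]; exact hs₀
    have h1 := hlin s₀ s hd.le
    rw [hs₀'.2] at h1
    set e := γ s - x - ((s - s₀ : ℝ) : ℂ) * deriv γ s₀ with he
    have h2 : γ s - x = ((s - s₀ : ℝ) : ℂ) * deriv γ s₀ + e := by rw [he]; ring
    have h3 : ((γ s - x) / T).im = (e / T).im := by
      rw [h2, add_div, Complex.add_im]
      rcases hpar s₀ hs₀' with h4 | h4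
      · rw [h4, mul_div_assoc, div_self hT0, mul_one, Complex.ofReal_im, zero_add]
      · rw [h4, mul_div_assoc, neg_div, div_self hT0, mul_neg, mul_one, Complex.neg_im,
          Complex.ofReal_im, neg_zero, zero_add]
    have h4 : |(e / T).im| ≤ ‖e‖ := by
      refine (Complex.abs_im_le_norm _).trans ?_
      rw [norm_div, hT, div_one]
    have h5 : |s - s₀| ≤ ‖γ s - x‖ + ‖e‖ := by
      have : ((s - s₀ : ℝ) : ℂ) * deriv γ s₀ = (γ s - x) - e := by rw [h2]; ring
      have h6 : ‖((s - s₀ : ℝ) : ℂ) * deriv γ s₀‖ = |s - s₀| := by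
        rw [norm_mul, h.norm_deriv, mul_one, Complex.norm_real, Real.norm_eq_abs]
      rw [← h6, this]
      exact norm_sub_le _ _
    have h6 : min (1 / 2) (ε / 2) ≤ 1 / 2 := min_le_left _ _
    have h7 : min (1 / 2) (ε / 2) ≤ ε / 2 := min_le_right _ _
    have h8 : |s - s₀| ≤ 2 * ‖γ s - x‖ := by nlinarith [abs_nonneg (s - s₀)]
    rw [h3] at him
    nlinarith [abs_nonneg (s - s₀)]
  · push Not at hex
    have := hfar s ⟨hs.1, by linarith [hs.2]⟩ hex
    linarith

/-- The value does not depend on ε: once ε is replaced by min(ε, 1/2), every sector contains the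
axis points x + ρiT for small ρ, and all are connected. -/
theorem exists_wind_eq_sector (h : IsArcCurve L γ) {x T : ℂ} (hT : ‖T‖ = 1)
    (hpar : ∀ s ∈ preimages L γ x, deriv γ s = T ∨ deriv γ s = -T) :
    ∃ a : ℂ, (∀ ε > 0, ∃ r > 0, ∀ z ∈ Metric.ball x r, ε * ‖z - x‖ < ((z - x) / T).im →
        z ∉ range γ ∧ wind L γ z = a) ∧
      ∀ᶠ ρ : ℝ in 𝓝[>] 0, wind L γ (x + ρ * (Complex.I * T)) = a ∧
        x + ρ * (Complex.I * T) ∉ range γ := by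
  have hT0 : T ≠ 0 := fun h0 => by simp [h0] at hT
  have hpt : ∀ ρ : ℝ, 0 < ρ → ∀ ε < 1, ∀ r > ρ, x + ρ * (Complex.I * T) ∈
      Metric.ball x r ∩ {z | ε * ‖z - x‖ < ((z - x) / T).im} := by
    intro ρ hρ ε hε r hr
    have e1 : x + ρ * (Complex.I * T) - x = ρ * (Complex.I * T) := by ring
    have e2 : ‖(ρ : ℂ) * (Complex.I * T)‖ = ρ := by
      rw [norm_mul, norm_mul, hT, Complex.norm_I, Complex.norm_real, Real.norm_of_nonneg hρ.le,
        mul_one, mul_one]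
    have e3 : ((ρ : ℂ) * (Complex.I * T) / T).im = ρ := by
      rw [← mul_assoc, mul_div_assoc, div_self hT0]; simp
    refine ⟨?_, ?_⟩
    · rw [Metric.mem_ball, dist_eq_norm, e1, e2]; exact hr
    · rw [mem_ofPred_eq, e1, e2, e3]; nlinarith
  have hconst : ∀ ε > 0, ∃ r > 0,
      Metric.ball x r ∩ {z | ε * ‖z - x‖ < ((z - x) / T).im} ⊆ (range γ)ᶜ := by
    intro ε hε
    obtain ⟨r, hr, hrs⟩ := h.exists_sector hT hpar hε
    exact ⟨r, hr, fun z hz => hrs z hz.1 (lt_of_lt_of_le hz.2 (le_abs_self _))⟩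
  obtain ⟨r₀, hr₀, hs₀⟩ := hconst (1 / 2) (by norm_num)
  refine ⟨wind L γ (x + (r₀ / 2 : ℝ) * (Complex.I * T)), fun ε hε => ?_, ?_⟩
  · obtain ⟨r, hr, hs⟩ := hconst (min ε (1 / 2)) (by positivity)
    refine ⟨r, hr, fun z hz hzs => ?_⟩
    have hz' : z ∈ Metric.ball x r ∩ {z | min ε (1 / 2) * ‖z - x‖ < ((z - x) / T).im} :=
      ⟨hz, lt_of_le_of_lt (mul_le_mul_of_nonneg_right (min_le_left _ _) (norm_nonneg _)) hzs⟩
    have hε1 : min ε (1 / 2) < 1 := (min_le_right _ _).trans_lt (by norm_num)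
    refine ⟨hs hz', ?_⟩
    have hm : 0 < min r r₀ / 2 := by positivity
    rw [h.wind_eq_of_isPreconnected (convex_sector x T r _ (by positivity)).isPreconnected hs hz'
      (hpt (min r r₀ / 2) hm _ hε1 r (by linarith [min_le_left r r₀]))]
    exact h.wind_eq_of_isPreconnected (convex_sector x T r₀ _ (by norm_num)).isPreconnected hs₀
      (hpt _ hm _ (by norm_num) r₀ (by linarith [min_le_right r r₀]))
      (hpt _ (by positivity) _ (by norm_num) r₀ (by linarith))
  · filter_upwards [self_mem_nhdsWithin, nhdsWithin_le_nhds (eventually_lt_nhds hr₀)] with ρ hρ hρr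
    have hp := hpt ρ hρ (1 / 2) (by norm_num) r₀ hρr
    exact ⟨h.wind_eq_of_isPreconnected (convex_sector x T r₀ _ (by norm_num)).isPreconnected hs₀
      hp (hpt _ (by positivity) _ (by norm_num) r₀ (by linarith)), hs₀ hp⟩

/-- The winding number is constant in either half of the complement of the double sector, and the
two values differ by the signed number of branches. -/
theorem exists_wind_eq_sectors (h : IsArcCurve L γ) {x T : ℂ} (hT : ‖T‖ = 1)
    (hpar : ∀ s ∈ preimages L γ x, deriv γ s = T ∨ deriv γ s = -T) :
    ∃ z₁ ∉ range γ, ∃ z₂ ∉ range γ,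
      wind L γ z₁ - wind L γ z₂ = ∑ᶠ s ∈ preimages L γ x, deriv γ s / T ∧
      ∀ ε > 0, ∃ r > 0, ∀ z ∈ Metric.ball x r, ε * ‖z - x‖ < |((z - x) / T).im| →
        z ∉ range γ ∧ (wind L γ z = wind L γ z₁ ∨ wind L γ z = wind L γ z₂) := by
  obtain ⟨a, ha, hae⟩ := h.exists_wind_eq_sector hT hpar
  -- The opposite sector is the sector for −T.
  obtain ⟨b, hb, hbe⟩ := h.exists_wind_eq_sector (T := -T) (by rwa [norm_neg])
    (fun s hs => by rw [neg_neg]; exact (hpar s hs).symm)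
  obtain ⟨hlim, -⟩ := h.tendsto_wind_sub hT hpar
  have hab : a - b = ∑ᶠ s ∈ preimages L γ x, deriv γ s / T := by
    refine tendsto_nhds_unique (tendsto_const_nhds.congr' ?_) hlim
    filter_upwards [hae, hbe] with ρ h1 h2
    rw [h1.1, ← h2.1, mul_neg, mul_neg, sub_eq_add_neg x]
  obtain ⟨ρ, h1, h2⟩ := (hae.and hbe).exists
  refine ⟨_, h1.2, _, h2.2, by rw [h1.1, h2.1, hab], fun ε hε => ?_⟩
  obtain ⟨r, hr, hra⟩ := ha ε hε
  obtain ⟨r', hr', hrb⟩ := hb ε hε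
  refine ⟨min r r', by positivity, fun z hz hzs => ?_⟩
  rw [h1.1, h2.1]
  rcases lt_abs.mp hzs with h3 | h3
  · have := hra z (Metric.ball_subset_ball (min_le_left _ _) hz) h3
    exact ⟨this.1, Or.inl this.2⟩
  · have := hrb z (Metric.ball_subset_ball (min_le_right _ _) hz) (by
      rwa [div_neg, Complex.neg_im])
    exact ⟨this.1, Or.inr this.2⟩

end IsArcCurve

theorem integral_divergence_eq_zero {η : ℂ → ℂ} (hη : ContDiff ℝ 1 η) (hc : HasCompactSupport η) :
    Integrable (divergence η) ∧ ∫ z, divergence η z = 0 := by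
  have hcd := hc.fderiv (𝕜 := ℝ)
  have hd : Continuous (fderiv ℝ η) := hη.continuous_fderiv (by norm_num)
  have hre : ∀ z, (fderiv ℝ η z 1).re = fderiv ℝ (fun z => (η z).re) z 1 := fun z => by
    have := (Complex.reCLM.hasFDerivAt.comp z (hη.differentiable (by norm_num) z).hasFDerivAt).fderiv
    exact (congrArg (fun l => l 1) this).symm
  have him : ∀ z, (fderiv ℝ η z Complex.I).im = fderiv ℝ (fun z => (η z).im) z Complex.I :=
    fun z => by
      have :=
        (Complex.imCLM.hasFDerivAt.comp z (hη.differentiable (by norm_num) z).hasFDerivAt).fderiv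
      exact (congrArg (fun l => l Complex.I) this).symm
  have i1 : Integrable fun z => (fderiv ℝ η z 1).re :=
    (Complex.continuous_re.comp (hd.clm_apply continuous_const)).integrable_of_hasCompactSupport
      (hcd.mono fun z hz h0 => hz (by simp [h0]))
  have i2 : Integrable fun z => (fderiv ℝ η z Complex.I).im :=
    (Complex.continuous_im.comp (hd.clm_apply continuous_const)).integrable_of_hasCompactSupport
      (hcd.mono fun z hz h0 => hz (by simp [h0]))
  refine ⟨i1.add i2, ?_⟩
  unfold divergence
  rw [integral_add i1 i2]
  simp_rw [hre, him]
  rw [integral_fderiv_apply_eq_zero (φ := fun z => (η z).re) (Complex.reCLM.contDiff.comp hη)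
      (hc.comp_left (g := Complex.re) rfl),
    integral_fderiv_apply_eq_zero (φ := fun z => (η z).im) (Complex.imCLM.contDiff.comp hη)
      (hc.comp_left (g := Complex.im) rfl), add_zero]

namespace IsPolarGradient

/-- The divergence of a test field has integral zero over the plane, so complementation changes the
sign of the gradient. This reduces density one to density zero. -/
theorem of_complement {E F : Set ℂ} {μ : Measure ℂ} {ν : ℂ → ℂ} (h : IsPolarGradient E μ ν)
    (hF : MeasurableSet F) (hd : Disjoint E F) (hu : ∀ᵐ z : ℂ, z ∈ E ∪ F) :
    IsPolarGradient F μ (fun z => -ν z) := by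
  refine ⟨h.1, h.2.1.neg, h.2.2.1.mono fun z hz => by rw [norm_neg, hz], fun η hη hc => ?_⟩
  obtain ⟨hi, h0⟩ := integral_divergence_eq_zero hη hc
  have h1 : ∫ z in E ∪ F, divergence η z = 0 := by
    rw [← h0]
    exact (setIntegral_congr_set (eventuallyEq_univ.mpr hu)).trans setIntegral_univ
  rw [setIntegral_union hd hF hi.integrableOn hi.integrableOn, h.2.2.2 η hη hc] at h1
  simp_rw [inner_neg_right]
  rw [integral_neg]
  linarith

end IsPolarGradient

namespace IsArcCurve

variable {L : ℝ} {γ : ℝ → ℂ}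

/-- Near x the set F is confined to the thin double sector, whose area in the disk is at most 4εr².
-/
theorem tendsto_density_zero {x T a : ℂ} (hT : ‖T‖ = 1)
    (hs : ∀ ε > 0, ∃ r > 0, ∀ z ∈ Metric.ball x r, ε * ‖z - x‖ < |((z - x) / T).im| →
        z ∉ range γ ∧ wind L γ z = a) {F : Set ℂ} (hF : ∀ z ∈ F, wind L γ z ≠ a) :
    Tendsto (fun r : ℝ => volume.real (F ∩ Metric.ball x r) / r ^ 2) (𝓝[>] 0) (𝓝 0) := by
  rw [Metric.tendsto_nhds]
  intro ε hε
  obtain ⟨r₀, hr₀, hr⟩ := hs (ε / 8) (by positivity)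
  filter_upwards [self_mem_nhdsWithin, nhdsWithin_le_nhds (eventually_lt_nhds hr₀)] with r hr0 hrr
  have hr0 : 0 < r := hr0
  have h1 : volume (F ∩ Metric.ball x r) ≤ ENNReal.ofReal (4 * (ε / 8) * r ^ 2) := by
    refine (measure_mono fun z hz => ?_).trans (volume_strip_le x hT hr0.le (by positivity))
    refine ⟨(mem_ball_iff_norm.mp hz.2).le, ?_⟩
    by_contra hlt
    push Not at hlt
    exact hF z hz.1 (hr z (Metric.ball_subset_ball hrr.le hz.2) hlt).2
  have h2 : volume.real (F ∩ Metric.ball x r) ≤ 4 * (ε / 8) * r ^ 2 :=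
    ENNReal.toReal_le_of_le_ofReal (by positivity) h1
  rw [Real.dist_eq, sub_zero, abs_of_nonneg (by positivity), div_lt_iff₀ (by positivity)]
  nlinarith [pow_pos hr0 2]

/-- The inner normal of the region with winding number `-1` is the sum of the rotated tangents. -/
theorem inner_normal_clockwiseSet (h : IsArcCurve L γ)
    (hw : ∀ z ∉ range γ, wind L γ z = 0 ∨ wind L γ z = -1)
    (hpar : ∀ s t, γ s = γ t → deriv γ s = deriv γ t ∨ deriv γ s = -deriv γ t) {x n : ℂ}
    (hn : IsInnerNormalAt (clockwiseSet L γ) x n) :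
    n = ∑ᶠ s ∈ preimages L γ x, perp (deriv γ s) := by
  obtain ⟨s₁, rfl⟩ := h.reducedBoundary_clockwiseSet_subset hw ⟨n, hn⟩
  obtain ⟨μ, ν, hp, hpos, hlim, hn1⟩ := hn
  have hμ := hp.1
  set T := deriv γ s₁ with hTdef
  have hT : ‖T‖ = 1 := h.norm_deriv s₁
  have hT0 : T ≠ 0 := fun h0 => by simp [h0] at hT
  obtain ⟨z₁, hz1, z₂, hz2, hjump, hsec⟩ := h.exists_wind_eq_sectors hT
    (x := γ s₁) fun s hs => hpar s s₁ hs.2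
  have hfin := h.finite_preimages (γ s₁)
  rw [finsum_mem_eq_finite_toFinset_sum _ hfin] at hjump ⊢
  have hball := h.tendsto_integral_ball (γ s₁)
  rw [finsum_mem_eq_finite_toFinset_sum _ hfin] at hball
  simp_rw [perp_eq]
  rw [← Finset.mul_sum]
  rw [← Finset.sum_div] at hjump
  set θ := ∑ s ∈ hfin.toFinset, deriv γ s with hθ
  have hnorm : ‖θ‖ = ‖wind L γ z₁ - wind L γ z₂‖ := by rw [hjump, norm_div, hT, div_one]
  by_cases hw12 : wind L γ z₁ = wind L γ z₂
  -- Equal winding numbers on both sides give the clockwise set (value 0) or its complement (value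
  -- −1) density zero at x.
  · exfalso
    have hsec' : ∀ ε > 0, ∃ r > 0, ∀ z ∈ Metric.ball (γ s₁) r,
        ε * ‖z - γ s₁‖ < |((z - γ s₁) / T).im| → z ∉ range γ ∧ wind L γ z = wind L γ z₁ := by
      simpa only [← hw12, or_self] using hsec
    rcases hw z₁ hz1 with h0 | h0
    · refine hp.not_tendsto_density_zero h.isOpen_clockwiseSet hn1 hpos hlim
        (tendsto_density_zero hT hsec' fun z hz => ?_)
      rw [hz.2, h0]; norm_num
    · have hFo : IsOpen {z | z ∉ range γ ∧ wind L γ z = 0} := by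
        simpa using h.isOpen_wind_eq {0}
      have hpF : IsPolarGradient {z | z ∉ range γ ∧ wind L γ z = 0} μ (fun z => -ν z) := by
        refine hp.of_complement hFo.measurableSet ?_ ?_
        · rw [Set.disjoint_left]
          rintro z hz hz'
          have := hz.2.symm.trans hz'.2
          norm_num at this
        · filter_upwards [h.ae_notMem_range] with z hz
          rcases hw z hz with h1 | h1
          · exact Or.inr ⟨hz, h1⟩
          · exact Or.inl ⟨hz, h1⟩
      refine hpF.not_tendsto_density_zero hFo (n := -n) (by rwa [norm_neg]) hpos ?_
        (tendsto_density_zero hT hsec' fun z hz => ?_)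
      · refine hlim.neg.congr fun r => ?_
        rw [setAverage_eq, setAverage_eq, integral_neg, smul_neg]
      · rw [hz.2, h0]; norm_num
  -- Two distinct values in {0, −1} differ by a number of modulus one.
  · have hθ1 : ‖θ‖ = 1 := by
      rw [hnorm]
      rcases hw z₁ hz1 with h1 | h1 <;> rcases hw z₂ hz2 with h2 | h2 <;> rw [h1, h2] at hw12 ⊢
      · exact absurd rfl hw12
      · norm_num
      · norm_num
      · exact absurd rfl hw12
    set J : ℝ → ℂ := fun r => ∫ s in (0 : ℝ)..L,
      (r : ℂ)⁻¹ * (γ ⁻¹' Metric.ball (γ s₁) r).indicator (deriv γ) s with hJ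
    have havg : ∀ᶠ r : ℝ in 𝓝[>] 0, ⨍ z in Metric.ball (γ s₁) r, ν z ∂μ =
        ((r / μ.real (Metric.ball (γ s₁) r) : ℝ) : ℂ) * (-Complex.I * J r) := by
      filter_upwards [self_mem_nhdsWithin] with r hr
      have hr : (r : ℂ) ≠ 0 := Complex.ofReal_ne_zero.mpr (ne_of_gt hr)
      rw [setAverage_eq, h.setIntegral_ball_normal hw hp _ (by assumption), perp_eq, hJ]
      simp only
      rw [intervalIntegral.integral_const_mul, Complex.real_smul]
      push_cast
      field_simp
    have hJn : Tendsto (fun r => ‖J r‖) (𝓝[>] 0) (𝓝 2) := by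
      have := hball.norm
      rwa [norm_mul, hθ1, mul_one, Complex.norm_ofNat] at this
    -- The averages have moduli tending to 1 and |J| tends to 2, so the perimeter of the disk is
    -- asymptotic to 2r; no separate density theorem is needed.
    have hratio : Tendsto (fun r : ℝ => r / μ.real (Metric.ball (γ s₁) r)) (𝓝[>] 0)
        (𝓝 (1 / 2)) := by
      have h1 : Tendsto (fun r => ‖⨍ z in Metric.ball (γ s₁) r, ν z ∂μ‖ / ‖J r‖) (𝓝[>] 0)
          (𝓝 (1 / 2)) := by
        have := hlim.norm.div hJn (by norm_num)
        rwa [hn1] at this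
      refine h1.congr' ?_
      filter_upwards [havg, self_mem_nhdsWithin, hJn.eventually (lt_mem_nhds one_lt_two)]
        with r hr hr0 hr1
      have hr0 : 0 < r := hr0
      rw [hr, norm_mul, norm_mul, norm_neg, Complex.norm_I, one_mul, Complex.norm_real,
        Real.norm_of_nonneg (by positivity), mul_div_assoc, div_self (by linarith), mul_one]
    have hlim2 : Tendsto (fun r : ℝ => ((r / μ.real (Metric.ball (γ s₁) r) : ℝ) : ℂ) *
        (-Complex.I * J r)) (𝓝[>] 0) (𝓝 (((1 / 2 : ℝ) : ℂ) * (-Complex.I * (2 * θ)))) :=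
      ((Complex.continuous_ofReal.tendsto _).comp hratio).mul (hball.const_mul _)
    rw [tendsto_nhds_unique hlim (hlim2.congr' (havg.mono fun _ hr => hr.symm))]
    push_cast
    ring

/-- The formula holds for every vector that qualifies as a normal at x, in particular for the chosen
one. -/
theorem innerNormal_clockwiseSet (h : IsArcCurve L γ)
    (hw : ∀ z ∉ range γ, wind L γ z = 0 ∨ wind L γ z = -1)
    (hpar : ∀ s t, γ s = γ t → deriv γ s = deriv γ t ∨ deriv γ s = -deriv γ t) {x : ℂ}
    (hx : x ∈ reducedBoundary (clockwiseSet L γ)) :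
    innerNormal (clockwiseSet L γ) x = ∑ᶠ s ∈ preimages L γ x, perp (deriv γ s) := by
  have hx' : ∃ n, IsInnerNormalAt (clockwiseSet L γ) x n := hx
  rw [innerNormal, dif_pos hx']
  exact h.inner_normal_clockwiseSet hw hpar hx'.choose_spec

end IsArcCurve

/-! ### Reversal of the orientation -/

namespace IsArcCurve

variable {L : ℝ} {γ : ℝ → ℂ}

theorem deriv_reverse (L : ℝ) (γ : ℝ → ℂ) (s : ℝ) :
    deriv (fun s => γ (L - s)) s = -deriv γ (L - s) :=
  deriv_comp_const_sub (f := γ) L s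

theorem reverse (h : IsArcCurve L γ) : IsArcCurve L fun s => γ (L - s) where
  pos := h.pos
  contDiff := h.contDiff.comp (contDiff_const.sub contDiff_id)
  periodic := fun s => by
    have := h.periodic (L - (s + L))
    simp only
    rw [← this]
    congr 1; ring
  norm_deriv := fun s => by rw [deriv_reverse, norm_neg, h.norm_deriv]

theorem range_reverse (L : ℝ) (γ : ℝ → ℂ) : range (fun s => γ (L - s)) = range γ := by
  ext z
  constructor
  · rintro ⟨s, rfl⟩; exact ⟨L - s, rfl⟩
  · rintro ⟨s, rfl⟩; exact ⟨L - s, by simp⟩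

theorem wind_reverse (L : ℝ) (γ : ℝ → ℂ) (z : ℂ) :
    wind L (fun s => γ (L - s)) z = -wind L γ z := by
  unfold wind
  simp_rw [deriv_reverse]
  rw [intervalIntegral.integral_comp_sub_left (fun s => -deriv γ s / (γ s - z)) L, sub_self,
    sub_zero]
  simp_rw [neg_div]
  rw [intervalIntegral.integral_neg, mul_neg]

end IsArcCurve

/-! ### Admissible curves -/

section admissible

variable {L : ℝ} {γ : ℝ → ℂ}

theorem contDiff_two_of_admissible (h : γ ∈ admissible L) : ContDiff ℝ 2 γ := by
  exact_mod_cast h.1.1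

theorem isArcCurve_of_admissible (hL : 0 < L) (h : γ ∈ admissible L) : IsArcCurve L γ where
  pos := hL
  contDiff := (contDiff_two_of_admissible h).of_le (by norm_num)
  periodic := h.1.2
  norm_deriv := fun s => by
    obtain ⟨t, ht, hst⟩ := (periodic_deriv h.1.2).exists_mem_Ico₀ hL s
    rw [hst]
    exact h.2.2.1 t (Ico_subset_Icc_self ht)

theorem norm_lt_one_of_admissible (hL : 0 < L) (h : γ ∈ admissible L) (s : ℝ) : ‖γ s‖ < 1 := by
  obtain ⟨t, ht, hst⟩ := h.1.2.exists_mem_Ico₀ hL s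
  rw [hst]
  exact mem_ball_zero_iff.mp (h.2.2.2 t (Ico_subset_Icc_self ht))

theorem contDiff_deriv_of_admissible (h : γ ∈ admissible L) : ContDiff ℝ 1 (deriv γ) := by
  have h2 : ContDiff ℝ (1 + 1) γ := (contDiff_two_of_admissible h).of_le (by norm_num)
  exact (contDiff_succ_iff_deriv.mp h2).2.2

theorem bendingEnergy_eq (L : ℝ) (γ : ℝ → ℂ) :
    bendingEnergy L γ = ∫ s in (0 : ℝ)..L, ‖deriv (deriv γ) s‖ ^ 2 := by
  simp only [bendingEnergy, iteratedDeriv_succ, iteratedDeriv_zero]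

end admissible

/-! ### Hölder bound for the tangents -/

theorem sq_integral_norm_le {f : ℝ → ℂ} (hf : Continuous f) {a b : ℝ} (hab : a ≤ b) :
    (∫ s in a..b, ‖f s‖) ^ 2 ≤ (b - a) * ∫ s in a..b, ‖f s‖ ^ 2 := by
  rcases hab.eq_or_lt with rfl | hlt
  · simp
  have hba : 0 < b - a := by linarith
  set A := ∫ s in a..b, ‖f s‖ with hA
  -- With c the mean of ‖f‖, the integral of (‖f‖ − c)² being nonnegative is the Cauchy–Schwarz
  -- inequality.
  set c := A / (b - a) with hc
  have i1 : IntervalIntegrable (fun s => ‖f s‖ ^ 2) volume a b :=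
    (hf.norm.pow 2).intervalIntegrable _ _
  have i2 : IntervalIntegrable (fun s => 2 * c * ‖f s‖) volume a b :=
    (continuous_const.mul hf.norm).intervalIntegrable _ _
  have h0 : 0 ≤ ∫ s in a..b, (‖f s‖ ^ 2 - 2 * c * ‖f s‖ + c ^ 2) :=
    intervalIntegral.integral_nonneg hab fun s _ => by nlinarith [sq_nonneg (‖f s‖ - c)]
  rw [intervalIntegral.integral_add (i1.sub i2) (by simp), intervalIntegral.integral_sub i1 i2,
    intervalIntegral.integral_const_mul, intervalIntegral.integral_const, smul_eq_mul, ← hA] at h0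
  have h1 : (b - a) * c = A := by rw [hc]; field_simp
  have h2 : (b - a) * (2 * c * A) = 2 * A ^ 2 := by rw [← h1]; ring
  have h3 : (b - a) * ((b - a) * c ^ 2) = A ^ 2 := by rw [← h1]; ring
  nlinarith [mul_nonneg hba.le h0]

/-- Cauchy–Schwarz for the second derivative on [t, s]. The restriction to one period allows
comparison of the integral with the energy. -/
theorem sq_norm_deriv_sub_le {L : ℝ} {γ : ℝ → ℂ} (h : γ ∈ admissible L) {s t : ℝ}
    (hst : |s - t| ≤ L) : ‖deriv γ s - deriv γ t‖ ^ 2 ≤ |s - t| * bendingEnergy L γ := by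
  wlog hle : t ≤ s generalizing s t
  · rw [norm_sub_rev, abs_sub_comm]
    exact this (by rwa [abs_sub_comm]) (le_of_not_ge hle)
  have hd := contDiff_deriv_of_admissible h
  have hc : Continuous (deriv (deriv γ)) := hd.continuous_deriv (by norm_num)
  rw [abs_of_nonneg (sub_nonneg.mpr hle)] at hst ⊢
  have h1 : deriv γ s - deriv γ t = ∫ u in t..s, deriv (deriv γ) u := by
    rw [intervalIntegral.integral_deriv_eq_sub
      (fun u _ => hd.differentiable (by norm_num) u) (hc.intervalIntegrable _ _)]
  have h2 : ‖deriv γ s - deriv γ t‖ ≤ ∫ u in t..s, ‖deriv (deriv γ) u‖ := by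
    rw [h1]; exact intervalIntegral.norm_integral_le_integral_norm hle
  have h3 : ∫ u in t..s, ‖deriv (deriv γ) u‖ ^ 2 ≤ bendingEnergy L γ := by
    have hp : Function.Periodic (fun u => ‖deriv (deriv γ) u‖ ^ 2) L := fun u => by
      simp only [periodic_deriv (periodic_deriv h.1.2) u]
    have hpe := hp.intervalIntegral_add_eq 0 t
    rw [zero_add] at hpe
    rw [bendingEnergy_eq, hpe]
    exact intervalIntegral.integral_mono_interval le_rfl hle (by linarith)
      (Eventually.of_forall fun u => by positivity) ((hc.norm.pow 2).intervalIntegrable _ _)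
  calc ‖deriv γ s - deriv γ t‖ ^ 2 ≤ (∫ u in t..s, ‖deriv (deriv γ) u‖) ^ 2 := by gcongr
    _ ≤ _ := sq_integral_norm_le hc hle
    _ ≤ _ := mul_le_mul_of_nonneg_left h3 (by linarith)

/-! ### Weak sequential compactness -/

/-- Weak sequential compactness of bounded sequences in a separable Hilbert space. -/
theorem exists_subseq_tendsto_inner {H : Type*} [NormedAddCommGroup H] [InnerProductSpace ℝ H]
    [CompleteSpace H] [TopologicalSpace.SeparableSpace H] {x : ℕ → H} {R : ℝ}
    (hx : ∀ k, ‖x k‖ ≤ R) :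
    ∃ (φ : ℕ → ℕ) (y : H), StrictMono φ ∧
      ∀ v, Tendsto (fun k => inner ℝ (x (φ k)) v) atTop (𝓝 (inner ℝ y v)) := by
  set f : ℕ → WeakDual ℝ H :=
    fun k => WeakDual.toStrongDual.symm (InnerProductSpace.toDual ℝ H (x k)) with hf
  have hmem : ∀ k, f k ∈ WeakDual.toStrongDual ⁻¹' Metric.closedBall (0 : StrongDual ℝ H) R := by
    intro k
    rw [mem_preimage, hf, LinearEquiv.apply_symm_apply, mem_closedBall_zero_iff,
      LinearIsometryEquiv.norm_map]
    exact hx k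
  obtain ⟨g, -, φ, hφ, hlim⟩ := WeakDual.isSeqCompact_closedBall ℝ H 0 R hmem
  refine ⟨φ, (InnerProductSpace.toDual ℝ H).symm (WeakDual.toStrongDual g), hφ, fun v => ?_⟩
  rw [InnerProductSpace.toDual_symm_apply]
  exact ((WeakDual.eval_continuous v).tendsto g).comp hlim

/-- Weak convergence in a submodule of a threefold product of Hilbert spaces is tested by the
functionals on the factors. -/
theorem tendsto_toWeakSpace_of_forall_inner {H : Type*} [NormedAddCommGroup H]
    [InnerProductSpace ℝ H] [CompleteSpace H] {W : Submodule ℝ (H × H × H)} {u : ℕ → W} {v : W}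
    (h₀ : ∀ y, Tendsto (fun k => inner ℝ (u k).1.1 y) atTop (𝓝 (inner ℝ v.1.1 y)))
    (h₁ : ∀ y, Tendsto (fun k => inner ℝ (u k).1.2.1 y) atTop (𝓝 (inner ℝ v.1.2.1 y)))
    (h₂ : ∀ y, Tendsto (fun k => inner ℝ (u k).1.2.2 y) atTop (𝓝 (inner ℝ v.1.2.2 y))) :
    Tendsto (fun k => toWeakSpace ℝ W (u k)) atTop (𝓝 (toWeakSpace ℝ W v)) := by
  have hcomp : ∀ l : H →L[ℝ] ℝ, ∃ y, ∀ x, l x = inner ℝ x y := fun l => by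
    refine ⟨(InnerProductSpace.toDual ℝ H).symm l, fun x => ?_⟩
    rw [real_inner_comm, InnerProductSpace.toDual_symm_apply]
  have key : ∀ f : W →L[ℝ] ℝ, Tendsto (fun k => f (u k)) atTop (𝓝 (f v)) := by
    intro f
    -- Hahn–Banach extends the functional to the product, where Riesz representation applies to each
    -- factor.
    obtain ⟨g, hg, -⟩ := exists_extension_norm_eq W f
    obtain ⟨y₀, e₀⟩ := hcomp (g.comp (ContinuousLinearMap.inl ℝ H (H × H)))
    obtain ⟨y₁, e₁⟩ := hcomp (g.comp
      ((ContinuousLinearMap.inr ℝ H (H × H)).comp (ContinuousLinearMap.inl ℝ H H)))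
    obtain ⟨y₂, e₂⟩ := hcomp (g.comp
      ((ContinuousLinearMap.inr ℝ H (H × H)).comp (ContinuousLinearMap.inr ℝ H H)))
    have hdec : ∀ w : W, f w = inner ℝ w.1.1 y₀ + inner ℝ w.1.2.1 y₁ + inner ℝ w.1.2.2 y₂ := by
      intro w
      rw [← hg w, ← e₀, ← e₁, ← e₂]
      simp only [ContinuousLinearMap.comp_apply, ContinuousLinearMap.inl_apply,
        ContinuousLinearMap.inr_apply]
      rw [← map_add, ← map_add]
      congr 1
      ext <;> simp
    simp_rw [hdec]
    exact ((h₀ y₀).add (h₁ y₁)).add (h₂ y₂)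
  change Tendsto _ _ (@nhds _ (TopologicalSpace.induced _ _) _)
  rw [nhds_induced, tendsto_comap_iff, tendsto_pi_nhds]
  exact key

/-! ### Classes of continuous functions in `L²` -/

section LTwo

variable {L : ℝ}

theorem memLp_two_of_continuous {f : ℝ → ℂ} (hf : Continuous f) :
    MemLp f 2 (volume.restrict (Ioo (0 : ℝ) L)) := by
  obtain ⟨C, hC⟩ := (isCompact_Icc (a := (0 : ℝ)) (b := L)).exists_bound_of_continuousOn
    hf.continuousOn
  refine MemLp.of_bound hf.aestronglyMeasurable C ?_
  filter_upwards [ae_restrict_mem measurableSet_Ioo] with s hs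
  exact hC s (Ioo_subset_Icc_self hs)

/-- The class in `L²(0, L)` of a continuous function. -/
noncomputable def lTwoClass (L : ℝ) {f : ℝ → ℂ} (hf : Continuous f) : LTwo L :=
  (memLp_two_of_continuous hf).toLp f

theorem coeFn_lTwoClass {f : ℝ → ℂ} (hf : Continuous f) :
    lTwoClass L hf =ᵐ[volume.restrict (Ioo (0 : ℝ) L)] f :=
  MemLp.coeFn_toLp _

theorem sq_norm_lTwoClass (hL : 0 ≤ L) {f : ℝ → ℂ} (hf : Continuous f) :
    ‖lTwoClass L hf‖ ^ 2 = ∫ s in (0 : ℝ)..L, ‖f s‖ ^ 2 := by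
  rw [← real_inner_self_eq_norm_sq, L2.inner_def, intervalIntegral.integral_of_le hL,
    integral_Ioc_eq_integral_Ioo]
  refine integral_congr_ae ?_
  filter_upwards [coeFn_lTwoClass hf] with s hs
  rw [hs, real_inner_self_eq_norm_sq]

/-- The `L²` functional dual to a continuous weight. -/
theorem inner_lTwoClass_smul {ψ : ℝ → ℝ} (hc : Continuous ψ) (hs : HasCompactSupport ψ) (v : ℂ)
    (f : LTwo L) :
    inner ℝ f (lTwoClass L (hc.smul (continuous_const (y := v)))) =
      inner ℝ v (∫ s in Ioo (0 : ℝ) L, ψ s • f s) := by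
  rw [← integral_inner (integrable_smul_of_test hc hs f), L2.inner_def]
  refine integral_congr_ae ?_
  filter_upwards [coeFn_lTwoClass (L := L) (hc.smul (continuous_const (y := v)))] with s hs'
  rw [hs', Pi.smul_apply', real_inner_smul_right, real_inner_smul_right, real_inner_comm]

/-- Weak derivatives are closed under weak convergence. -/
theorem isWeakDeriv_of_tendsto {f g : ℕ → LTwo L} {f₀ g₀ : LTwo L}
    (h : ∀ k, IsWeakDeriv L (f k) (g k))
    (hf : ∀ y, Tendsto (fun k => inner ℝ (f k) y) atTop (𝓝 (inner ℝ f₀ y)))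
    (hg : ∀ y, Tendsto (fun k => inner ℝ (g k) y) atTop (𝓝 (inner ℝ g₀ y))) :
    IsWeakDeriv L f₀ g₀ := by
  intro φ hφ
  have hd : Continuous (deriv φ) := hφ.1.continuous_deriv (by norm_num)
  refine ext_inner_left ℝ fun v => ?_
  have h1 := hf (lTwoClass L (hd.smul (continuous_const (y := v))))
  have h2 := hg (lTwoClass L (hφ.1.continuous.smul (continuous_const (y := v))))
  simp_rw [inner_lTwoClass_smul hd hφ.2.1.deriv] at h1
  simp_rw [inner_lTwoClass_smul hφ.1.continuous hφ.2.1] at h2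
  rw [inner_neg_right]
  refine tendsto_nhds_unique h1 (h2.neg.congr fun k => ?_)
  rw [h k φ hφ, inner_neg_right]

theorem isWeakDeriv_lTwoClass (hL : 0 ≤ L) {f : ℝ → ℂ} (hf : ContDiff ℝ 1 f) :
    IsWeakDeriv L (lTwoClass L hf.continuous)
      (lTwoClass L (hf.continuous_deriv (by norm_num))) := by
  intro φ hφ
  have hφ1 : ContDiff ℝ 1 φ := hφ.1.of_le (by exact_mod_cast le_top)
  have hd : Continuous (deriv φ) := hφ1.continuous_deriv (by norm_num)
  have hfd : Continuous (deriv f) := hf.continuous_deriv (by norm_num)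
  have h0 : φ 0 = 0 := image_eq_zero_of_notMem_tsupport fun h => (hφ.2.2 h).1.false
  have h1 : φ L = 0 := image_eq_zero_of_notMem_tsupport fun h => (hφ.2.2 h).2.false
  have e1 : ∫ s in Ioo (0 : ℝ) L, deriv φ s • lTwoClass L hf.continuous s =
      ∫ s in (0 : ℝ)..L, deriv φ s • f s := by
    rw [intervalIntegral.integral_of_le hL, integral_Ioc_eq_integral_Ioo]
    refine integral_congr_ae ?_
    filter_upwards [coeFn_lTwoClass (L := L) hf.continuous] with s hs
    rw [hs]
  have e2 : ∫ s in Ioo (0 : ℝ) L, φ s • lTwoClass L hfd s =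
      ∫ s in (0 : ℝ)..L, φ s • deriv f s := by
    rw [intervalIntegral.integral_of_le hL, integral_Ioc_eq_integral_Ioo]
    refine integral_congr_ae ?_
    filter_upwards [coeFn_lTwoClass (L := L) hfd] with s hs
    rw [hs]
  rw [e1, e2, eq_neg_iff_add_eq_zero, ← intervalIntegral.integral_add
    (Continuous.intervalIntegrable (by fun_prop) _ _)
    (Continuous.intervalIntegrable (by fun_prop) _ _)]
  have := intervalIntegral.integral_eq_sub_of_hasDerivAt (a := 0) (b := L)
    (f := fun s => φ s • f s) (f' := fun s => φ s • deriv f s + deriv φ s • f s)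
    (fun s _ => ((hφ1.differentiable (by norm_num) s).hasDerivAt.smul
      (hf.differentiable (by norm_num) s).hasDerivAt))
    (((hφ1.continuous.smul hfd).add (hd.smul hf.continuous)).intervalIntegrable _ _)
  rw [h0, h1, zero_smul, zero_smul, sub_zero] at this
  rw [← this]
  exact intervalIntegral.integral_congr fun s _ => add_comm _ _

/-- Bounded pointwise convergence of continuous functions implies weak convergence. -/
theorem tendsto_inner_lTwoClass {f : ℕ → ℝ → ℂ} {f₀ : ℝ → ℂ} (hf : ∀ k, Continuous (f k))
    (hf₀ : Continuous f₀) (hb : ∀ k s, ‖f k s‖ ≤ 1)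
    (hlim : ∀ s, Tendsto (fun k => f k s) atTop (𝓝 (f₀ s))) (y : LTwo L) :
    Tendsto (fun k => inner ℝ (lTwoClass L (hf k)) y) atTop (𝓝 (inner ℝ (lTwoClass L hf₀) y)) := by
  have e : ∀ {g : ℝ → ℂ} (hg : Continuous g), inner ℝ (lTwoClass L hg) y =
      ∫ s in Ioo (0 : ℝ) L, inner ℝ (g s) (y s) := by
    intro g hg
    rw [L2.inner_def]
    refine integral_congr_ae ?_
    filter_upwards [coeFn_lTwoClass (L := L) hg] with s hs
    rw [hs]
  simp_rw [e]
  have hy : Integrable y (volume.restrict (Ioo (0 : ℝ) L)) :=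
    (Lp.memLp y).integrable (by norm_num)
  refine tendsto_integral_of_dominated_convergence (fun s => ‖y s‖)
    (fun k => (hf k).aestronglyMeasurable.inner hy.1) hy.norm
    (fun k => Eventually.of_forall fun s => ?_)
    (Eventually.of_forall fun s => (hlim s).inner tendsto_const_nhds)
  refine (norm_inner_le_norm _ _).trans ?_
  exact mul_le_of_le_one_left (norm_nonneg _) (hb k s)

/-- Weak convergence in `L²` implies convergence of the primitives. -/
theorem exists_tendsto_integral_of_tendsto_inner {f : ℕ → ℝ → ℂ} (hf : ∀ k, Continuous (f k))
    {w : LTwo L}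
    (hlim : ∀ y, Tendsto (fun k => inner ℝ (lTwoClass L (hf k)) y) atTop (𝓝 (inner ℝ w y)))
    {s : ℝ} (hs : s ∈ Ico 0 L) :
    ∃ l, Tendsto (fun k => ∫ t in (0 : ℝ)..s, f k t) atTop (𝓝 l) := by
  set z : LTwo L → ℂ := fun u => ∫ t in Iic s, u t ∂(volume.restrict (Ioo (0 : ℝ) L)) with hz
  have hzk : ∀ k, z (lTwoClass L (hf k)) = ∫ t in (0 : ℝ)..s, f k t := by
    intro k
    -- The strict inequality s < L is what makes this an equality.
    have hset : Iic s ∩ Ioo 0 L = Ioc 0 s := by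
      ext t
      simp only [mem_inter_iff, mem_Iic, mem_Ioo, mem_Ioc]
      exact ⟨fun h => ⟨h.2.1, h.1⟩, fun h => ⟨h.2, h.1, h.2.trans_lt hs.2⟩⟩
    rw [intervalIntegral.integral_of_le hs.1, ← hset,
      ← Measure.restrict_restrict measurableSet_Iic]
    exact integral_congr_ae (ae_restrict_of_ae (coeFn_lTwoClass (L := L) (hf k)))
  have h1 : ∀ v : ℂ, Tendsto (fun k => (inner ℝ v (∫ t in (0 : ℝ)..s, f k t) : ℝ)) atTop
      (𝓝 (inner ℝ v (z w))) := by
    intro v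
    have := hlim (indicatorConstLp 2 (measurableSet_Iic (a := s)) (measure_ne_top _ _) v)
    simp_rw [← real_inner_comm _ (indicatorConstLp 2 _ _ v),
      L2.inner_indicatorConstLp_eq_inner_setIntegral] at this
    refine this.congr fun k => ?_
    rw [← hzk]
  refine ⟨z w, ?_⟩
  have hre := h1 1
  have him := h1 Complex.I
  have e1 : ∀ z : ℂ, (inner ℝ (1 : ℂ) z : ℝ) = z.re := fun z => by simp [Complex.inner]
  have e2 : ∀ z : ℂ, (inner ℝ Complex.I z : ℝ) = z.im := fun z => by simp [Complex.inner]
  simp only [e1] at hre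
  simp only [e2] at him
  have h2 := (((Complex.continuous_ofReal.tendsto _).comp hre).add
    (((Complex.continuous_ofReal.tendsto _).comp him).mul_const Complex.I))
  simpa only [Function.comp_def, Complex.re_add_im] using h2

end LTwo

/-! ### Compactness of curves of bounded bending energy -/

section Compactness

variable {L : ℝ}

/-- A pointwise limit of the tangents of curves of bounded energy is continuous. -/
theorem continuous_of_tendsto_deriv (hL : 0 < L) {g : ℕ → ℝ → ℂ} (hg : ∀ k, g k ∈ admissible L)
    {M : ℝ} (hM : ∀ k, bendingEnergy L (g k) ≤ M) {T : ℝ → ℂ}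
    (hT : ∀ s, Tendsto (fun k => deriv (g k) s) atTop (𝓝 (T s))) : Continuous T := by
  have hbd : ∀ s t, |s - t| ≤ L → ‖T s - T t‖ ≤ √(|s - t| * M) := by
    intro s t hst
    refine le_of_tendsto ((hT s).sub (hT t)).norm (Eventually.of_forall fun k => ?_)
    refine Real.le_sqrt_of_sq_le ((sq_norm_deriv_sub_le (hg k) hst).trans ?_)
    exact mul_le_mul_of_nonneg_left (hM k) (abs_nonneg _)
  refine continuous_iff_continuousAt.mpr fun t => ?_
  rw [ContinuousAt, tendsto_iff_norm_sub_tendsto_zero]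
  have h0 : Tendsto (fun s : ℝ => √(|s - t| * M)) (𝓝 t) (𝓝 0) := by
    have hc : Continuous fun s : ℝ => √(|s - t| * M) := by fun_prop
    simpa using hc.tendsto t
  refine squeeze_zero' (Eventually.of_forall fun s => norm_nonneg _) ?_ h0
  filter_upwards [Metric.closedBall_mem_nhds t hL] with s hs
  exact hbd s t (by rwa [Metric.mem_closedBall, Real.dist_eq] at hs)

/-- Convergence of the initial points and of the tangents implies uniform convergence. -/
theorem exists_limit_of_tendsto_deriv {g : ℕ → ℝ → ℂ} (hg : ∀ k, IsArcCurve L (g k)) {T : ℝ → ℂ}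
    (hTc : Continuous T) (hT : ∀ s, Tendsto (fun k => deriv (g k) s) atTop (𝓝 (T s))) {p : ℂ}
    (hp : Tendsto (fun k => g k 0) atTop (𝓝 p)) :
    ∃ γ, IsArcCurve L γ ∧ (∀ s, deriv γ s = T s) ∧
      (∀ s, Tendsto (fun k => g k s) atTop (𝓝 (γ s))) ∧
      ∀ ε > 0, ∀ᶠ k in atTop, ∀ s, ‖g k s - γ s‖ < ε := by
  have hL : 0 < L := (hg 0).pos
  have hftc : ∀ k s, g k s = g k 0 + ∫ t in (0 : ℝ)..s, deriv (g k) t := by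
    intro k s
    rw [intervalIntegral.integral_deriv_eq_sub
      (fun u _ => ((hg k).hasDerivAt u).differentiableAt)
      ((hg k).continuous_deriv.intervalIntegrable _ _)]
    ring
  set γ : ℝ → ℂ := fun s => p + ∫ t in (0 : ℝ)..s, T t with hγ
  have hder : ∀ s, HasDerivAt γ (T s) s := fun s =>
    (intervalIntegral.integral_hasDerivAt_right (hTc.intervalIntegrable _ _)
      hTc.aestronglyMeasurable.stronglyMeasurableAtFilter hTc.continuousAt).const_add p
  have hTn : ∀ s, ‖T s‖ = 1 := fun s =>
    tendsto_nhds_unique (hT s).norm (tendsto_const_nhds.congr fun k => ((hg k).norm_deriv s).symm)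
  have hlim : ∀ s, Tendsto (fun k => g k s) atTop (𝓝 (γ s)) := by
    intro s
    simp_rw [fun k => hftc k s]
    refine hp.add (intervalIntegral.tendsto_integral_filter_of_dominated_convergence (fun _ => 1)
      (Eventually.of_forall fun k => (hg k).continuous_deriv.aestronglyMeasurable)
      (Eventually.of_forall fun k => ae_of_all _ fun u _ => ((hg k).norm_deriv u).le)
      intervalIntegrable_const (ae_of_all _ fun u _ => hT u))
  have hper : Function.Periodic γ L := fun s =>
    tendsto_nhds_unique (hlim (s + L)) ((hlim s).congr fun k => ((hg k).periodic s).symm)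
  have hderiv : deriv γ = T := funext fun s => (hder s).deriv
  refine ⟨γ, ⟨hL, ?_, hper, fun s => by rw [hderiv, hTn]⟩, fun s => by rw [hderiv], hlim, ?_⟩
  · rw [contDiff_one_iff_deriv]
    exact ⟨fun s => (hder s).differentiableAt, by rwa [hderiv]⟩
  · intro ε hε
    -- L¹ convergence of the tangents over one period, together with convergence of the initial
    -- points, controls the distance uniformly in s.
    have hD : Tendsto (fun k => ∫ t in (0 : ℝ)..L, ‖deriv (g k) t - T t‖) atTop (𝓝 0) := by
      have := intervalIntegral.tendsto_integral_filter_of_dominated_convergence (μ := volume)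
        (a := 0) (b := L) (l := atTop) (F := fun k t => ‖deriv (g k) t - T t‖) (f := fun _ => 0)
        (fun _ => 2)
        (Eventually.of_forall fun k =>
          ((hg k).continuous_deriv.sub hTc).norm.aestronglyMeasurable)
        (Eventually.of_forall fun k => ae_of_all _ fun u _ => by
          rw [norm_norm]
          refine (norm_sub_le _ _).trans ?_
          rw [(hg k).norm_deriv, hTn]; norm_num)
        intervalIntegrable_const (ae_of_all _ fun u _ => by
          simpa using ((hT u).sub_const (T u)).norm)
      simpa using this
    have hp0 : Tendsto (fun k => ‖g k 0 - p‖) atTop (𝓝 0) := by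
      simpa using (hp.sub_const p).norm
    have hsum := hp0.add hD
    rw [add_zero] at hsum
    filter_upwards [hsum.eventually (gt_mem_nhds hε)] with k hk s
    have hperk : Function.Periodic (fun s => g k s - γ s) L := fun s => by
      simp only [(hg k).periodic s, hper s]
    obtain ⟨t, ht, hst⟩ := hperk.exists_mem_Ico₀ hL s
    rw [hst]
    refine lt_of_le_of_lt ?_ hk
    have e : g k t - γ t = (g k 0 - p) + ∫ u in (0 : ℝ)..t, (deriv (g k) u - T u) := by
      rw [intervalIntegral.integral_sub ((hg k).continuous_deriv.intervalIntegrable _ _)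
        (hTc.intervalIntegrable _ _), hftc k t]
      simp only [hγ]; ring
    rw [e]
    refine (norm_add_le _ _).trans (add_le_add le_rfl ?_)
    refine (intervalIntegral.norm_integral_le_integral_norm ht.1).trans ?_
    exact intervalIntegral.integral_mono_interval le_rfl ht.1 ht.2.le
      (Eventually.of_forall fun u => norm_nonneg _)
      (((hg k).continuous_deriv.sub hTc).norm.intervalIntegrable _ _)

/-- Two extractions suffice: the second derivatives converge weakly in L², and the initial points
and initial tangents converge. The tangents and the curves are then recovered by integration, so
their convergence needs no further subsequence. -/
theorem exists_subseq_limit (hL : 0 < L) {γs : ℕ → ℝ → ℂ} (hadm : ∀ k, γs k ∈ admissible L)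
    {M : ℝ} (hM : ∀ k, bendingEnergy L (γs k) ≤ M) :
    ∃ (φ : ℕ → ℕ) (γ : ℝ → ℂ), StrictMono φ ∧ IsArcCurve L γ ∧
      WeaklyConvergesW22 L (fun k => γs (φ k)) γ ∧
      (∀ s, Tendsto (fun k => deriv (γs (φ k)) s) atTop (𝓝 (deriv γ s))) ∧
      (∀ ε > 0, ∀ᶠ k in atTop, ∀ s, ‖γs (φ k) s - γ s‖ < ε) := by
  have : Fact ((2 : ENNReal) ≠ ⊤) := ⟨by norm_num⟩
  have harc : ∀ k, IsArcCurve L (γs k) := fun k => isArcCurve_of_admissible hL (hadm k)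
  have hd1 : ∀ k, ContDiff ℝ 1 (deriv (γs k)) := fun k => contDiff_deriv_of_admissible (hadm k)
  have hd2 : ∀ k, Continuous (deriv (deriv (γs k))) := fun k =>
    (hd1 k).continuous_deriv (by norm_num)
  have hbd : ∀ k, ‖lTwoClass L (hd2 k)‖ ≤ √M := by
    intro k
    refine Real.le_sqrt_of_sq_le ?_
    rw [sq_norm_lTwoClass hL.le, ← bendingEnergy_eq]
    exact hM k
  obtain ⟨φ₁, w, hφ₁, hw⟩ := exists_subseq_tendsto_inner hbd
  obtain ⟨⟨p, q⟩, -, φ₂, hφ₂, hpq⟩ := (isCompact_closedBall (0 : ℂ × ℂ) 1).tendsto_subseq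
    (x := fun k => (γs (φ₁ k) 0, deriv (γs (φ₁ k)) 0)) (fun k => by
      rw [mem_closedBall_zero_iff, Prod.norm_def]
      exact max_le (norm_lt_one_of_admissible hL (hadm _) 0).le ((harc _).norm_deriv 0).le)
  have hp := (continuous_fst.tendsto _).comp hpq
  have hq := (continuous_snd.tendsto _).comp hpq
  simp only [Function.comp_def] at hp hq
  set φ : ℕ → ℕ := fun k => φ₁ (φ₂ k) with hφ
  have hw' : ∀ y, Tendsto (fun k => inner ℝ (lTwoClass L (hd2 (φ k))) y) atTop
      (𝓝 (inner ℝ w y)) := fun y => (hw y).comp hφ₂.tendsto_atTop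
  have hex : ∀ s, ∃ l, Tendsto (fun k => deriv (γs (φ k)) s) atTop (𝓝 l) := by
    intro s
    have h0 : ∀ t ∈ Ico 0 L, ∃ l, Tendsto (fun k => deriv (γs (φ k)) t) atTop (𝓝 l) := by
      intro t ht
      obtain ⟨l, hl⟩ := exists_tendsto_integral_of_tendsto_inner (fun k => hd2 (φ k)) hw' ht
      refine ⟨q + l, (hq.add hl).congr fun k => ?_⟩
      rw [intervalIntegral.integral_deriv_eq_sub
        (fun u _ => (hd1 _).differentiable (by norm_num) u) ((hd2 _).intervalIntegrable _ _)]
      ring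
    have hmem := sub_toIcoDiv_zsmul_mem_Ico hL 0 s
    rw [zero_add] at hmem
    obtain ⟨l, hl⟩ := h0 _ hmem
    refine ⟨l, hl.congr fun k => ?_⟩
    exact (periodic_deriv (harc (φ k)).periodic).sub_zsmul_eq _
  choose T hT using hex
  have hTc := continuous_of_tendsto_deriv hL (fun k => hadm (φ k)) (fun k => hM (φ k)) hT
  obtain ⟨γ, hγ, hγT, hlim, hunif⟩ :=
    exists_limit_of_tendsto_deriv (fun k => harc (φ k)) hTc hT hp
  have hT' : ∀ s, Tendsto (fun k => deriv (γs (φ k)) s) atTop (𝓝 (deriv γ s)) := fun s => by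
    rw [hγT]; exact hT s
  refine ⟨φ, γ, fun a b hab => hφ₁ (hφ₂ hab), hγ, ?_, hT', hunif⟩
  have l0 := tendsto_inner_lTwoClass (L := L) (fun k => (harc (φ k)).continuous) hγ.continuous
    (fun k s => (norm_lt_one_of_admissible hL (hadm _) s).le) hlim
  have l1 := tendsto_inner_lTwoClass (L := L) (fun k => (harc (φ k)).continuous_deriv)
    hγ.continuous_deriv (fun k s => ((harc _).norm_deriv s).le) hT'
  have w1 : ∀ k, IsWeakDeriv L (lTwoClass L (harc k).continuous)
      (lTwoClass L (harc k).continuous_deriv) := fun k =>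
    isWeakDeriv_lTwoClass hL.le (harc k).contDiff
  have w2 : ∀ k, IsWeakDeriv L (lTwoClass L (harc k).continuous_deriv) (lTwoClass L (hd2 k)) :=
    fun k => isWeakDeriv_lTwoClass hL.le (hd1 k)
  refine ⟨fun k => ⟨(_, _, _), w1 (φ k), w2 (φ k)⟩,
    ⟨(lTwoClass L hγ.continuous, lTwoClass L hγ.continuous_deriv, w),
      isWeakDeriv_of_tendsto (fun k => w1 (φ k)) l0 l1,
      isWeakDeriv_of_tendsto (fun k => w2 (φ k)) l1 hw'⟩,
    fun k => coeFn_lTwoClass (harc (φ k)).continuous, coeFn_lTwoClass hγ.continuous, ?_⟩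
  exact tendsto_toWeakSpace_of_forall_inner l0 l1 hw'

end Compactness

/-! ### Tangential contact -/

/-- Lagrange's identity: for unit vectors the squares of the inner and cross products add up to 1,
so the inner product is ±1. -/
theorem eq_or_eq_neg_of_cross_eq_zero {a b : ℂ} (ha : ‖a‖ = 1) (hb : ‖b‖ = 1)
    (h : a.re * b.im - a.im * b.re = 0) : a = b ∨ a = -b := by
  have h1 : a.re ^ 2 + a.im ^ 2 = 1 := by
    rw [← Complex.sq_norm_sub_sq_re a, ha]; ring
  have h2 : b.re ^ 2 + b.im ^ 2 = 1 := by
    rw [← Complex.sq_norm_sub_sq_re b, hb]; ring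
  have h3 : (a.re * b.re + a.im * b.im) ^ 2 = 1 ^ 2 := by
    linear_combination (b.re ^ 2 + b.im ^ 2) * h1 + h2 - (a.re * b.im - a.im * b.re) * h
  rcases sq_eq_sq_iff_eq_or_eq_neg.mp h3 with h4 | h4
  · left
    have h5 : (a.re - b.re) ^ 2 + (a.im - b.im) ^ 2 = 0 := by linarith
    apply Complex.ext <;> nlinarith [sq_nonneg (a.re - b.re), sq_nonneg (a.im - b.im)]
  · right
    have h5 : (a.re + b.re) ^ 2 + (a.im + b.im) ^ 2 = 0 := by linarith
    apply Complex.ext <;> simp only [Complex.neg_re, Complex.neg_im] <;>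
      nlinarith [sq_nonneg (a.re + b.re), sq_nonneg (a.im + b.im)]

/-- The differential of `(a, b) ↦ γ a - γ b`. -/
noncomputable def tangentDifference (u v : ℂ) : ℝ × ℝ →L[ℝ] ℂ :=
  (ContinuousLinearMap.fst ℝ ℝ ℝ).smulRight u - (ContinuousLinearMap.snd ℝ ℝ ℝ).smulRight v

theorem tangentDifference_apply (u v : ℂ) (p : ℝ × ℝ) :
    tangentDifference u v p = p.1 • u - p.2 • v := rfl

/-- Cramer's rule. -/
theorem range_tangentDifference {u v : ℂ} (h : u.re * v.im - u.im * v.re ≠ 0) :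
    (tangentDifference u v).range = ⊤ := by
  rw [LinearMap.range_eq_top]
  intro w
  refine ⟨((w.re * v.im - w.im * v.re) / (u.re * v.im - u.im * v.re),
    (w.re * u.im - w.im * u.re) / (u.re * v.im - u.im * v.re)), ?_⟩
  change tangentDifference u v _ = w
  rw [tangentDifference_apply]
  apply Complex.ext
  · simp only [Complex.sub_re, Complex.smul_re, smul_eq_mul]
    rw [div_mul_eq_mul_div, div_mul_eq_mul_div, ← sub_div, div_eq_iff h]
    ring
  · simp only [Complex.sub_im, Complex.smul_im, smul_eq_mul]
    rw [div_mul_eq_mul_div, div_mul_eq_mul_div, ← sub_div, div_eq_iff h]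
    ring

namespace IsArcCurve

variable {L : ℝ} {γ : ℝ → ℂ}

theorem norm_sub_sub_le (h : IsArcCurve L γ) {s ρ κ : ℝ} {T : ℂ}
    (hd : ∀ a ∈ Metric.closedBall s ρ, ‖deriv γ a - T‖ ≤ κ) {a a' : ℝ}
    (ha : a ∈ Metric.closedBall s ρ) (ha' : a' ∈ Metric.closedBall s ρ) :
    ‖γ a - γ a' - (a - a') • T‖ ≤ κ * |a - a'| := by
  have h1 : ∀ u ∈ Metric.closedBall s ρ,
      HasDerivWithinAt (fun u : ℝ => γ u - u • T) (deriv γ u - T) (Metric.closedBall s ρ) u := by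
    intro u _
    have := (h.hasDerivAt u).sub ((hasDerivAt_id u).smul_const T)
    rw [one_smul] at this
    exact this.hasDerivWithinAt
  have h2 := (convex_closedBall s ρ).norm_image_sub_le_of_norm_hasDerivWithin_le h1 hd ha' ha
  have h3 : γ a - γ a' - (a - a') • T = γ a - a • T - (γ a' - a' • T) := by
    rw [sub_smul]; abel
  rw [h3]
  exact h2

/-- A limit of simple curves has no transversal self-contacts. -/
theorem deriv_eq_or_eq_neg_of_limit {g : ℕ → ℝ → ℂ} (hg : ∀ k, IsArcCurve L (g k))
    (hinj : ∀ k, InjOn (g k) (Ico 0 L)) {M : ℝ}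
    (hM : ∀ k s t, |s - t| ≤ L → ‖deriv (g k) s - deriv (g k) t‖ ^ 2 ≤ |s - t| * M)
    (hγ : IsArcCurve L γ) (hlim : ∀ s, Tendsto (fun k => g k s) atTop (𝓝 (γ s)))
    (hlim' : ∀ s, Tendsto (fun k => deriv (g k) s) atTop (𝓝 (deriv γ s))) {s t : ℝ}
    (hst : γ s = γ t) : deriv γ s = deriv γ t ∨ deriv γ s = -deriv γ t := by
  have hL := hγ.pos
  set u := deriv γ s with hu
  set v := deriv γ t with hv
  by_contra hne
  have hD : u.re * v.im - u.im * v.re ≠ 0 := fun h0 =>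
    hne (eq_or_eq_neg_of_cross_eq_zero (hγ.norm_deriv s) (hγ.norm_deriv t) h0)
  have huv : 0 < ‖u - v‖ := norm_pos_iff.mpr (sub_ne_zero.mpr fun h => hne (Or.inl h))
  set R := (tangentDifference u v).nonlinearRightInverseOfSurjective (range_tangentDifference hD)
    with hR
  have hN : 0 < R.nnnorm := ContinuousLinearMap.nonlinearRightInverseOfSurjective_nnnorm_pos _ _
  have hN' : (0 : ℝ) < (R.nnnorm : ℝ)⁻¹ := by positivity
  -- The first bound keeps the linearization error 2κ below the inverse norm of R, so the map is
  -- locally onto; the second contradicts ‖u − v‖ ≤ 2κ at the end.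
  set κ : ℝ := min ((R.nnnorm : ℝ)⁻¹ / 4) (‖u - v‖ / 4) with hκ
  have hκ0 : 0 < κ := by positivity
  obtain ⟨ρ, hρM, hρL, hρ⟩ : ∃ ρ : ℝ, √(ρ * M) < κ / 2 ∧ ρ < L ∧ 0 < ρ := by
    have hc : Continuous fun ρ : ℝ => √(ρ * M) := by fun_prop
    have h0 : Tendsto (fun ρ : ℝ => √(ρ * M)) (𝓝[>] 0) (𝓝 0) := by
      have := (hc.tendsto 0).mono_left (nhdsWithin_le_nhds (s := Ioi 0))
      simpa using this
    exact ((h0.eventually (gt_mem_nhds (half_pos hκ0))).and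
      (((eventually_lt_nhds hL).filter_mono nhdsWithin_le_nhds).and self_mem_nhdsWithin)).exists
  have hclose : ∀ r, ∀ᶠ k in atTop, ∀ a ∈ Metric.closedBall r ρ,
      ‖deriv (g k) a - deriv γ r‖ ≤ κ := by
    intro r
    have h0 : Tendsto (fun k => ‖deriv (g k) r - deriv γ r‖) atTop (𝓝 0) := by
      simpa using ((hlim' r).sub_const (deriv γ r)).norm
    filter_upwards [h0.eventually (gt_mem_nhds (half_pos hκ0))] with k hk a ha
    rw [Metric.mem_closedBall, Real.dist_eq] at ha
    have h1 : ‖deriv (g k) a - deriv (g k) r‖ ^ 2 ≤ ρ * M := by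
      refine (hM k a r (by linarith)).trans ?_
      have hM0 : 0 ≤ M := by
        have h2 := hM k L 0 (by simp [abs_of_pos hL])
        rw [sub_zero, abs_of_pos hL] at h2
        exact nonneg_of_mul_nonneg_right ((sq_nonneg _).trans h2) hL
      exact mul_le_mul_of_nonneg_right ha hM0
    have h2 := Real.le_sqrt_of_sq_le h1
    calc ‖deriv (g k) a - deriv γ r‖
        ≤ ‖deriv (g k) a - deriv (g k) r‖ + ‖deriv (g k) r - deriv γ r‖ :=
          norm_sub_le_norm_sub_add_norm_sub _ _ _
      _ ≤ κ := by linarith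
  have hF0 : Tendsto (fun k => ‖g k s - g k t‖) atTop (𝓝 0) := by
    have := ((hlim s).sub (hlim t)).norm
    rwa [hst, sub_self, norm_zero] at this
  -- Radius of the disk around the value at (s, t) that the image of the ball of radius ρ must
  -- cover.
  set ε₀ := ((R.nnnorm : ℝ)⁻¹ - 2 * κ) * ρ with hε₀
  have hκN : κ ≤ (R.nnnorm : ℝ)⁻¹ / 4 := min_le_left _ _
  have hκuv : κ ≤ ‖u - v‖ / 4 := min_le_right _ _
  have hε₀' : 0 < ε₀ := mul_pos (by linarith) hρ
  obtain ⟨k, hk1, hk2, hk3⟩ := ((hclose s).and ((hclose t).and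
    (hF0.eventually (gt_mem_nhds hε₀')))).exists
  have happ : ApproximatesLinearOn (fun p : ℝ × ℝ => g k p.1 - g k p.2) (tangentDifference u v)
      (Metric.closedBall (s, t) ρ) (2 * κ).toNNReal := by
    intro p hp q hq
    rw [← closedBall_prod_same] at hp hq
    have e1 := (hg k).norm_sub_sub_le hk1 hp.1 hq.1
    have e2 := (hg k).norm_sub_sub_le hk2 hp.2 hq.2
    have e3 : |p.1 - q.1| ≤ ‖p - q‖ := norm_fst_le (p - q)
    have e4 : |p.2 - q.2| ≤ ‖p - q‖ := norm_snd_le (p - q)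
    have e5 : g k p.1 - g k p.2 - (g k q.1 - g k q.2) - tangentDifference u v (p - q) =
        (g k p.1 - g k q.1 - (p.1 - q.1) • u) - (g k p.2 - g k q.2 - (p.2 - q.2) • v) := by
      rw [tangentDifference_apply, Prod.fst_sub, Prod.snd_sub]
      abel
    rw [e5, Real.coe_toNNReal _ (by positivity)]
    refine (norm_sub_le _ _).trans ?_
    nlinarith
  obtain ⟨⟨a, b⟩, hab, h0⟩ := happ.surjOn_closedBall_of_nonlinearRightInverse R hρ.le le_rfl
    (show (0 : ℂ) ∈ _ by
      rw [mem_closedBall_iff_norm, zero_sub, norm_neg, Real.coe_toNNReal _ (by positivity)]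
      exact hk3.le)
  rw [← closedBall_prod_same] at hab
  -- The zero may have a and b equal modulo L, so it need not violate injectivity. The contradiction
  -- comes from the tangents: they coincide at a and b, yet are κ-close to u and to v.
  obtain ⟨n, hn⟩ := (hg k).exists_int_of_eq (hinj k) (sub_eq_zero.mp h0)
  have hder : deriv (g k) b = deriv (g k) a := by
    rw [show b = a + n * L from hn]
    exact ((periodic_deriv (hg k).periodic).int_mul n) a
  have i1 := hk1 a hab.1
  have i2 := hk2 b hab.2
  rw [hder] at i2
  have i3 : ‖u - v‖ ≤ ‖deriv (g k) a - u‖ + ‖deriv (g k) a - v‖ := by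
    rw [norm_sub_rev (deriv (g k) a) u]
    exact norm_sub_le_norm_sub_add_norm_sub _ _ _
  linarith

/-- At a contact point |γ|² attains its maximum over the curve. -/
theorem inner_deriv_eq_zero (h : IsArcCurve L γ) (hb : ∀ s, ‖γ s‖ ≤ 1) {s : ℝ} (hs : ‖γ s‖ = 1) :
    inner ℝ (γ s) (deriv γ s) = 0 := by
  have hmax : IsLocalMax (fun t => ‖γ t‖ ^ 2) s := Eventually.of_forall fun t => by
    simp only [hs]
    exact pow_le_pow_left₀ (norm_nonneg _) (hb t) 2
  have := hmax.hasDerivAt_eq_zero (h.hasDerivAt s).norm_sq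
  linarith

/-! ### Convergence of the enclosed regions -/

/-- Uniform convergence keeps the approximating curves at half the distance of γ from z, which
bounds the integrands for dominated convergence. -/
theorem tendsto_wind {g : ℕ → ℝ → ℂ} (hg : ∀ k, IsArcCurve L (g k)) (hγ : IsArcCurve L γ)
    (hlim' : ∀ s, Tendsto (fun k => deriv (g k) s) atTop (𝓝 (deriv γ s)))
    (hunif : ∀ ε > 0, ∀ᶠ k in atTop, ∀ s, ‖g k s - γ s‖ < ε) {z : ℂ} (hz : z ∉ range γ) :
    (∀ᶠ k in atTop, z ∉ range (g k)) ∧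
      Tendsto (fun k => wind L (g k) z) atTop (𝓝 (wind L γ z)) := by
  obtain ⟨d, hd, hdb⟩ := hγ.exists_forall_le_norm_sub hz
  have hfar : ∀ᶠ k in atTop, ∀ s, d / 2 ≤ ‖g k s - z‖ := by
    filter_upwards [hunif (d / 2) (half_pos hd)] with k hk s
    have h1 := hk s
    have h2 : ‖γ s - z‖ ≤ ‖g k s - z‖ + ‖g k s - γ s‖ := by
      rw [norm_sub_rev (g k s) (γ s), add_comm]
      exact norm_sub_le_norm_sub_add_norm_sub _ _ _
    linarith [hdb s]
  have hnot : ∀ᶠ k in atTop, z ∉ range (g k) := by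
    filter_upwards [hfar] with k hk
    rintro ⟨s, rfl⟩
    have := hk s
    rw [sub_self, norm_zero] at this
    linarith
  refine ⟨hnot, Tendsto.const_mul _ ?_⟩
  refine intervalIntegral.tendsto_integral_filter_of_dominated_convergence (fun _ => (d / 2)⁻¹)
    ?_ ?_ intervalIntegrable_const (ae_of_all _ fun s _ => ?_)
  · filter_upwards [hnot] with k hk
    exact ((hg k).continuous_windIntegrand hk).aestronglyMeasurable
  · filter_upwards [hfar] with k hk
    refine ae_of_all _ fun s _ => ?_
    rw [norm_div, (hg k).norm_deriv, one_div]
    exact inv_anti₀ (half_pos hd) (hk s)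
  · have h0 : Tendsto (fun k => g k s) atTop (𝓝 (γ s)) := by
      rw [Metric.tendsto_atTop']
      intro ε hε
      obtain ⟨N, hN⟩ := eventually_atTop.mp (hunif ε hε)
      exact ⟨N, fun k hk => by rw [dist_eq_norm]; exact hN k hk.le s⟩
    refine (hlim' s).div (h0.sub_const z) (sub_ne_zero.mpr fun h => hz ⟨s, h⟩)

end IsArcCurve

/-! ### Convergence of characteristic functions in L¹ -/

theorem enorm_charFn_sub_le {A B K : Set ℂ} (hA : A ⊆ K) (hB : B ⊆ K) (z : ℂ) :
    ‖(charFn A - charFn B) z‖ₑ ≤ K.indicator (fun _ => 1) z := by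
  rw [Pi.sub_apply]
  by_cases hz : z ∈ K
  · rw [indicator_of_mem hz]
    by_cases h1 : z ∈ A <;> by_cases h2 : z ∈ B <;> simp [charFn, h1, h2]
  · have h1 : z ∉ A := fun h => hz (hA h)
    have h2 : z ∉ B := fun h => hz (hB h)
    simp [charFn, h1, h2]

/-- Pointwise almost everywhere convergence of the enclosed regions in a bounded set implies
convergence in `L¹`. -/
theorem tendsto_eLpNorm_charFn {A : ℕ → Set ℂ} {E K : Set ℂ} (hA : ∀ k, MeasurableSet (A k))
    (hE : MeasurableSet E) (hK : MeasurableSet K) (hKf : volume K ≠ ⊤) (hAK : ∀ k, A k ⊆ K)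
    (hEK : E ⊆ K) (hlim : ∀ᵐ z : ℂ, ∀ᶠ k in atTop, z ∈ A k ↔ z ∈ E) :
    Tendsto (fun k => eLpNorm (charFn (A k) - charFn E) 1 volume) atTop (𝓝 0) := by
  simp_rw [eLpNorm_one_eq_lintegral_enorm]
  have hm : ∀ {B : Set ℂ}, MeasurableSet B → Measurable (charFn B) := fun hB =>
    measurable_const.indicator hB
  have := tendsto_lintegral_of_dominated_convergence (μ := volume)
    (F := fun k z => ‖(charFn (A k) - charFn E) z‖ₑ) (f := fun _ => 0)
    (K.indicator fun _ => 1) (fun k => ((hm (hA k)).sub (hm hE)).enorm)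
    (fun k => ae_of_all _ fun z => enorm_charFn_sub_le (hAK k) hEK z)
    (by rw [lintegral_indicator hK, setLIntegral_one]; exact hKf) ?_
  · simpa using this
  · filter_upwards [hlim] with z hz
    refine tendsto_const_nhds.congr' ?_
    filter_upwards [hz] with k hk
    by_cases h : z ∈ E <;> simp [charFn, hk, h]

end ConfinedElastica

/-! ### The proposition -/

theorem proposition2p1 (L : ℝ) (hL : 0 < L) (γs : ℕ → ℝ → ℂ) (hγs : IsMinimalSequence L γs) :
    ∃ (φ : ℕ → ℕ) (γ : ℝ → ℂ) (E : Set ℂ), StrictMono φ ∧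
      WeaklyConvergesW22 L (fun k => γs (φ k)) γ ∧
      IsClosedCurve 1 L γ ∧
      γ '' Icc 0 L ⊆ Metric.closedBall 0 1 ∧
      (∀ s ∈ Icc 0 L, ‖deriv γ s‖ = 1) ∧
      TouchesCircleTangentially L γ ∧
      NoTransversalCrossings L γ ∧
      Tendsto (fun k => eLpNorm (charFn (enclosed L (γs (φ k))) - charFn E) 1 volume)
        atTop (𝓝 0) ∧
      E ⊆ Metric.closedBall 0 1 ∧
      HasFinitePerimeter E ∧
      reducedBoundary E ⊆ γ '' Icc 0 L ∧
      ∃ c : ℝ → ℂ, (c = γ ∨ c = fun s => γ (L - s)) ∧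
        ∀ᵐ x ∂(Measure.hausdorffMeasure 1 : Measure ℂ), x ∈ reducedBoundary E →
          (preimages L c x).Finite ∧
            innerNormal E x = ∑ᶠ s ∈ preimages L c x, perp (deriv c s) := by
  obtain ⟨hadm, hen⟩ := hγs
  obtain ⟨M, hM⟩ := hen.bddAbove_range
  have hM : ∀ k, bendingEnergy L (γs k) ≤ M := fun k => hM (mem_range_self k)
  have harc : ∀ k, IsArcCurve L (γs k) := fun k => isArcCurve_of_admissible hL (hadm k)
  have hlt : ∀ k s, ‖γs k s‖ < 1 := fun k => norm_lt_one_of_admissible hL (hadm k)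
  have horient := fun k => (harc k).exists_wind_eq (hadm k).2.1 (hlt k)
  choose τ hτ hτw using horient
  -- One of the two orientations occurs infinitely often; the subsequence keeps only curves with
  -- that orientation.
  obtain ⟨σ, hσ, φ₀, hφ₀, hφσ⟩ : ∃ σ : ℂ, (σ = 1 ∨ σ = -1) ∧
      ∃ φ₀ : ℕ → ℕ, StrictMono φ₀ ∧ ∀ k, τ (φ₀ k) = σ := by
    by_cases h1 : ∃ᶠ k in atTop, τ k = 1
    · exact ⟨1, Or.inl rfl, extraction_of_frequently_atTop h1⟩
    · rw [not_frequently] at h1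
      exact ⟨-1, Or.inr rfl, extraction_of_frequently_atTop
        (h1.mono fun k hk => (hτ k).resolve_left hk).frequently⟩
  obtain ⟨φ₁, γ, hφ₁, hγ, hweak, hlim', hunif⟩ :=
    exists_subseq_limit hL (fun k => hadm (φ₀ k)) (fun k => hM (φ₀ k))
  set g : ℕ → ℝ → ℂ := fun k => γs (φ₀ (φ₁ k)) with hg
  have hgarc : ∀ k, IsArcCurve L (g k) := fun k => harc _
  have hgadm : ∀ k, g k ∈ admissible L := fun k => hadm _
  have hgw : ∀ k, ∀ z ∉ range (g k), (wind L (g k) z = 0 ∨ wind L (g k) z = σ) ∧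
      (z ∈ enclosed L (g k) ↔ wind L (g k) z = σ) := fun k z hz => by
    have := hτw (φ₀ (φ₁ k)) z hz
    rwa [hφσ] at this
  have hσ0 : σ ≠ 0 := by rcases hσ with rfl | rfl <;> norm_num
  have hlim : ∀ s, Tendsto (fun k => g k s) atTop (𝓝 (γ s)) := fun s => by
    rw [Metric.tendsto_nhds]
    intro ε hε
    filter_upwards [hunif ε hε] with k hk
    rw [dist_eq_norm]
    exact hk s
  have hle : ∀ s, ‖γ s‖ ≤ 1 := fun s =>
    le_of_tendsto (hlim s).norm (Eventually.of_forall fun k => (hlt _ s).le)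
  have htan : ∀ s t, γ s = γ t → deriv γ s = deriv γ t ∨ deriv γ s = -deriv γ t :=
    fun s t hst => IsArcCurve.deriv_eq_or_eq_neg_of_limit hgarc (fun k => (hgadm k).2.1)
      (fun k s t hst => (sq_norm_deriv_sub_le (hgadm k) hst).trans
        (mul_le_mul_of_nonneg_left (hM _) (abs_nonneg _))) hγ hlim hlim' hst
  have hwlim := fun z (hz : z ∉ range γ) => IsArcCurve.tendsto_wind hgarc hγ hlim' hunif hz
  -- The winding numbers of the approximating curves lie in the closed set {0, σ}, hence so does
  -- their limit.
  have hw : ∀ z ∉ range γ, wind L γ z = 0 ∨ wind L γ z = σ := by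
    intro z hz
    have hcl : IsClosed ({0, σ} : Set ℂ) := (toFinite _).isClosed
    exact hcl.mem_of_tendsto (hwlim z hz).2
      ((hwlim z hz).1.mono fun k hk => (hgw k z hk).1)
  set E : Set ℂ := {z | z ∉ range γ ∧ wind L γ z = σ} with hE
  have hEo : IsOpen E := by simpa only [mem_singleton_iff] using hγ.isOpen_wind_eq {σ}
  have hEb : E ⊆ Metric.closedBall 0 1 := by
    intro z hz
    rw [mem_closedBall_zero_iff]
    by_contra hgt
    push Not at hgt
    have h0 : wind L γ z = 0 := tendsto_nhds_unique (hwlim z hz.1).2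
      (tendsto_const_nhds.congr fun k =>
        ((hgarc k).wind_eq_zero_of_one_le_norm (hlt _) hgt.le).symm)
    exact hσ0 (hz.2.symm.trans h0)
  have henc : ∀ k, enclosed L (g k) = {z | z ∉ range (g k) ∧ wind L (g k) z = σ} := by
    intro k
    ext z
    constructor
    · intro hz
      have hz' : z ∉ range (g k) := by rw [← (hgarc k).image_Icc]; exact hz.1
      exact ⟨hz', (hgw k z hz').2.mp hz⟩
    · exact fun hz => (hgw k z hz.1).2.mpr hz.2
  have hencm : ∀ k, MeasurableSet (enclosed L (g k)) := fun k => by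
    rw [henc]
    have : IsOpen {z | z ∉ range (g k) ∧ wind L (g k) z = σ} := by
      simpa using (hgarc k).isOpen_wind_eq {σ}
    exact this.measurableSet
  have hencb : ∀ k, enclosed L (g k) ⊆ Metric.closedBall 0 1 := by
    intro k z hz
    rw [henc] at hz
    rw [mem_closedBall_zero_iff]
    by_contra hgt
    push Not at hgt
    exact hσ0 (hz.2.symm.trans ((hgarc k).wind_eq_zero_of_one_le_norm (hlt _) hgt.le))
  have hL1 : Tendsto (fun k => eLpNorm (charFn (enclosed L (g k)) - charFn E) 1 volume)
      atTop (𝓝 0) := by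
    refine tendsto_eLpNorm_charFn hencm hEo.measurableSet measurableSet_closedBall
      (measure_closedBall_lt_top (x := (0 : ℂ)) (r := 1)).ne hencb hEb ?_
    filter_upwards [hγ.ae_notMem_range] with z hz
    obtain ⟨hk1, hk2⟩ := hwlim z hz
    -- Two values in {0, σ} at distance less than |σ| are equal, so membership of z is eventually
    -- constant.
    have hne : ∀ᶠ k in atTop, ‖wind L (g k) z - wind L γ z‖ < ‖σ‖ := by
      have := (tendsto_iff_norm_sub_tendsto_zero.mp hk2)
      exact this.eventually (gt_mem_nhds (norm_pos_iff.mpr hσ0))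
    filter_upwards [hk1, hne] with k hk hkn
    rw [(hgw k z hk).2]
    have hzE : z ∈ E ↔ wind L γ z = σ := ⟨fun h => h.2, fun h => ⟨hz, h⟩⟩
    rw [hzE]
    rcases (hgw k z hk).1 with h1 | h1 <;> rcases hw z hz with h2 | h2 <;> rw [h1, h2] at hkn ⊢
    · simp at hkn
    · simp at hkn
  -- For σ = 1 the reversed curve winds clockwise around E; for σ = −1 the curve γ already does.
  obtain ⟨c, hc, hcarc, hcr, hctan, hcE, hcw⟩ : ∃ c : ℝ → ℂ, (c = γ ∨ c = fun s => γ (L - s)) ∧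
      IsArcCurve L c ∧ range c = range γ ∧
      (∀ s t, c s = c t → deriv c s = deriv c t ∨ deriv c s = -deriv c t) ∧
      clockwiseSet L c = E ∧ ∀ z ∉ range c, wind L c z = 0 ∨ wind L c z = -1 := by
    rcases hσ with rfl | rfl
    · refine ⟨fun s => γ (L - s), Or.inr rfl, hγ.reverse, IsArcCurve.range_reverse L γ,
        fun s t hst => ?_, ?_, fun z hz => ?_⟩
      · rw [IsArcCurve.deriv_reverse, IsArcCurve.deriv_reverse, neg_inj, neg_inj]
        exact htan _ _ hst
      · ext z
        rw [clockwiseSet, mem_ofPred_eq, IsArcCurve.range_reverse, IsArcCurve.wind_reverse, neg_inj]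
        rfl
      · rw [IsArcCurve.range_reverse] at hz
        rw [IsArcCurve.wind_reverse, neg_eq_zero, neg_inj]
        exact hw z hz
    · exact ⟨γ, Or.inl rfl, hγ, rfl, htan, rfl, hw⟩
  refine ⟨fun k => φ₀ (φ₁ k), γ, E, fun a b hab => hφ₀ (hφ₁ hab), hweak, ⟨hγ.contDiff, hγ.periodic⟩,
    ?_, fun s _ => hγ.norm_deriv s, fun s _ hs => hγ.inner_deriv_eq_zero hle hs, ?_, hL1, hEb,
    ?_, ?_, c, hc, ?_⟩
  · rintro _ ⟨s, -, rfl⟩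
    exact mem_closedBall_zero_iff.mpr (hle s)
  · intro s _ t _ hst
    rcases htan s t hst with h | h
    · rw [h]
    · rw [h, ← Set.neg_singleton, Submodule.span_neg]
  · rw [← hcE]
    exact hcarc.hasFinitePerimeter_clockwiseSet hcw
  · rw [hγ.image_Icc, ← hcr, ← hcE]
    exact hcarc.reducedBoundary_clockwiseSet_subset hcw
  -- No exceptional set arises: the formula holds at every point of the reduced boundary.
  · refine ae_of_all _ fun x hx => ⟨hcarc.finite_preimages x, ?_⟩
    rw [← hcE] at hx ⊢
    exact hcarc.innerNormal_clockwiseSet hcw hctan hx
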